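/- Let $\widehat f(\omega)=\frac1{\sqrt{2\pi}}\int_{\mathbb R}f(t)e^{-it\omega}\,dt$ be the (unitary) Fourier transform on $L^2(\mathbb R)$, and let $$h_k(x)=\frac{1}{\pi^{1/4}\sqrt{2^k k!}}\,e^{x^2/2}\,\frac{d^k}{dx^k}e^{-x^2}\qquad(k\ge 0)$$ be the Hermite functions. For $\alpha>0$ let $h_k^\alpha(x)=\alpha^{-1/2}h_k(x/\alpha)$ be the scaled Hermite functions and, for $f\in L^2(\mathbb R)$, $$K_n^\alpha f=\sum_{k=0}^n\langle f,h_k^\alpha\rangle h_k^\alpha,\qquad \langle f,h_k^\alpha\rangle=\int_{\mathbb R}f(y)h_k^\alpha(y)\,dy .$$ Let $\alpha>0$, $T\ge 2$, $c\ge 2/\alpha$ and $\varepsilon_T,\varepsilon_{c/\alpha}\ge 0$, and let $f\in L^2(\mathbb R)$ (complex valued) be $\varepsilon_T$-almost time limited to $[-T,T]$ and $\varepsilon_{c/\alpha}$-almost band limited to $[-c/\alpha,c/\alpha]$, that is, $$\int_{|t|>T}|f(t)|^2\,dt\le\varepsilon_T^2\|f\|_{L^2(\mathbb R)}^2\quad\text{and}\quad\int_{|\omega|>c/\alpha}|\widehat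 f(\omega)|^2\,d\omega\le\varepsilon_{c/\alpha}^2\|f\|_{L^2(\mathbb R)}^2 .$$ Then for every integer $n\ge\max\bigl(2(T/\alpha)^2,\,2c^2\bigr)$, $$\|f-K_n^\alpha f\|_{L^2([-T,T])}\le\left(\varepsilon_T+\varepsilon_{c/\alpha}+\frac{24\,(T/\alpha)^3}{\sqrt{2n+1}}\right)\|f\|_{L^2(\mathbb R)} .$$ -/

import Mathlib

open MeasureTheory
open scoped FourierTransform

/-- The Fourier transform on `L²(ℝ)` in the unitary normalization
`(2π)^(-1/2) ∫ f(t) exp(-i t ω) dt`, obtained from Mathlib's Plancherel transform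
(kernel `exp(-2π i t ξ)`) by the substitution `ξ = ω / (2π)`. -/
noncomputable def unitaryFourier (f : Lp ℂ 2 (volume : Measure ℝ)) (ω : ℝ) : ℂ :=
  ((1 / Real.sqrt (2 * Real.pi) : ℝ) : ℂ) *
    (𝓕 f : Lp ℂ 2 (volume : Measure ℝ)) (ω / (2 * Real.pi))

/-- `f` is `ε`-almost time limited to `[-T, T]`. -/
def IsAlmostTimeLimited (ε T : ℝ) (f : Lp ℂ 2 (volume : Measure ℝ)) : Prop :=
  ∫ t in {t : ℝ | T < |t|}, ‖f t‖ ^ 2 ≤ ε ^ 2 * ‖f‖ ^ 2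

/-- `f` is `ε`-almost band limited to `[-Ω, Ω]`. -/
def IsAlmostBandLimited (ε Ω : ℝ) (f : Lp ℂ 2 (volume : Measure ℝ)) : Prop :=
  ∫ ω in {ω : ℝ | Ω < |ω|}, ‖unitaryFourier f ω‖ ^ 2 ≤ ε ^ 2 * ‖f‖ ^ 2

/-- The `n`-th Hermite polynomial `exp(x²) (d/dx)ⁿ exp(-x²)`, as a function. -/
noncomputable def hermitePoly (n : ℕ) (x : ℝ) : ℝ :=
  Real.exp (x ^ 2) * iteratedDeriv n (fun t : ℝ => Real.exp (-t ^ 2)) x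

/-- The `n`-th (`L²`-normalized) Hermite function. -/
noncomputable def hermiteFun (n : ℕ) (x : ℝ) : ℝ :=
  1 / (Real.pi ^ (1 / 4 : ℝ) * Real.sqrt (2 ^ n * (n.factorial : ℝ))) *
    hermitePoly n x * Real.exp (-x ^ 2 / 2)

/-- The scaled Hermite function `α^(-1/2) h_k(x / α)`. -/
noncomputable def scaledHermiteFun (α : ℝ) (k : ℕ) (x : ℝ) : ℝ :=
  α ^ (-(1 / 2) : ℝ) * hermiteFun k (x / α)

/-- The projection `∑_{k=0}^n ⟨f, h_k^α⟩ h_k^α` of `f`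
onto the first `n + 1` scaled Hermite functions. -/
noncomputable def scaledHermiteProj (α : ℝ) (n : ℕ) (f : Lp ℂ 2 (volume : Measure ℝ))
    (x : ℝ) : ℂ :=
  ∑ k ∈ Finset.range (n + 1),
    (∫ y : ℝ, f y * (scaledHermiteFun α k y : ℂ)) * (scaledHermiteFun α k x : ℂ)

/-! Put `b = √(2n+2)` and `t = (T/α) b`, and let `A`, `Q`, `K` be the orthogonal projections onto
functions living on `[-T, T]`, onto the band `[-c/α, c/α]`, and onto the first `n+1` scaled Hermite
functions. In units of `α`, the range of `K` fills a phase-space disc of radius about `b`, while `n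
≥ 2c²` and `n ≥ 2(T/α)²` put the rectangle `[-T/α, T/α] × [-c, c]` well inside it. So `K` should
nearly fix whatever `A` and `Q` nearly fix. The work lies in keeping coefficient exactly 1 in front
of both `ε`'s and in obtaining the explicit remainder `24 (T/α)³ / b`, which is smaller than the one
claimed. Two regimes need different arguments.

Large `t` (`t ≥ 2.2`): let `Φ` be a Fourier multiplier with a smooth cutoff that is 1 on `|ω| ≤ b/2`
and 0 beyond `0.7 b`. Write `f = (f - Φf) + Φ(f - Af) + ΦAf`. The first two pieces cost at most `‖f
- Qf‖` and `‖f - Af‖`. The transform of the third is a cutoff times a slowly varying function, and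
Hermite functions are eigenfunctions of the Fourier transform. Green's formula for the Hermite
operator bounds its coefficients of index above `n`: each application divides by at least `2n+3`,
whereas multiplication by `ω²` costs only `0.49 b²` on the support, so iteration gives a convergent
series (`norm_hermiteTail_cutoff_le`).

Small `t` (`t ≤ 2.2`): on the short window the kernel of `K` is compared with the sinc kernel of
`[-b, b]` (`abs_hermiteKernel_sub_le`), through the Christoffel–Darboux formula and the slowly
varying factor of `h_n - i h_{n+1}`; Wallis' product controls the amplitude. Since `c ≤ b/2`, energy
discarded between `c` and `b` absorbs the amplitude deficit and the oscillating correction, which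
yields `A Q A ≤ A K A + ε` (`integral_band_le_hermite`). An abstract lemma on three projections,
`IsOrthoProj.norm_apply_sub_le`, turns this into the estimate.

If the claimed remainder is at least 1, the bound is trivial, since `A` and `1 - K` are
contractions. -/

section Projections

/-! ### Three orthogonal projections in a Hilbert space -/

variable {E : Type*} [NormedAddCommGroup E] [InnerProductSpace ℂ E]

/-- A self-adjoint idempotent operator, given by its defining identities. -/
structure IsOrthoProj (A : E →L[ℂ] E) : Prop where
  symm : ∀ x y, inner ℂ (A x) y = inner ℂ x (A y)
  idem : ∀ x, A (A x) = A x

namespace IsOrthoProj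

variable {A Q K : E →L[ℂ] E}

theorem inner_self (hA : IsOrthoProj A) (x : E) : inner ℂ (A x) x = ((‖A x‖ ^ 2 : ℝ) : ℂ) := by
  rw [← hA.idem x, hA.symm, hA.idem, inner_self_eq_norm_sq_to_K]; norm_cast

theorem re_inner_self (hA : IsOrthoProj A) (x : E) : (inner ℂ (A x) x).re = ‖A x‖ ^ 2 := by
  rw [hA.inner_self]; exact Complex.ofReal_re _

theorem re_inner_self' (hA : IsOrthoProj A) (x : E) : (inner ℂ x (A x)).re = ‖A x‖ ^ 2 := by
  rw [← hA.symm, hA.re_inner_self]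

theorem compl (hA : IsOrthoProj A) : IsOrthoProj (ContinuousLinearMap.id ℂ E - A) where
  symm x y := by simp only [sub_apply, ContinuousLinearMap.id_apply, inner_sub_left, inner_sub_right, hA.symm]
  idem x := by simp [hA.idem]

theorem norm_sq_sub (hA : IsOrthoProj A) (x : E) : ‖x - A x‖ ^ 2 = ‖x‖ ^ 2 - ‖A x‖ ^ 2 := by
  rw [@norm_sub_sq ℂ]
  have := hA.re_inner_self' x
  simp only [RCLike.re_to_complex] at *
  rw [this]; ring

theorem norm_le (hA : IsOrthoProj A) (x : E) : ‖A x‖ ≤ ‖x‖ := by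
  have h := hA.norm_sq_sub x
  nlinarith [sq_nonneg ‖x - A x‖, norm_nonneg x, norm_nonneg (A x), sq_abs ‖x‖]

theorem norm_sub_le (hA : IsOrthoProj A) (x : E) : ‖x - A x‖ ≤ ‖x‖ := by
  simpa using hA.compl.norm_le x

/-- On the range of `A` the compression `A Q A` has norm at most `1 - δ < 1`, so `1 - A Q A` is
inverted by a Neumann series. The solution stays in the range of `A` because both `h` and `A Q A z`
lie there. -/
theorem exists_resolvent [CompleteSpace E] (hA : IsOrthoProj A) (hQ : IsOrthoProj Q) {δ : ℝ}
    (hδ : 0 < δ) (hδ' : δ ≤ 1) (hq : ∀ z, A z = z → ‖Q z‖ ^ 2 ≤ (1 - δ) * ‖z‖ ^ 2) (h : E)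
    (hh : A h = h) : ∃ z, A z = z ∧ z - A (Q z) = h := by
  have hd : 0 ≤ 1 - δ := by linarith
  set q : E →L[ℂ] E := A ∘L Q ∘L A with hqdef
  have hqn : ‖q‖ ≤ 1 - δ := by
    refine ContinuousLinearMap.opNorm_le_bound _ hd fun w => ?_
    set x := A w with hx
    set y := A (Q x) with hy
    have hxA : A x = x := hA.idem w
    have hyA : A y = y := hA.idem _
    -- Bounding `Q` on both `x` and `y` gains `√(1 - δ)` twice, hence the full factor `1 - δ`.
    have h1 : ‖y‖ ^ 2 ≤ ‖Q y‖ * ‖Q x‖ := by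
      have : ((‖y‖ ^ 2 : ℝ) : ℂ) = inner ℂ (Q y) (Q x) := by
        rw [hQ.symm, hQ.idem]
        conv_rhs => rw [← hyA, hA.symm, ← hy]
        rw [inner_self_eq_norm_sq_to_K]; norm_cast
      calc ‖y‖ ^ 2 = ‖((‖y‖ ^ 2 : ℝ) : ℂ)‖ := by
            rw [Complex.norm_real, Real.norm_of_nonneg (by positivity)]
        _ ≤ _ := by rw [this]; exact norm_inner_le_norm _ _
    have hy2 := hq y hyA
    have hx2 := hq x hxA
    have h2 : (‖Q y‖ * ‖Q x‖) ^ 2 ≤ ((1 - δ) * (‖y‖ * ‖x‖)) ^ 2 := by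
      calc (‖Q y‖ * ‖Q x‖) ^ 2 = ‖Q y‖ ^ 2 * ‖Q x‖ ^ 2 := by ring
        _ ≤ ((1 - δ) * ‖y‖ ^ 2) * ((1 - δ) * ‖x‖ ^ 2) := by gcongr
        _ = _ := by ring
    have h3 : ‖Q y‖ * ‖Q x‖ ≤ (1 - δ) * (‖y‖ * ‖x‖) :=
      le_of_sq_le_sq h2 (by positivity)
    have h4 : ‖y‖ ≤ (1 - δ) * ‖x‖ := by
      rcases (norm_nonneg y).eq_or_lt with h0 | h0
      · rw [← h0]; positivity
      · have : ‖y‖ * ‖y‖ ≤ ‖y‖ * ((1 - δ) * ‖x‖) := by nlinarith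
        exact le_of_mul_le_mul_left this h0
    calc ‖q w‖ = ‖y‖ := rfl
      _ ≤ (1 - δ) * ‖x‖ := h4
      _ ≤ (1 - δ) * ‖w‖ := by gcongr; exact hA.norm_le w
  have hu : ‖q‖ < 1 := by linarith
  set u := Units.oneSub q hu with hudef
  set z : E := (↑u⁻¹ : E →L[ℂ] E) h with hz
  have hzq : z - q z = h := by
    have : ((u : E →L[ℂ] E) * (↑u⁻¹ : E →L[ℂ] E)) h = h := by simp
    simpa [hudef, ContinuousLinearMap.mul_def] using this
  have hzA : A z = z := by
    have e : z = h + q z := by rw [← hzq]; abel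
    have eq : A (q z) = q z := by simp [hqdef, hA.idem]
    calc A z = A (h + q z) := by rw [← e]
      _ = h + q z := by rw [map_add, hh, eq]
      _ = z := e.symm
  refine ⟨z, hzA, ?_⟩
  conv_rhs => rw [← hzq]
  simp [hqdef, hzA]

/-- The left side is `‖K v - A K v‖²`. With `a = ‖A K v‖` one has `‖K v‖² = ⟨v, A K v⟩ ≤ a`, so it
is at most `a - a² ≤ 1/4`. -/
theorem norm_sq_apply_le (hA : IsOrthoProj A) (hK : IsOrthoProj K) {v : E} (hvA : A v = v)
    (hvn : ‖v‖ = 1) : ‖K v‖ ^ 2 - ‖A (K v)‖ ^ 2 ≤ 1 / 4 := by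
  have s2 : ‖K v‖ ^ 2 ≤ ‖A (K v)‖ := by
    calc ‖K v‖ ^ 2 = (inner ℂ v (A (K v))).re := by rw [← hA.symm, hvA, hK.re_inner_self']
      _ ≤ ‖v‖ * ‖A (K v)‖ := (Complex.re_le_norm _).trans (norm_inner_le_norm _ _)
      _ = _ := by rw [hvn, one_mul]
  linarith [sq_nonneg (‖A (K v)‖ - 1 / 2), sub_sq ‖A (K v)‖ (1 / 2)]

theorem norm_sq_sub_apply (hA : IsOrthoProj A) (hK : IsOrthoProj K) {v : E} (hvA : A v = v) :
    ‖v - A (K v)‖ ^ 2 = ‖v‖ ^ 2 - 2 * ‖K v‖ ^ 2 + ‖A (K v)‖ ^ 2 := by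
  rw [@norm_sub_sq ℂ]
  have : (inner ℂ v (A (K v))).re = ‖K v‖ ^ 2 := by rw [← hA.symm, hvA, hK.re_inner_self']
  simp only [RCLike.re_to_complex] at *
  rw [this]

/-- A vector `z` in the range of `A` for which `(1 - Q) z` and `(1 - K) v` agree after applying
`A`, together with the norm bounds coming from `A Q A ≤ A K A + ε`. -/
theorem exists_comparison_vector [CompleteSpace E] (hA : IsOrthoProj A) (hQ : IsOrthoProj Q)
    (hK : IsOrthoProj K) {δ ε : ℝ} (hδ : 0 < δ) (hδ' : δ ≤ 1) (hε : 0 ≤ ε)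
    (hq : ∀ z, A z = z → ‖Q z‖ ^ 2 ≤ (1 - δ) * ‖z‖ ^ 2)
    (hk : ∀ z, A z = z → ‖Q z‖ ^ 2 ≤ ‖K z‖ ^ 2 + ε * ‖z‖ ^ 2) {v : E} (hvA : A v = v)
    (hvn : ‖v‖ = 1) : ∃ z, A z = z ∧ z - A (Q z) = v - A (K v) ∧
      ‖z - Q z‖ ^ 2 ≤ (1 - ‖K v‖ ^ 2) * (1 + ε / δ) := by
  obtain ⟨z, hzA, hz⟩ := hA.exists_resolvent hQ hδ hδ' hq (A (v - K v)) (hA.idem _)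
  refine ⟨z, hzA, by rw [hz, map_sub, hvA], ?_⟩
  rw [hQ.norm_sq_sub]
  set Z := ‖z‖ ^ 2 - ‖Q z‖ ^ 2 with hZ
  set V := 1 - ‖K v‖ ^ 2 with hV
  have hZ0 : δ * ‖z‖ ^ 2 ≤ Z := by have := hq z hzA; rw [hZ]; linarith
  have hZnn : 0 ≤ Z := le_trans (by positivity) hZ0
  have c4 : ‖v - K v‖ ^ 2 = V := by rw [hK.norm_sq_sub, hvn, hV]; ring
  have hV0 : 0 ≤ V := by rw [← c4]; positivity
  -- `Z = ⟨z, (1 - A Q) z⟩`, and the equation for `z` replaces `(1 - A Q) z` by `A (1 - K) v`.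
  -- Idempotence of `1 - K` then puts it on both sides, ready for Cauchy–Schwarz.
  have c1 : Z = (inner ℂ (z - K z) (v - K v)).re := by
    have : (inner ℂ z (z - A (Q z))).re = Z := by
      rw [inner_sub_right, ← hA.symm, hzA, Complex.sub_re, hQ.re_inner_self',
        inner_self_eq_norm_sq_to_K, hZ]; norm_cast
    rw [← this, hz, ← hA.symm, hzA]
    have := hK.compl.symm z (v - K v)
    simp only [sub_apply, ContinuousLinearMap.id_apply, map_sub, hK.idem,
      sub_self, sub_zero] at this
    rw [this]
  have c2 : Z ≤ ‖z - K z‖ * ‖v - K v‖ := by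
    rw [c1]; exact (Complex.re_le_norm _).trans (norm_inner_le_norm _ _)
  have c3 : ‖z - K z‖ ^ 2 ≤ Z * (1 + ε / δ) := by
    rw [hK.norm_sq_sub]
    have h1 := hk z hzA
    have h2 : ε * ‖z‖ ^ 2 ≤ Z * (ε / δ) := by
      calc ε * ‖z‖ ^ 2 = (δ * ‖z‖ ^ 2) * (ε / δ) := by field_simp
        _ ≤ _ := by gcongr
    linarith
  -- `‖(1 - K) z‖²` is itself bounded by a multiple of `Z`, so one factor `Z` cancels.
  have c5 : Z * Z ≤ Z * (V * (1 + ε / δ)) := by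
    calc Z * Z ≤ (‖z - K z‖ * ‖v - K v‖) * (‖z - K z‖ * ‖v - K v‖) := by gcongr
      _ = ‖z - K z‖ ^ 2 * ‖v - K v‖ ^ 2 := by ring
      _ ≤ Z * (1 + ε / δ) * V := by rw [c4]; gcongr
      _ = _ := by ring
  rcases hZnn.eq_or_lt with h1 | h1
  · rw [← h1]; positivity
  · exact le_of_mul_le_mul_left c5 h1

/-- Write `(1 - K) v = (1 - Q) z + β` with the comparison vector `z`; its equation says `A β = 0`.
Paired with `f`, the first summand sees only `f - Q f` and the second only `f - A f`, so it remains
to bound the norms of `(1 - Q) z` and `β` by `1 + O(ε/δ)`. -/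
theorem norm_apply_sub_le_aux [CompleteSpace E] (hA : IsOrthoProj A) (hQ : IsOrthoProj Q)
    (hK : IsOrthoProj K) {δ ε : ℝ} (hδ : 0 < δ) (hδ' : δ ≤ 1) (hε : 0 ≤ ε)
    (hq : ∀ z, A z = z → ‖Q z‖ ^ 2 ≤ (1 - δ) * ‖z‖ ^ 2)
    (hk : ∀ z, A z = z → ‖Q z‖ ^ 2 ≤ ‖K z‖ ^ 2 + ε * ‖z‖ ^ 2) {v : E} (hvA : A v = v)
    (hvn : ‖v‖ = 1) (f : E) :
    ‖inner ℂ (v - K v) f‖ ≤ (1 + 1 / 2 * (ε / δ)) * ‖f - Q f‖ + (1 + ε / δ) * ‖f - A f‖ := by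
  obtain ⟨z, hzA, hz, hZ⟩ := hA.exists_comparison_vector hQ hK hδ hδ' hε hq hk hvA hvn
  have hεδ : 0 ≤ ε / δ := by positivity
  generalize ε / δ = e at *
  have n1 := hA.norm_sq_apply_le hK hvA hvn
  have n2 : (1 - ‖K v‖ ^ 2) * e ≤ e :=
    mul_le_of_le_one_left hεδ (by linarith [sq_nonneg ‖K v‖])
  have hzQ : ‖z - Q z‖ ≤ 1 + 1 / 2 * e := by
    refine le_of_sq_le_sq ?_ (by positivity)
    nlinarith [sq_nonneg ‖K v‖, sq_nonneg e]
  have b1 : ‖K v - A (K v)‖ ≤ 1 / 2 := by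
    refine le_of_sq_le_sq ?_ (by norm_num)
    rw [hA.norm_sq_sub]; linarith
  have b2 : ‖Q z - A (Q z)‖ ≤ 1 / 2 + e := by
    have e1 := hA.norm_sq_sub_apply hK hvA
    have e2 := hA.norm_sq_sub_apply hQ hzA
    rw [hQ.norm_sq_sub] at hZ
    rw [hz, e1, hvn] at e2
    refine le_of_sq_le_sq ?_ (by positivity)
    rw [hA.norm_sq_sub]
    linarith [sq_nonneg e, add_sq (1 / 2) e]
  set β := (v - K v) - (z - Q z) with hβ
  have hAβ : A β = 0 := by
    rw [hβ, map_sub, map_sub, map_sub A z, hvA, hzA, hz, sub_self]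
  have hβn : ‖β‖ ≤ 1 + e := by
    -- Applying `1 - A` to `β` removes `v` and `z`, leaving two commutator-like terms of norm at
    -- most `1/2` and `1/2 + e`.
    have h1 : β = (Q z - A (Q z)) - (K v - A (K v)) := by
      have h2 : β = β - A β := by rw [hAβ, sub_zero]
      rw [h2, hβ]; simp only [map_sub, hvA, hzA]; abel
    rw [h1]
    exact (_root_.norm_sub_le _ _).trans (by linarith)
  have main : inner ℂ (v - K v) f = inner ℂ (z - Q z) (f - Q f) + inner ℂ β (f - A f) := by
    have t2 : inner ℂ β (f - A f) = inner ℂ β f := by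
      rw [inner_sub_right, ← hA.symm, hAβ, inner_zero_left, sub_zero]
    have t3 : inner ℂ (z - Q z) (f - Q f) = inner ℂ (z - Q z) f := by
      have : inner ℂ (z - Q z) (Q f) = 0 := by
        rw [← hQ.symm, map_sub, hQ.idem, sub_self, inner_zero_left]
      rw [inner_sub_right, this, sub_zero]
    rw [t2, t3, ← inner_add_left, hβ, add_sub_cancel]
  rw [main]
  refine (norm_add_le _ _).trans (add_le_add ?_ ?_)
  · exact (norm_inner_le_norm _ _).trans (by gcongr)
  · exact (norm_inner_le_norm _ _).trans (by gcongr)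

/-- If `A Q A ≤ A K A + ε` and `A Q A ≤ 1 - δ` for orthogonal projections, then
`‖A (1 - K) f‖` is controlled by `‖(1 - Q) f‖` and `‖(1 - A) f‖`. -/
theorem norm_apply_sub_le [CompleteSpace E] (hA : IsOrthoProj A) (hQ : IsOrthoProj Q)
    (hK : IsOrthoProj K) {δ ε : ℝ} (hδ : 0 < δ) (hδ' : δ ≤ 1) (hε : 0 ≤ ε)
    (hq : ∀ z, A z = z → ‖Q z‖ ^ 2 ≤ (1 - δ) * ‖z‖ ^ 2)
    (hk : ∀ z, A z = z → ‖Q z‖ ^ 2 ≤ ‖K z‖ ^ 2 + ε * ‖z‖ ^ 2) (f : E) :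
    ‖A (f - K f)‖ ≤ ‖f - Q f‖ + ‖f - A f‖ + 3 / 2 * (ε / δ) * ‖f‖ := by
  set w := A (f - K f) with hw
  rcases eq_or_ne w 0 with h0 | h0
  · rw [h0, norm_zero]; positivity
  have hwpos : 0 < ‖w‖ := norm_pos_iff.2 h0
  have hwne : ((‖w‖ : ℝ) : ℂ) ≠ 0 := by exact_mod_cast hwpos.ne'
  -- The norm of `w` is tested on its own direction.
  obtain ⟨v, hv⟩ : ∃ v : E, v = ((‖w‖⁻¹ : ℝ) : ℂ) • w := ⟨_, rfl⟩
  have hvn : ‖v‖ = 1 := by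
    rw [hv, norm_smul, Complex.norm_real, norm_inv, norm_norm, inv_mul_cancel₀ hwpos.ne']
  have hvA : A v = v := by rw [hv, map_smul, hw, hA.idem]
  have hwv : inner ℂ v w = ((‖w‖ : ℝ) : ℂ) := by
    rw [hv, inner_smul_left, inner_self_eq_norm_sq_to_K, Complex.conj_ofReal]
    change ((‖w‖⁻¹ : ℝ) : ℂ) * ((‖w‖ : ℝ) : ℂ) ^ 2 = _
    push_cast
    rw [sq, ← mul_assoc, inv_mul_cancel₀ hwne, one_mul]
  have t1 : inner ℂ v w = inner ℂ (v - K v) f := by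
    rw [hw, ← hA.symm, hvA, inner_sub_right, inner_sub_left, hK.symm]
  have main := hA.norm_apply_sub_le_aux hQ hK hδ hδ' hε hq hk hvA hvn f
  rw [← t1, hwv, Complex.norm_real, norm_norm] at main
  have hεδ : 0 ≤ ε / δ := by positivity
  -- Only the `ε/δ` parts of the coefficients are estimated by `‖f‖`, giving `1/2 + 1 = 3/2`; the
  -- leading coefficients stay equal to 1.
  have f1 := mul_le_mul_of_nonneg_left (hQ.norm_sub_le f) hεδ
  have f2 := mul_le_mul_of_nonneg_left (hA.norm_sub_le f) hεδ
  linarith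

end IsOrthoProj

end Projections

/-! ### Hermite functions: ladder relations, orthonormality, Fourier transform -/

section HermiteFunctions

/-- The Hermite polynomials with the sign convention of `hermitePoly`, as polynomials. -/
noncomputable def hermiteP : ℕ → Polynomial ℝ
  | 0 => 1
  | n + 1 => (hermiteP n).derivative - 2 * Polynomial.X * hermiteP n

theorem hermiteP_succ (n : ℕ) :
    hermiteP (n + 1) = (hermiteP n).derivative - 2 * Polynomial.X * hermiteP n := rfl

theorem derivative_hermiteP_succ (n : ℕ) :
    (hermiteP (n + 1)).derivative = -(2 * ((n : Polynomial ℝ) + 1)) * hermiteP n := by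
  induction n with
  | zero => simp [hermiteP]
  | succ n ih =>
    rw [hermiteP_succ (n + 1), ih]
    have h : (hermiteP n).derivative = hermiteP (n + 1) + 2 * Polynomial.X * hermiteP n := by
      rw [hermiteP_succ]; ring
    have h2 : (2 : Polynomial ℝ).derivative = 0 := Polynomial.derivative_ofNat 2
    have h1 : (hermiteP (n + 1)).derivative = -(2 * ((n : Polynomial ℝ) + 1)) * hermiteP n := ih
    simp only [Polynomial.derivative_sub, Polynomial.derivative_mul, Polynomial.derivative_neg,
      Polynomial.derivative_add, Polynomial.derivative_natCast, Polynomial.derivative_one, h2,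
      Polynomial.derivative_X, h1, h]
    push_cast
    ring

theorem iteratedDeriv_exp_neg_sq (n : ℕ) :
    iteratedDeriv n (fun t : ℝ => Real.exp (-t ^ 2)) =
      fun x => (hermiteP n).eval x * Real.exp (-x ^ 2) := by
  induction n with
  | zero => simp [hermiteP]
  | succ n ih =>
    rw [iteratedDeriv_succ, ih]
    funext x
    have h1 : HasDerivAt (fun x : ℝ => Real.exp (-x ^ 2)) (Real.exp (-x ^ 2) * (-(2 * x))) x := by
      have := ((hasDerivAt_pow 2 x).neg).exp
      simpa using this
    rw [(((hermiteP n).hasDerivAt x).fun_mul h1).deriv, hermiteP_succ]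
    simp only [Polynomial.eval_sub, Polynomial.eval_mul, Polynomial.eval_X, Polynomial.eval_ofNat]
    ring

theorem hermitePoly_eq_eval (n : ℕ) (x : ℝ) : hermitePoly n x = (hermiteP n).eval x := by
  rw [hermitePoly, iteratedDeriv_exp_neg_sq, mul_left_comm, ← Real.exp_add]
  simp

/-- The normalizing constant of the `n`-th Hermite function. -/
noncomputable def hermiteConst (n : ℕ) : ℝ :=
  1 / (Real.pi ^ (1 / 4 : ℝ) * Real.sqrt (2 ^ n * (n.factorial : ℝ)))

theorem hermiteConst_pos (n : ℕ) : 0 < hermiteConst n := by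
  have := Real.pi_pos
  unfold hermiteConst; positivity

theorem hermiteConst_eq (n : ℕ) :
    hermiteConst n = Real.sqrt (2 * n + 2) * hermiteConst (n + 1) := by
  have hpi := Real.pi_pos
  have h : Real.sqrt (2 ^ (n + 1) * ((n + 1).factorial : ℝ)) =
      Real.sqrt (2 * n + 2) * Real.sqrt (2 ^ n * (n.factorial : ℝ)) := by
    rw [← Real.sqrt_mul (by positivity), Nat.factorial_succ]
    congr 1; push_cast; ring
  have h1 : 0 < Real.sqrt (2 * n + 2) := Real.sqrt_pos.2 (by positivity)
  have h2 : 0 < Real.sqrt (2 ^ n * (n.factorial : ℝ)) := Real.sqrt_pos.2 (by positivity)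
  have h3 : 0 < Real.pi ^ (1 / 4 : ℝ) := by positivity
  unfold hermiteConst
  rw [h]; field_simp

theorem hermiteFun_eq (n : ℕ) (x : ℝ) :
    hermiteFun n x = hermiteConst n * (hermiteP n).eval x * Real.exp (-x ^ 2 / 2) := by
  rw [hermiteFun, hermitePoly_eq_eval, hermiteConst]

theorem hasDerivAt_exp_neg_sq_half (x : ℝ) :
    HasDerivAt (fun x : ℝ => Real.exp (-x ^ 2 / 2)) (-x * Real.exp (-x ^ 2 / 2)) x := by
  have := (((hasDerivAt_pow 2 x).neg).div_const 2).exp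
  convert! this using 1
  simp; ring

theorem hasDerivAt_hermiteFun_aux (n : ℕ) (x : ℝ) :
    HasDerivAt (hermiteFun n)
      (hermiteConst n * (hermiteP n).derivative.eval x * Real.exp (-x ^ 2 / 2) -
        x * hermiteFun n x) x := by
  have h := (((hermiteP n).hasDerivAt x).const_mul (hermiteConst n)).mul
    (hasDerivAt_exp_neg_sq_half x)
  have e : hermiteFun n = fun x => hermiteConst n * (hermiteP n).eval x * Real.exp (-x ^ 2 / 2) :=
    funext (hermiteFun_eq n)
  rw [e]
  convert! h using 1
  ring

/-- The raising relation. The functions carry no factor `(-1)^n`, so the signs of both ladder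
relations are opposite to the customary ones. -/
theorem hasDerivAt_hermiteFun (n : ℕ) (x : ℝ) :
    HasDerivAt (hermiteFun n)
      (x * hermiteFun n x + Real.sqrt (2 * n + 2) * hermiteFun (n + 1) x) x := by
  convert! hasDerivAt_hermiteFun_aux n x using 1
  rw [hermiteFun_eq (n + 1), hermiteP_succ, hermiteFun_eq n, hermiteConst_eq n]
  simp only [Polynomial.eval_sub, Polynomial.eval_mul, Polynomial.eval_X, Polynomial.eval_ofNat]
  ring

theorem hasDerivAt_hermiteFun_succ (n : ℕ) (x : ℝ) :
    HasDerivAt (hermiteFun (n + 1))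
      (-Real.sqrt (2 * n + 2) * hermiteFun n x - x * hermiteFun (n + 1) x) x := by
  convert! hasDerivAt_hermiteFun_aux (n + 1) x using 1
  rw [derivative_hermiteP_succ, hermiteFun_eq n, hermiteConst_eq n]
  simp only [Polynomial.eval_mul, Polynomial.eval_neg, Polynomial.eval_add,
    Polynomial.eval_natCast, Polynomial.eval_one, Polynomial.eval_ofNat]
  have h : Real.sqrt (2 * n + 2) * Real.sqrt (2 * n + 2) = 2 * n + 2 :=
    Real.mul_self_sqrt (by positivity)
  linear_combination (-(hermiteConst (n + 1) * Polynomial.eval x (hermiteP n) *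
    Real.exp (-x ^ 2 / 2))) * h

/-- The three-term recurrence of the Hermite functions. -/
theorem hermiteFun_recurrence (n : ℕ) (x : ℝ) :
    2 * x * hermiteFun (n + 1) x =
      -Real.sqrt (2 * n + 2) * hermiteFun n x -
        Real.sqrt (2 * ((n + 1 : ℕ) : ℝ) + 2) * hermiteFun (n + 2) x := by
  have := (hasDerivAt_hermiteFun (n + 1) x).unique (hasDerivAt_hermiteFun_succ n x)
  linarith

theorem continuous_hermiteFun (n : ℕ) : Continuous (hermiteFun n) :=
  continuous_iff_continuousAt.2 fun x => (hasDerivAt_hermiteFun n x).continuousAt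

/-- The derivative of the `n`-th Hermite function. -/
noncomputable def hermiteFunDeriv (n : ℕ) (x : ℝ) : ℝ :=
  x * hermiteFun n x + Real.sqrt (2 * n + 2) * hermiteFun (n + 1) x

theorem continuous_hermiteFunDeriv (n : ℕ) : Continuous (hermiteFunDeriv n) :=
  (continuous_id.mul (continuous_hermiteFun n)).add
    (continuous_const.mul (continuous_hermiteFun (n + 1)))

/-- The Hermite functions satisfy `h'' = (x² - (2n+1)) h`. -/
theorem hasDerivAt_hermiteFunDeriv (n : ℕ) (x : ℝ) :
    HasDerivAt (hermiteFunDeriv n) ((x ^ 2 - (2 * n + 1)) * hermiteFun n x) x := by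
  have h := ((hasDerivAt_id x).mul (hasDerivAt_hermiteFun n x)).add
    ((hasDerivAt_hermiteFun_succ n x).const_mul (Real.sqrt (2 * n + 2)))
  convert! h using 1
  have hs : Real.sqrt (2 * n + 2) * Real.sqrt (2 * n + 2) = 2 * n + 2 :=
    Real.mul_self_sqrt (by positivity)
  simp only [id]
  linear_combination (hermiteFun n x) * hs

theorem integrable_eval_mul_exp (p : Polynomial ℝ) {b : ℝ} (hb : 0 < b) :
    Integrable fun x : ℝ => p.eval x * Real.exp (-b * x ^ 2) := by
  induction p using Polynomial.induction_on' with
  | add p q hp hq =>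
    simp only [Polynomial.eval_add, add_mul]; exact hp.add hq
  | monomial k c =>
    have := (integrable_rpow_mul_exp_neg_mul_sq hb (s := k)
      (lt_of_lt_of_le (by norm_num) (Nat.cast_nonneg k))).const_mul c
    simp only [Real.rpow_natCast] at this
    simpa only [Polynomial.eval_monomial, mul_assoc] using this

theorem integrable_eval_mul_hermiteFun (p : Polynomial ℝ) (n : ℕ) :
    Integrable fun x : ℝ => p.eval x * hermiteFun n x := by
  have := (integrable_eval_mul_exp (p * hermiteP n) (b := 1 / 2) (by norm_num)).const_mul
    (hermiteConst n)
  refine this.congr (Filter.Eventually.of_forall fun x => ?_)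
  simp only [hermiteFun_eq, Polynomial.eval_mul]
  rw [show -(1 / 2) * x ^ 2 = -x ^ 2 / 2 by ring]; ring

theorem integrable_eval_mul_hermiteFun_mul (p : Polynomial ℝ) (m n : ℕ) :
    Integrable fun x : ℝ => p.eval x * (hermiteFun m x * hermiteFun n x) := by
  have := (integrable_eval_mul_exp (p * hermiteP m * hermiteP n) (b := 1) (by norm_num)).const_mul
    (hermiteConst m * hermiteConst n)
  refine this.congr (Filter.Eventually.of_forall fun x => ?_)
  simp only [hermiteFun_eq, Polynomial.eval_mul]
  rw [show -1 * x ^ 2 = -x ^ 2 / 2 + -x ^ 2 / 2 by ring, Real.exp_add]; ring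

theorem integrable_hermiteFun (n : ℕ) : Integrable (hermiteFun n) := by
  simpa using integrable_eval_mul_hermiteFun 1 n

theorem integrable_id_mul_hermiteFun (n : ℕ) : Integrable fun x => x * hermiteFun n x := by
  simpa using integrable_eval_mul_hermiteFun Polynomial.X n

theorem integrable_hermiteFunDeriv (n : ℕ) : Integrable (hermiteFunDeriv n) :=
  (integrable_id_mul_hermiteFun n).add ((integrable_hermiteFun (n + 1)).const_mul _)

theorem integrable_hermiteFun_mul (m n : ℕ) :
    Integrable fun x => hermiteFun m x * hermiteFun n x := by
  simpa using integrable_eval_mul_hermiteFun_mul 1 m n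

/-- The Wronskian `F` has derivative `(2n - 2m) h_m h_n` by the Hermite equation, and the integral
of `F'` over the line vanishes. -/
theorem integral_hermiteFun_mul_of_ne {m n : ℕ} (h : m ≠ n) :
    ∫ x, hermiteFun m x * hermiteFun n x = 0 := by
  set F : ℝ → ℝ := fun x => hermiteFunDeriv m x * hermiteFun n x -
    hermiteFun m x * hermiteFunDeriv n x with hF
  have hd : ∀ x, HasDerivAt F ((2 * (n : ℝ) - 2 * m) * (hermiteFun m x * hermiteFun n x)) x := by
    intro x
    have hm : HasDerivAt (hermiteFun m) (hermiteFunDeriv m x) x := hasDerivAt_hermiteFun m x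
    have hn : HasDerivAt (hermiteFun n) (hermiteFunDeriv n x) x := hasDerivAt_hermiteFun n x
    have := ((hasDerivAt_hermiteFunDeriv m x).mul hn).sub
      (hm.mul (hasDerivAt_hermiteFunDeriv n x))
    convert! this using 1
    ring
  -- The terms `x h_m h_n` cancel in the Wronskian, leaving products of two Hermite functions.
  have hFi : Integrable F := by
    have e : F = fun x => Real.sqrt (2 * m + 2) * (hermiteFun (m + 1) x * hermiteFun n x) -
        Real.sqrt (2 * n + 2) * (hermiteFun m x * hermiteFun (n + 1) x) := by
      funext x; simp only [hF, hermiteFunDeriv]; ring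
    rw [e]
    exact ((integrable_hermiteFun_mul _ _).const_mul _).sub
      ((integrable_hermiteFun_mul _ _).const_mul _)
  have h0 := integral_eq_zero_of_hasDerivAt_of_integrable hd
    ((integrable_hermiteFun_mul m n).const_mul _) hFi
  rw [integral_const_mul] at h0
  have hne : (2 * (n : ℝ) - 2 * m) ≠ 0 := by
    intro h1; apply h
    have : (m : ℝ) = n := by linarith
    exact_mod_cast this
  exact (mul_eq_zero.1 h0).resolve_left hne

/-- The ladder relations make `h_{n+1}² - h_n²` a constant multiple of the derivative of `h_n
h_{n+1}`, so all norms equal that of the Gaussian `h_0`. -/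
theorem integral_hermiteFun_sq (n : ℕ) : ∫ x, hermiteFun n x * hermiteFun n x = 1 := by
  induction n with
  | zero =>
    have e : ∀ x, hermiteFun 0 x * hermiteFun 0 x =
        hermiteConst 0 ^ 2 * Real.exp (-1 * x ^ 2) := by
      intro x
      rw [hermiteFun_eq, show -1 * x ^ 2 = -x ^ 2 / 2 + -x ^ 2 / 2 by ring, Real.exp_add]
      simp [hermiteP]; ring
    simp_rw [e]
    rw [integral_const_mul, integral_gaussian, hermiteConst]
    have h1 : (Real.pi ^ (1 / 4 : ℝ)) ^ 2 = Real.sqrt Real.pi := by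
      rw [← Real.rpow_natCast, ← Real.rpow_mul Real.pi_pos.le, Real.sqrt_eq_rpow]; norm_num
    have h2 : Real.sqrt Real.pi ≠ 0 := (Real.sqrt_pos.2 Real.pi_pos).ne'
    simp only [pow_zero, Nat.factorial_zero, Nat.cast_one, mul_one, Real.sqrt_one, div_one,
      div_pow, one_pow, h1]
    field_simp
  | succ n ih =>
    have hd : ∀ x, HasDerivAt (fun x => hermiteFun n x * hermiteFun (n + 1) x)
        (Real.sqrt (2 * n + 2) * (hermiteFun (n + 1) x * hermiteFun (n + 1) x -
          hermiteFun n x * hermiteFun n x)) x := by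
      intro x
      convert! (hasDerivAt_hermiteFun n x).mul (hasDerivAt_hermiteFun_succ n x) using 1
      ring
    have h0 := integral_eq_zero_of_hasDerivAt_of_integrable hd
      (((integrable_hermiteFun_mul _ _).sub (integrable_hermiteFun_mul _ _)).const_mul _)
      (integrable_hermiteFun_mul _ _)
    have hne : Real.sqrt (2 * n + 2) ≠ 0 := (Real.sqrt_pos.2 (by positivity)).ne'
    rw [integral_const_mul, integral_sub (integrable_hermiteFun_mul _ _)
      (integrable_hermiteFun_mul _ _), ih] at h0
    have := (mul_eq_zero.1 h0).resolve_left hne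
    linarith

theorem integral_hermiteFun_mul (m n : ℕ) :
    ∫ x, hermiteFun m x * hermiteFun n x = if m = n then 1 else 0 := by
  split_ifs with h
  · rw [h, integral_hermiteFun_sq]
  · exact integral_hermiteFun_mul_of_ne h

/-- The Hermite functions are eigenfunctions of the Fourier transform. -/
theorem fourier_hermiteFun (n : ℕ) (ξ : ℝ) :
    𝓕 (fun x : ℝ => (hermiteFun n x : ℂ)) ξ =
      Real.sqrt (2 * Real.pi) * (-Complex.I) ^ n * (hermiteFun n (2 * Real.pi * ξ) : ℂ) := by
  induction n generalizing ξ with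
  | zero =>
    have hb : (0 : ℝ) < ((1 / 2 : ℂ)).re := by norm_num
    have g := fourierIntegral_gaussian hb (((-(2 * Real.pi * ξ) : ℝ)) : ℂ)
    rw [Real.fourier_real_eq_integral_exp_smul]
    have e : ∀ v : ℝ, Complex.exp (((-2 * Real.pi * v * ξ : ℝ) : ℂ) * Complex.I) •
        (hermiteFun 0 v : ℂ) = (hermiteConst 0 : ℂ) *
        (Complex.exp (Complex.I * ((-(2 * Real.pi * ξ) : ℝ) : ℂ) * v) *
          Complex.exp (-(1 / 2) * (v : ℂ) ^ 2)) := by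
      intro v
      rw [hermiteFun_eq, smul_eq_mul]
      simp only [hermiteP, Polynomial.eval_one, mul_one]
      push_cast
      rw [show (-(v : ℂ) ^ 2 / 2) = -(1 / 2) * (v : ℂ) ^ 2 by ring,
        show (-2 * (Real.pi : ℂ) * v * ξ * Complex.I) =
          Complex.I * (-(2 * Real.pi * ξ)) * v by ring]
      ring
    simp_rw [e]
    rw [integral_const_mul, g, hermiteFun_eq]
    simp only [hermiteP, Polynomial.eval_one, mul_one, pow_zero]
    have h1 : ((Real.pi : ℂ) / (1 / 2)) ^ (1 / 2 : ℂ) = (Real.sqrt (2 * Real.pi) : ℂ) := by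
      rw [Real.sqrt_eq_rpow, Complex.ofReal_cpow (by positivity)]
      push_cast; congr 1; ring
    rw [h1]
    push_cast
    rw [show -(-(2 * (Real.pi : ℂ) * ξ)) ^ 2 / (4 * (1 / 2)) = -(2 * Real.pi * ξ) ^ 2 / 2 by ring]
    ring
  | succ n ih =>
    set P : ℝ → ℂ := fun x => (hermiteFun n x : ℂ) with hP
    set s : ℝ := Real.sqrt (2 * n + 2) with hs
    have hs0 : (s : ℂ) ≠ 0 := by
      have : s ≠ 0 := (Real.sqrt_pos.2 (by positivity)).ne'
      exact_mod_cast this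
    have hPi : Integrable P := (integrable_hermiteFun n).ofReal
    have hxP : Integrable (fun x : ℝ => x • P x) := by
      have := (integrable_id_mul_hermiteFun n).ofReal (𝕜 := ℂ)
      refine this.congr (Filter.Eventually.of_forall fun x => ?_)
      simp [hP]
    have hPd : ∀ x, HasDerivAt P ((hermiteFunDeriv n x : ℝ) : ℂ) x :=
      fun x => (hasDerivAt_hermiteFun n x).ofReal_comp
    have hdP : deriv P = fun x => ((hermiteFunDeriv n x : ℝ) : ℂ) := funext fun x => (hPd x).deriv
    have hdPi : Integrable (deriv P) := by
      rw [hdP]; exact (integrable_hermiteFunDeriv n).ofReal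
    have f1 := congrFun (Real.fourier_deriv hPi (fun x => (hPd x).differentiableAt) hdPi) ξ
    have f2 := Real.hasDerivAt_fourier hPi hxP ξ
    have f3 : HasDerivAt (𝓕 P) (Real.sqrt (2 * Real.pi) * (-Complex.I) ^ n *
        ((hermiteFunDeriv n (2 * Real.pi * ξ) * (2 * Real.pi) : ℝ) : ℂ)) ξ := by
      have e : 𝓕 P = fun ξ : ℝ => Real.sqrt (2 * Real.pi) * (-Complex.I) ^ n *
        ((hermiteFun n (2 * Real.pi * ξ) : ℝ) : ℂ) := funext ih
      rw [e]
      have h1 : HasDerivAt (fun ξ : ℝ => 2 * Real.pi * ξ) (2 * Real.pi) ξ := by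
        simpa using (hasDerivAt_id ξ).const_mul (2 * Real.pi)
      have h2 : HasDerivAt (fun ξ : ℝ => hermiteFun n (2 * Real.pi * ξ))
          (hermiteFunDeriv n (2 * Real.pi * ξ) * (2 * Real.pi)) ξ :=
        (hasDerivAt_hermiteFun n (2 * Real.pi * ξ)).comp ξ h1
      exact (h2.ofReal_comp).const_mul _
    -- The transform of `x h_n` is found by differentiating the transform of `h_n` twice over: under
    -- the integral, and from the inductive hypothesis. Together with the transform of `h_n'` it
    -- gives that of `h_{n+1} = s⁻¹ (h_n' - x h_n)`.
    have f4 := f2.unique f3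
    have f5 : 𝓕 (fun x : ℝ => (-2 * Real.pi * Complex.I * x) • P x) ξ =
        (-2 * Real.pi * Complex.I) * 𝓕 (fun x : ℝ => x • P x) ξ := by
      rw [Real.fourier_real_eq, Real.fourier_real_eq, ← integral_const_mul]
      congr 1; funext v
      simp only [Circle.smul_def, smul_eq_mul, Complex.real_smul]; ring
    have hsplit : (fun x : ℝ => (hermiteFun (n + 1) x : ℂ)) =
        fun x => (s : ℂ)⁻¹ * (deriv P x - x • P x) := by
      funext x
      rw [hdP]
      simp only [hP, hermiteFunDeriv, Complex.real_smul]
      push_cast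
      rw [← hs]; field_simp; ring
    have f6 : 𝓕 (fun x : ℝ => (hermiteFun (n + 1) x : ℂ)) ξ =
        (s : ℂ)⁻¹ * (𝓕 (deriv P) ξ - 𝓕 (fun x : ℝ => x • P x) ξ) := by
      rw [hsplit, Real.fourier_real_eq, Real.fourier_real_eq, Real.fourier_real_eq,
        ← integral_sub, ← integral_const_mul]
      · congr 1; funext v
        simp only [Circle.smul_def, smul_eq_mul]; ring
      · simpa [mul_comm] using (Real.fourierIntegral_convergent_iff ξ).2 hdPi
      · simpa [mul_comm] using (Real.fourierIntegral_convergent_iff ξ).2 hxP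
    rw [f5] at f4
    have hpi : (Real.pi : ℂ) ≠ 0 := by exact_mod_cast Real.pi_ne_zero
    have f7 : 𝓕 (fun x : ℝ => x • P x) ξ = Complex.I * (Real.sqrt (2 * Real.pi) *
        (-Complex.I) ^ n * ((hermiteFunDeriv n (2 * Real.pi * ξ) : ℝ) : ℂ)) := by
      have hI : (-2 * (Real.pi : ℂ) * Complex.I) ≠ 0 := by simp [hpi]
      apply mul_left_cancel₀ hI
      rw [f4]; push_cast
      linear_combination (2 * (Real.pi : ℂ) * (Real.sqrt (2 * Real.pi) * (-Complex.I) ^ n *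
        ((hermiteFunDeriv n (2 * Real.pi * ξ) : ℝ) : ℂ))) * Complex.I_mul_I
    rw [f6, f1, f7, ih, hermiteFunDeriv, smul_eq_mul, pow_succ]
    push_cast
    rw [← hs]; field_simp; ring

end HermiteFunctions

/-! ### Values at the origin and Wallis' product -/

section HermiteZero

theorem hermiteFun_odd_zero (m : ℕ) : hermiteFun (2 * m + 1) 0 = 0 := by
  induction m with
  | zero => simp [hermiteFun_eq, hermiteP]
  | succ m ih =>
    have h := hermiteFun_recurrence (2 * m + 1) 0
    rw [ih] at h
    have hs : Real.sqrt (2 * (((2 * m + 1) + 1 : ℕ) : ℝ) + 2) ≠ 0 :=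
      (Real.sqrt_pos.2 (by positivity)).ne'
    have : Real.sqrt (2 * (((2 * m + 1) + 1 : ℕ) : ℝ) + 2) * hermiteFun (2 * m + 1 + 2) 0 = 0 := by
      linarith
    exact (mul_eq_zero.1 this).resolve_left hs

theorem hermiteFun_zero_zero_sq : Real.pi * (hermiteFun 0 0 ^ 2) ^ 2 = 1 := by
  have h1 : (Real.pi ^ (1 / 4 : ℝ)) ^ 4 = Real.pi := by
    rw [← Real.rpow_natCast, ← Real.rpow_mul Real.pi_pos.le]; norm_num
  have h2 : Real.pi ^ (1 / 4 : ℝ) ≠ 0 := (Real.rpow_pos_of_pos Real.pi_pos _).ne'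
  have : hermiteFun 0 0 = 1 / Real.pi ^ (1 / 4 : ℝ) := by
    simp [hermiteFun_eq, hermiteP, hermiteConst]
  rw [this]
  calc _ = Real.pi / (Real.pi ^ (1 / 4 : ℝ)) ^ 4 := by field_simp
    _ = 1 := by rw [h1, div_self Real.pi_ne_zero]

theorem hermiteFun_even_zero_succ (m : ℕ) :
    (2 * (m : ℝ) + 2) * hermiteFun (2 * (m + 1)) 0 ^ 2 =
      (2 * m + 1) * hermiteFun (2 * m) 0 ^ 2 := by
  have h := hermiteFun_recurrence (2 * m) 0
  have e1 : Real.sqrt (2 * ((2 * m : ℕ) : ℝ) + 2) ^ 2 = 2 * (2 * m + 1) := by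
    rw [Real.sq_sqrt (by positivity)]; push_cast; ring
  have e2 : Real.sqrt (2 * ((2 * m + 1 : ℕ) : ℝ) + 2) ^ 2 = 2 * (2 * m + 2) := by
    rw [Real.sq_sqrt (by positivity)]; push_cast; ring
  have h2 : Real.sqrt (2 * ((2 * m + 1 : ℕ) : ℝ) + 2) * hermiteFun (2 * m + 2) 0 =
      -(Real.sqrt (2 * ((2 * m : ℕ) : ℝ) + 2) * hermiteFun (2 * m) 0) := by linarith
  have h3 := congrArg (· ^ 2) h2
  simp only [neg_sq, mul_pow, e1, e2] at h3
  rw [show 2 * (m + 1) = 2 * m + 2 by ring]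
  linarith

/-- `π ^ 2 h_{2m}(0) ^ 4`, the square of the normalized central binomial coefficient times `π`. -/
noncomputable def hermiteZero (m : ℕ) : ℝ := Real.pi ^ 2 * (hermiteFun (2 * m) 0 ^ 2) ^ 2

theorem hermiteZero_nonneg (m : ℕ) : 0 ≤ hermiteZero m := by unfold hermiteZero; positivity

theorem hermiteZero_succ (m : ℕ) :
    (2 * (m : ℝ) + 2) ^ 2 * hermiteZero (m + 1) = (2 * m + 1) ^ 2 * hermiteZero m := by
  have h := congrArg (· ^ 2) (hermiteFun_even_zero_succ m)
  simp only [mul_pow] at h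
  unfold hermiteZero
  linear_combination Real.pi ^ 2 * h

theorem hermiteZero_succ' (m : ℕ) :
    hermiteZero (m + 1) = ((2 * m + 1) / (2 * m + 2)) ^ 2 * hermiteZero m := by
  have := hermiteZero_succ m
  rw [div_pow, div_mul_eq_mul_div, eq_div_iff (by positivity), ← this]; ring

/-- Both sides obey the same one-step recursion in `m`. This supplies the exact limit in the two
bounds below. -/
theorem hermiteZero_mul_wallis (m : ℕ) :
    hermiteZero m * (2 * m + 1) = Real.pi / Real.Wallis.W m := by
  rw [eq_div_iff (Real.Wallis.W_pos m).ne']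
  induction m with
  | zero =>
    have := hermiteFun_zero_zero_sq
    simp only [hermiteZero, Real.Wallis.W]
    simp
    linear_combination Real.pi * this
  | succ m ih =>
    rw [Real.Wallis.W_succ, hermiteZero_succ', ← ih]
    push_cast
    field_simp; ring

open Filter Topology in
theorem tendsto_hermiteZero_mul (q : ℕ → ℝ)
    (hq : Tendsto (fun m : ℕ => q m / (2 * m + 1)) atTop (𝓝 (1 / 2))) :
    Tendsto (fun m => hermiteZero m * q m) atTop (𝓝 1) := by
  have h1 : Tendsto (fun m => hermiteZero m * (2 * m + 1)) atTop (𝓝 (Real.pi / (Real.pi / 2))) := by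
    simp_rw [hermiteZero_mul_wallis]
    exact tendsto_const_nhds.div Real.Wallis.tendsto_W_nhds_pi_div_two (by positivity)
  have h2 := h1.mul hq
  have e : Real.pi / (Real.pi / 2) * (1 / 2) = 1 := by
    have := Real.pi_ne_zero
    field_simp
  rw [e] at h2
  refine h2.congr fun m => ?_
  have : (2 * (m : ℝ) + 1) ≠ 0 := by positivity
  field_simp

open Filter Topology in
-- The product increases to its limit 1. The shift `1/4` is the second term in the expansion of `1 /
-- hermiteZero m` in powers of `1/m`; the companion lower bound adds the third term, `1/(32 m)`, for
-- which the product decreases to 1 instead.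
theorem hermiteZero_mul_le_one (m : ℕ) : hermiteZero m * (m + 1 / 4) ≤ 1 := by
  have hmono : Monotone fun m : ℕ => hermiteZero m * (m + 1 / 4) := by
    refine monotone_nat_of_le_succ fun m => ?_
    rw [hermiteZero_succ']
    have h0 := hermiteZero_nonneg m
    have : (m : ℝ) + 1 / 4 ≤ ((2 * m + 1) / (2 * m + 2)) ^ 2 * (((m + 1 : ℕ) : ℝ) + 1 / 4) := by
      rw [div_pow, div_mul_eq_mul_div, le_div_iff₀ (by positivity)]
      have : (0 : ℝ) ≤ m := Nat.cast_nonneg m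
      push_cast
      nlinarith
    calc _ ≤ hermiteZero m * (((2 * m + 1) / (2 * m + 2)) ^ 2 * (((m + 1 : ℕ) : ℝ) + 1 / 4)) := by
          gcongr
      _ = _ := by ring
  refine hmono.ge_of_tendsto (tendsto_hermiteZero_mul _ ?_) m
  have h : Tendsto (fun m : ℕ => (1 : ℝ) / 2 - 1 / 4 * (1 / (2 * m + 1))) atTop
      (𝓝 (1 / 2 - 1 / 4 * 0)) := by
    refine tendsto_const_nhds.sub (Tendsto.const_mul _ ?_)
    refine tendsto_const_nhds.div_atTop ?_
    exact tendsto_atTop_add_const_right _ _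
      (tendsto_natCast_atTop_atTop.const_mul_atTop (by norm_num))
  rw [mul_zero, sub_zero] at h
  refine h.congr fun m => ?_
  have : (2 * (m : ℝ) + 1) ≠ 0 := by positivity
  field_simp; ring

open Filter Topology in
theorem one_le_hermiteZero_mul (m : ℕ) :
    1 ≤ hermiteZero (m + 1) * ((m + 1) + 1 / 4 + 1 / (32 * (m + 1))) := by
  have hanti : Antitone fun m : ℕ =>
      hermiteZero (m + 1) * ((m + 1 : ℝ) + 1 / 4 + 1 / (32 * (m + 1))) := by
    refine antitone_nat_of_succ_le fun m => ?_
    rw [hermiteZero_succ' (m + 1)]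
    have h0 := hermiteZero_nonneg (m + 1)
    have hm : (0 : ℝ) ≤ m := Nat.cast_nonneg m
    have : ((2 * ((m + 1 : ℕ) : ℝ) + 1) / (2 * ((m + 1 : ℕ) : ℝ) + 2)) ^ 2 *
        ((((m + 1 : ℕ) : ℝ) + 1) + 1 / 4 + 1 / (32 * (((m + 1 : ℕ) : ℝ) + 1))) ≤
        (m + 1) + 1 / 4 + 1 / (32 * (m + 1)) := by
      push_cast
      rw [← sub_nonneg]
      have : (m : ℝ) + 1 + 1 / 4 + 1 / (32 * (m + 1)) -
          ((2 * ((m : ℝ) + 1) + 1) / (2 * (m + 1) + 2)) ^ 2 *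
            ((m + 1 + 1) + 1 / 4 + 1 / (32 * (m + 1 + 1))) =
          (3 * m + 7) / (128 * (m + 1) * (m + 2) ^ 3) := by
        field_simp; ring
      rw [this]; positivity
    calc _ = hermiteZero (m + 1) * (((2 * ((m + 1 : ℕ) : ℝ) + 1) /
          (2 * ((m + 1 : ℕ) : ℝ) + 2)) ^ 2 *
        ((((m + 1 : ℕ) : ℝ) + 1) + 1 / 4 + 1 / (32 * (((m + 1 : ℕ) : ℝ) + 1)))) := by ring
      _ ≤ _ := by gcongr
  have hlim : Tendsto (fun m : ℕ => hermiteZero (m + 1) *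
      (((m + 1 : ℕ) : ℝ) + 1 / 4 + 1 / (32 * ((m + 1 : ℕ) : ℝ)))) atTop (𝓝 1) := by
    refine (tendsto_hermiteZero_mul
      (fun m : ℕ => (m : ℝ) + 1 / 4 + 1 / (32 * (m : ℝ))) ?_).comp (tendsto_add_atTop_nat 1)
    have hd : Tendsto (fun m : ℕ => 2 * (m : ℝ) + 1) atTop atTop :=
      tendsto_atTop_add_const_right _ _
        (tendsto_natCast_atTop_atTop.const_mul_atTop (by norm_num))
    have h1 : Tendsto (fun m : ℕ => (1 : ℝ) / 2 - 1 / 4 * (1 / (2 * m + 1)) +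
        1 / (32 * m) * (1 / (2 * m + 1))) atTop (𝓝 (1 / 2 - 1 / 4 * 0 + 0 * 0)) := by
      refine (tendsto_const_nhds.sub ((tendsto_const_nhds.div_atTop hd).const_mul _)).add ?_
      refine Tendsto.mul ?_ (tendsto_const_nhds.div_atTop hd)
      exact tendsto_const_nhds.div_atTop
        (tendsto_natCast_atTop_atTop.const_mul_atTop (by norm_num))
    simp only [mul_zero, sub_zero, add_zero] at h1
    refine h1.congr' ?_
    filter_upwards [eventually_gt_atTop 0] with m hm
    have : (0 : ℝ) < m := by exact_mod_cast hm
    field_simp; ring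
  have := hanti.le_of_tendsto (b := m) (a := 1) (by simpa using hlim)
  simpa using this

/-- The squared modulus at the origin of `h_n - i h_{n+1}`. -/
noncomputable def hermiteAmp (n : ℕ) : ℝ := hermiteFun n 0 ^ 2 + hermiteFun (n + 1) 0 ^ 2

theorem hermiteAmp_nonneg (n : ℕ) : 0 ≤ hermiteAmp n := by unfold hermiteAmp; positivity

theorem hermiteAmp_even (m : ℕ) : Real.pi ^ 2 * hermiteAmp (2 * m) ^ 2 = hermiteZero m := by
  rw [hermiteAmp, hermiteFun_odd_zero, hermiteZero]; ring

theorem hermiteAmp_odd (m : ℕ) :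
    Real.pi ^ 2 * hermiteAmp (2 * m + 1) ^ 2 = hermiteZero (m + 1) := by
  rw [hermiteAmp, hermiteFun_odd_zero, hermiteZero, show 2 * m + 1 + 1 = 2 * (m + 1) by ring]; ring

/-- The square is at most `(m + 1/2)/(m + 1/4)` for `n = 2m` and below 1 for odd `n`. The worst case
is `n = 2`, with `1.2 ≤ 1.1²`. -/
theorem hermiteAmp_upper {n : ℕ} (hn : 1 ≤ n) :
    Real.pi * Real.sqrt (2 * n + 2) * hermiteAmp n / 2 ≤ 1.1 := by
  refine le_of_sq_le_sq ?_ (by norm_num)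
  have e : (Real.pi * Real.sqrt (2 * n + 2) * hermiteAmp n / 2) ^ 2 =
      (Real.pi ^ 2 * hermiteAmp n ^ 2) * (2 * n + 2) / 4 := by
    rw [div_pow, mul_pow, mul_pow, Real.sq_sqrt (by positivity)]; ring
  rw [e]
  rcases Nat.even_or_odd' n with ⟨m, rfl | rfl⟩
  · rw [hermiteAmp_even]
    have h := hermiteZero_mul_le_one m
    have h0 := hermiteZero_nonneg m
    have hm : (1 : ℝ) ≤ m := by exact_mod_cast (by omega : 1 ≤ m)
    push_cast
    nlinarith
  · rw [hermiteAmp_odd]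
    have h := hermiteZero_mul_le_one (m + 1)
    have h0 := hermiteZero_nonneg (m + 1)
    have hm : (0 : ℝ) ≤ m := Nat.cast_nonneg m
    push_cast at h ⊢
    nlinarith

/-- This product is, up to the factor `1/π`, the coefficient of the sinc kernel in the expansion of
the Hermite kernel. The factor with `(-1)^n` cancels the parity dependence of the amplitude at order
`1/b²`, so the deficit is only of order `1/b⁴`, with `b² = 2n+2`. -/
theorem hermiteAmp_lower {n : ℕ} (hn : 1 ≤ n) :
    1 - 0.3 / (2 * n + 2) ^ 2 ≤ Real.pi * Real.sqrt (2 * n + 2) * hermiteAmp n / 2 *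
      (1 - (-1) ^ n / (2 * (2 * n + 2))) := by
  have hr := hermiteAmp_nonneg n
  have hn0 : (0 : ℝ) ≤ n := Nat.cast_nonneg n
  have e : (Real.pi * Real.sqrt (2 * n + 2) * hermiteAmp n / 2 *
      (1 - (-1) ^ n / (2 * (2 * n + 2)))) ^ 2 =
      (Real.pi ^ 2 * hermiteAmp n ^ 2) * ((2 * n + 2) / 4 *
        (1 - (-1) ^ n / (2 * (2 * n + 2))) ^ 2) := by
    rw [mul_pow, div_pow, mul_pow, mul_pow, Real.sq_sqrt (by positivity)]; ring
  have hpos : (0 : ℝ) ≤ 1 - (-1) ^ n / (2 * (2 * n + 2)) := by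
    have h1 : ((-1 : ℝ)) ^ n ≤ 1 := by
      rcases neg_one_pow_eq_or ℝ n with h | h <;> rw [h]; norm_num
    have : ((-1 : ℝ)) ^ n / (2 * (2 * n + 2)) ≤ 1 := by
      rw [div_le_one (by positivity)]; linarith
    linarith
  refine le_of_sq_le_sq ?_ (by have := Real.pi_pos; positivity)
  rw [e]
  rcases Nat.even_or_odd' n with ⟨m, rfl | rfl⟩
  · obtain ⟨k, rfl⟩ : ∃ k, m = k + 1 := ⟨m - 1, by omega⟩
    rw [hermiteAmp_even, (even_two_mul _).neg_one_pow]
    have h := one_le_hermiteZero_mul k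
    have hk : (0 : ℝ) ≤ k := Nat.cast_nonneg k
    have key : (1 - 0.3 / (2 * ((2 * (k + 1) : ℕ) : ℝ) + 2) ^ 2) ^ 2 *
        ((k + 1) + 1 / 4 + 1 / (32 * (k + 1))) ≤
        (2 * ((2 * (k + 1) : ℕ) : ℝ) + 2) / 4 *
          (1 - 1 / (2 * (2 * ((2 * (k + 1) : ℕ) : ℝ) + 2))) ^ 2 := by
      push_cast
      rw [← sub_nonneg]
      -- Over a common denominator the difference has a numerator with positive coefficients only.
      rw [show _ - _ = (1791 / 3200 + 7119 / 400 * (k : ℝ) + 3561 / 100 * (k : ℝ) ^ 2 + 122 / 5 * (k : ℝ) ^ 3 +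
        28 / 5 * (k : ℝ) ^ 4) / ((2 * (2 * ((k : ℝ) + 1)) + 2) ^ 4 * ((k : ℝ) + 1)) by field_simp; ring]
      positivity
    have hd : (0 : ℝ) < (k + 1) + 1 / 4 + 1 / (32 * (k + 1)) := by positivity
    have h0 := hermiteZero_nonneg (k + 1)
    calc _ ≤ (1 - 0.3 / (2 * ((2 * (k + 1) : ℕ) : ℝ) + 2) ^ 2) ^ 2 *
          (hermiteZero (k + 1) * ((k + 1) + 1 / 4 + 1 / (32 * (k + 1)))) :=
          le_mul_of_one_le_right (by positivity) h
      _ = hermiteZero (k + 1) * ((1 - 0.3 / (2 * ((2 * (k + 1) : ℕ) : ℝ) + 2) ^ 2) ^ 2 *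
        ((k + 1) + 1 / 4 + 1 / (32 * (k + 1)))) := by ring
      _ ≤ _ := by gcongr
  · rw [hermiteAmp_odd, (odd_two_mul_add_one _).neg_one_pow]
    have h := one_le_hermiteZero_mul m
    have hk : (0 : ℝ) ≤ m := Nat.cast_nonneg m
    have key : (1 - 0.3 / (2 * ((2 * m + 1 : ℕ) : ℝ) + 2) ^ 2) ^ 2 *
        ((m + 1) + 1 / 4 + 1 / (32 * (m + 1))) ≤
        (2 * ((2 * m + 1 : ℕ) : ℝ) + 2) / 4 *
          (1 - -1 / (2 * (2 * ((2 * m + 1 : ℕ) : ℝ) + 2))) ^ 2 := by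
      push_cast
      rw [← sub_nonneg]
      rw [show _ - _ = (26191 / 3200 + 11999 / 400 * (m : ℝ) + 4101 / 100 * (m : ℝ) ^ 2 +
        124 / 5 * (m : ℝ) ^ 3 + 28 / 5 * (m : ℝ) ^ 4) / ((2 * (2 * (m : ℝ) + 1) + 2) ^ 4 * ((m : ℝ) + 1)) by field_simp; ring]
      positivity
    have h0 := hermiteZero_nonneg (m + 1)
    calc _ ≤ (1 - 0.3 / (2 * ((2 * m + 1 : ℕ) : ℝ) + 2) ^ 2) ^ 2 *
          (hermiteZero (m + 1) * ((m + 1) + 1 / 4 + 1 / (32 * (m + 1)))) :=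
          le_mul_of_one_le_right (by positivity) h
      _ = hermiteZero (m + 1) * ((1 - 0.3 / (2 * ((2 * m + 1 : ℕ) : ℝ) + 2) ^ 2) ^ 2 *
        ((m + 1) + 1 / 4 + 1 / (32 * (m + 1)))) := by ring
      _ ≤ _ := by gcongr

end HermiteZero

/-! ### Christoffel–Darboux formula and the slowly varying phase -/

section HermiteKernel

open Complex ComplexConjugate

/-- The kernel of the orthogonal projection onto the first `n + 1` Hermite functions. -/
noncomputable def hermiteKernel (n : ℕ) (x y : ℝ) : ℝ :=
  ∑ k ∈ Finset.range (n + 1), hermiteFun k x * hermiteFun k y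

/-- The Christoffel–Darboux formula: the three-term recurrence makes the sum telescope. -/
theorem sub_mul_hermiteKernel (n : ℕ) (x y : ℝ) :
    (x - y) * hermiteKernel n x y = Real.sqrt (2 * n + 2) / 2 *
      (hermiteFun n x * hermiteFun (n + 1) y - hermiteFun (n + 1) x * hermiteFun n y) := by
  induction n with
  | zero =>
    have h (z : ℝ) : Real.sqrt (2 * ((0 : ℕ) : ℝ) + 2) * hermiteFun (0 + 1) z =
        -(2 * z * hermiteFun 0 z) := by
      have := (hasDerivAt_hermiteFun 0 z).unique (hasDerivAt_hermiteFun_aux 0 z)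
      simp only [hermiteP, Polynomial.derivative_one, Polynomial.eval_zero, mul_zero, zero_mul,
        zero_sub] at this
      linarith
    have h1 := h x
    have h2 := h y
    simp only [hermiteKernel, zero_add, Finset.range_one, Finset.sum_singleton] at *
    linear_combination -(hermiteFun 0 x / 2) * h2 + hermiteFun 0 y / 2 * h1
  | succ n ih =>
    have h1 := hermiteFun_recurrence n x
    have h2 := hermiteFun_recurrence n y
    rw [hermiteKernel, Finset.sum_range_succ, mul_add, ← hermiteKernel, ih]
    linear_combination (-(hermiteFun (n + 1) y) / 2) * (-1) * h1 +
      hermiteFun (n + 1) x / 2 * (-1) * h2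

theorem norm_sub_le_of_norm_deriv_le {f f' : ℝ → ℂ} {T A B : ℝ}
    (hf : ∀ x, HasDerivAt f (f' x) x)
    (hb : ∀ x, |x| ≤ T → ‖f' x‖ ≤ |x| * (A + B * x ^ 2)) {x : ℝ} (hx : |x| ≤ T) :
    ‖f x - f 0‖ ≤ A * x ^ 2 / 2 + B * x ^ 4 / 4 := by
  have key : ∀ (g g' : ℝ → ℂ), (∀ x, HasDerivAt g (g' x) x) →
      (∀ x, |x| ≤ T → ‖g' x‖ ≤ |x| * (A + B * x ^ 2)) → ∀ x, 0 ≤ x → x ≤ T →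
      ‖g x - g 0‖ ≤ A * x ^ 2 / 2 + B * x ^ 4 / 4 := by
    intro g g' hg hb x hx0 hxT
    refine image_norm_le_of_norm_deriv_right_le_deriv_boundary (a := 0) (b := T)
      (f := fun x => g x - g 0) (f' := g') (B := fun x => A * x ^ 2 / 2 + B * x ^ 4 / 4)
      (B' := fun x => x * (A + B * x ^ 2)) ?_ ?_ (by simp) ?_ ?_ ⟨hx0, hxT⟩
    · exact fun z _ => ((hg z).sub_const _).continuousAt.continuousWithinAt
    · exact fun z _ => ((hg z).sub_const _).hasDerivWithinAt
    · intro z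
      have := (((hasDerivAt_pow 2 z).const_mul A).div_const 2).add
        (((hasDerivAt_pow 4 z).const_mul B).div_const 4)
      convert! this using 1
      simp; ring
    · intro z hz
      have := hb z (by rw [abs_of_nonneg hz.1]; exact hz.2.le)
      rwa [abs_of_nonneg hz.1] at this
  rcases le_total 0 x with h | h
  · exact key f f' hf hb x h (by rwa [abs_of_nonneg h] at hx)
  · have := key (fun x => f (-x)) (fun x => -f' (-x))
      (fun x => by simpa [Function.comp_def] using (hf (-x)).scomp x (hasDerivAt_neg x))
      (fun z hz => by simpa using hb (-z) (by simpa using hz)) (-x) (by linarith)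
      (by rwa [abs_of_nonpos h] at hx)
    simpa [Even.neg_pow (by decide : Even 4)] using this

/-- The slowly varying factor of `h_n - i h_{n+1}`. -/
noncomputable def hermitePhase (n : ℕ) (x : ℝ) : ℂ :=
  cexp (-(I * Real.sqrt (2 * n + 2) * x)) * (hermiteFun n x - I * hermiteFun (n + 1) x)

theorem hasDerivAt_cexp_mul_ofReal (c : ℂ) (x : ℝ) :
    HasDerivAt (fun x : ℝ => cexp (c * x)) (c * cexp (c * x)) x := by
  have := ((hasDerivAt_id (x : ℂ)).const_mul c).cexp.comp_ofReal
  simpa [mul_comm] using this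

theorem conj_cexp_I_mul (b x : ℝ) : conj (cexp (-(I * b * x))) = cexp (I * b * x) := by
  rw [← Complex.exp_conj]; simp

theorem conj_hermitePhase (n : ℕ) (x : ℝ) : conj (hermitePhase n x) =
    cexp (I * Real.sqrt (2 * n + 2) * x) * (hermiteFun n x + I * hermiteFun (n + 1) x) := by
  rw [hermitePhase, map_mul, conj_cexp_I_mul]
  simp

/-- By the ladder relations `z = h_n - i h_{n+1}` satisfies `z' = i b z + x conj z`. Removing
`exp(ibx)` leaves a derivative that is small near the origin, uniformly in the fast frequency `b`.
-/
theorem hasDerivAt_hermitePhase (n : ℕ) (x : ℝ) :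
    HasDerivAt (hermitePhase n)
      (x * cexp (-(2 * I * Real.sqrt (2 * n + 2)) * x) * conj (hermitePhase n x)) x := by
  have h1 := hasDerivAt_cexp_mul_ofReal (-(I * Real.sqrt (2 * n + 2))) x
  have h2 := (hasDerivAt_hermiteFun n x).ofReal_comp
  have h3 := (hasDerivAt_hermiteFun_succ n x).ofReal_comp.const_mul I
  have h := h1.mul (h2.sub h3)
  have e : hermitePhase n = fun x : ℝ => cexp (-(I * Real.sqrt (2 * n + 2)) * x) *
      (hermiteFun n x - I * hermiteFun (n + 1) x) := by
    funext z; rw [hermitePhase, neg_mul]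
  have h' := conj_hermitePhase n x
  suffices HasDerivAt (fun x : ℝ => cexp (-(I * Real.sqrt (2 * n + 2)) * x) *
      (hermiteFun n x - I * hermiteFun (n + 1) x)) (x * cexp (-(2 * I * Real.sqrt (2 * n + 2)) * x) *
      conj (hermitePhase n x)) x by rwa [← e] at this
  convert! h using 1
  rw [h', show -(2 * I * (Real.sqrt (2 * n + 2) : ℂ)) * x =
    -(I * Real.sqrt (2 * n + 2)) * x + -(I * Real.sqrt (2 * n + 2) * x) by ring, Complex.exp_add,
    Complex.exp_neg (I * _ * _)]
  have hne := Complex.exp_ne_zero (I * Real.sqrt (2 * n + 2) * x)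
  simp only [Pi.sub_apply]
  push_cast
  generalize (Real.sqrt (2 * n + 2) : ℂ) = b at *
  field_simp
  linear_combination -b * (hermiteFun (n + 1) x) * I_sq

theorem norm_hermitePhase_sq (n : ℕ) (x : ℝ) :
    ‖hermitePhase n x‖ ^ 2 = hermiteFun n x ^ 2 + hermiteFun (n + 1) x ^ 2 := by
  have h0 : (-(I * (Real.sqrt (2 * n + 2) : ℂ) * x)).re = 0 := by simp
  rw [hermitePhase, norm_mul, Complex.norm_exp, h0, Real.exp_zero, one_mul, Complex.sq_norm,
    Complex.normSq_apply]
  simp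
  ring

/-- A Grönwall argument: `exp(-x²)` times the squared modulus has derivative `-4x h_{n+1}²
exp(-x²)`, so it is largest at 0. -/
theorem norm_hermitePhase_sq_le (n : ℕ) (x : ℝ) :
    ‖hermitePhase n x‖ ^ 2 ≤ hermiteAmp n * Real.exp (x ^ 2) := by
  set g : ℝ → ℝ := fun x => (hermiteFun n x ^ 2 + hermiteFun (n + 1) x ^ 2) * Real.exp (-x ^ 2)
    with hg
  have hd : ∀ x, HasDerivAt g (-(x * (4 * hermiteFun (n + 1) x ^ 2 * Real.exp (-x ^ 2)))) x := by
    intro x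
    have h1 := (hasDerivAt_hermiteFun n x).pow 2
    have h2 := (hasDerivAt_hermiteFun_succ n x).pow 2
    have h3 := ((hasDerivAt_pow 2 x).neg).exp
    convert! (h1.add h2).mul h3 using 1
    simp
    ring
  have hc : Continuous g := continuous_iff_continuousAt.2 fun x => (hd x).continuousAt
  have key : g x ≤ g 0 := by
    rcases le_total 0 x with h | h
    · refine antitoneOn_of_deriv_nonpos (convex_Ici 0) hc.continuousOn
        (fun z _ => (hd z).differentiableAt.differentiableWithinAt) (fun z hz => ?_)
        (Set.self_mem_Ici) h h
      rw [interior_Ici] at hz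
      rw [(hd z).deriv]
      have : 0 ≤ z := le_of_lt hz
      have : 0 ≤ z * (4 * hermiteFun (n + 1) z ^ 2 * Real.exp (-z ^ 2)) := by positivity
      linarith
    · refine monotoneOn_of_deriv_nonneg (convex_Iic 0) hc.continuousOn
        (fun z _ => (hd z).differentiableAt.differentiableWithinAt) (fun z hz => ?_)
        h (Set.self_mem_Iic) h
      rw [interior_Iic] at hz
      rw [(hd z).deriv]
      have : 0 ≤ -z := by have : z < 0 := hz; linarith
      have : 0 ≤ -z * (4 * hermiteFun (n + 1) z ^ 2 * Real.exp (-z ^ 2)) := by positivity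
      linarith
  rw [norm_hermitePhase_sq]
  have e : hermiteFun n x ^ 2 + hermiteFun (n + 1) x ^ 2 = g x * Real.exp (x ^ 2) := by
    simp only [hg]; rw [mul_assoc, ← Real.exp_add]; simp
  rw [e]
  gcongr
  simpa [hg, hermiteAmp] using key

theorem norm_hermitePhase_le {n : ℕ} {x T : ℝ} (hx : |x| ≤ T) :
    ‖hermitePhase n x‖ ≤ Real.sqrt (hermiteAmp n) * Real.exp (T ^ 2 / 2) := by
  refine le_of_sq_le_sq ((norm_hermitePhase_sq_le n x).trans ?_) (by positivity)
  rw [mul_pow, Real.sq_sqrt (hermiteAmp_nonneg n), ← Real.exp_nat_mul]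
  have := hermiteAmp_nonneg n
  have h2 : x ^ 2 ≤ T ^ 2 := sq_le_sq' (by linarith [neg_abs_le x]) (by linarith [le_abs_self x])
  gcongr
  push_cast; linarith

/-- Exactly one of `h_n`, `h_{n+1}` is odd and vanishes at 0, so the value there is real or purely
imaginary according to the parity of `n`. This is the source of every `(-1)^n` in the expansion. -/
theorem conj_hermitePhase_zero_sq (n : ℕ) :
    conj (hermitePhase n 0) * conj (hermitePhase n 0) = (-1) ^ n * hermiteAmp n := by
  rw [conj_hermitePhase, hermiteAmp]
  rcases Nat.even_or_odd' n with ⟨m, rfl | rfl⟩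
  · rw [hermiteFun_odd_zero, (even_two_mul _).neg_one_pow]
    simp; ring
  · rw [hermiteFun_odd_zero, (odd_two_mul_add_one _).neg_one_pow]
    simp
    linear_combination (hermiteFun (2 * m + 1 + 1) 0 : ℂ) ^ 2 * I_sq

theorem norm_hermitePhase_sub_le {n : ℕ} {x T : ℝ} (hx : |x| ≤ T) :
    ‖hermitePhase n x - hermitePhase n 0‖ ≤
      Real.sqrt (hermiteAmp n) * Real.exp (T ^ 2 / 2) * x ^ 2 / 2 := by
  have := norm_sub_le_of_norm_deriv_le (T := T)
    (A := Real.sqrt (hermiteAmp n) * Real.exp (T ^ 2 / 2)) (B := 0)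
    (hasDerivAt_hermitePhase n) (fun z hz => ?_) hx
  · simpa using this
  · rw [norm_mul, norm_mul, Complex.norm_exp, RCLike.norm_conj]
    simpa using mul_le_mul_of_nonneg_left (norm_hermitePhase_le hz) (abs_nonneg z)

end HermiteKernel

/-! ### Second order expansion of the Hermite kernel at the origin -/

section HermiteKernelExpansion

open Complex ComplexConjugate

/-- The oscillating moment `∫_0^x s exp(-2ibs) ds`. -/
noncomputable def oscMoment (b x : ℝ) : ℂ :=
  I * x * cexp (-(2 * I * b) * x) / (2 * b) + (cexp (-(2 * I * b) * x) - 1) / (4 * b ^ 2)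

theorem hasDerivAt_oscMoment {b : ℝ} (hb : b ≠ 0) (x : ℝ) :
    HasDerivAt (oscMoment b) (x * cexp (-(2 * I * b) * x)) x := by
  have h1 := hasDerivAt_cexp_mul_ofReal (-(2 * I * b)) x
  have h2 := ((hasDerivAt_id x).ofReal_comp.const_mul I).mul h1
  have h := (h2.div_const (2 * b)).add ((h1.sub_const 1).div_const (4 * b ^ 2))
  have hb' : (b : ℂ) ≠ 0 := by exact_mod_cast hb
  convert! h using 1
  simp
  field_simp
  linear_combination 8 * b * x * I_sq

/-- The error in the second order expansion of `ξ(x) conj ξ(y)` at the origin, where `ξ` is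
`hermitePhase n`. -/
noncomputable def phaseError (n : ℕ) (x y : ℝ) : ℂ :=
  hermitePhase n x * conj (hermitePhase n y) - hermiteAmp n - (-1) ^ n * hermiteAmp n *
    (oscMoment (Real.sqrt (2 * n + 2)) x + conj (oscMoment (Real.sqrt (2 * n + 2)) y))

theorem sqrt_two_mul_add_two_pos (n : ℕ) : 0 < Real.sqrt (2 * n + 2) :=
  Real.sqrt_pos.2 (by positivity)

/-- Subtracting the oscillating moment replaces `conj ξ(x) conj ξ(y)` in the derivative by its
difference from the value at the origin. That difference is of second order, so the error is of
fourth order in `T`. -/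
theorem hasDerivAt_phaseError (n : ℕ) (x y : ℝ) :
    HasDerivAt (fun x => phaseError n x y) (x * cexp (-(2 * I * Real.sqrt (2 * n + 2)) * x) *
      (conj (hermitePhase n x) * conj (hermitePhase n y) -
        conj (hermitePhase n 0) * conj (hermitePhase n 0))) x := by
  have h1 := (hasDerivAt_hermitePhase n x).mul_const (conj (hermitePhase n y))
  have h2 := ((hasDerivAt_oscMoment (sqrt_two_mul_add_two_pos n).ne' x).add_const
    (conj (oscMoment (Real.sqrt (2 * n + 2)) y))).const_mul ((-1) ^ n * (hermiteAmp n : ℂ))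
  convert! (h1.sub_const (hermiteAmp n : ℂ)).sub h2 using 1
  rw [conj_hermitePhase_zero_sq]
  ring

theorem norm_conj_hermitePhase_mul_sub_le {n : ℕ} {x y T : ℝ} (hx : |x| ≤ T) (hy : |y| ≤ T) :
    ‖conj (hermitePhase n x) * conj (hermitePhase n y) -
        conj (hermitePhase n 0) * conj (hermitePhase n 0)‖ ≤
      hermiteAmp n * (Real.exp (T ^ 2 / 2) ^ 2 * y ^ 2 / 2 + Real.exp (T ^ 2 / 2) * x ^ 2 / 2) := by
  have e : conj (hermitePhase n x) * conj (hermitePhase n y) -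
        conj (hermitePhase n 0) * conj (hermitePhase n 0) =
      conj (hermitePhase n x * (hermitePhase n y - hermitePhase n 0) +
        hermitePhase n 0 * (hermitePhase n x - hermitePhase n 0)) := by
    simp only [map_add, map_mul, map_sub]; ring
  rw [e, RCLike.norm_conj]
  have h0 : ‖hermitePhase n 0‖ ≤ Real.sqrt (hermiteAmp n) := by
    simpa using norm_hermitePhase_le (n := n) (x := 0) (T := 0) (by simp)
  refine (norm_add_le _ _).trans ?_
  rw [norm_mul, norm_mul]
  have hs := Real.mul_self_sqrt (hermiteAmp_nonneg n)
  calc _ ≤ (Real.sqrt (hermiteAmp n) * Real.exp (T ^ 2 / 2)) *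
        (Real.sqrt (hermiteAmp n) * Real.exp (T ^ 2 / 2) * y ^ 2 / 2) +
      Real.sqrt (hermiteAmp n) * (Real.sqrt (hermiteAmp n) * Real.exp (T ^ 2 / 2) * x ^ 2 / 2) := by
        gcongr
        · exact norm_hermitePhase_le hx
        · exact norm_hermitePhase_sub_le hy
        · exact norm_hermitePhase_sub_le hx
    _ = _ := by
        linear_combination (Real.exp (T ^ 2 / 2) ^ 2 * y ^ 2 / 2 + Real.exp (T ^ 2 / 2) * x ^ 2 / 2) * hs

theorem norm_deriv_phaseError_le {n : ℕ} {x y T : ℝ} (hx : |x| ≤ T) (hy : |y| ≤ T) :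
    ‖x * cexp (-(2 * I * Real.sqrt (2 * n + 2)) * x) *
      (conj (hermitePhase n x) * conj (hermitePhase n y) -
        conj (hermitePhase n 0) * conj (hermitePhase n 0))‖ ≤
      |x| * (hermiteAmp n * (Real.exp (T ^ 2 / 2) ^ 2 * y ^ 2 / 2) +
        hermiteAmp n * (Real.exp (T ^ 2 / 2) / 2) * x ^ 2) := by
  rw [norm_mul, norm_mul, Complex.norm_exp]
  have h := mul_le_mul_of_nonneg_left (norm_conj_hermitePhase_mul_sub_le (n := n) hx hy)
    (abs_nonneg x)
  have h0 : (-(2 * I * (Real.sqrt (2 * n + 2) : ℂ)) * x).re = 0 := by simp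
  rw [h0, Real.exp_zero, mul_one, norm_real, Real.norm_eq_abs]
  refine h.trans (le_of_eq ?_)
  ring

theorem conj_phaseError (n : ℕ) (x y : ℝ) : conj (phaseError n x y) = phaseError n y x := by
  simp only [phaseError, map_sub, map_mul, map_add, map_pow, map_neg, map_one, conj_ofReal,
    conj_conj]
  ring

theorem phaseError_zero_zero (n : ℕ) : phaseError n 0 0 = 0 := by
  have h : ‖hermitePhase n 0‖ ^ 2 = hermiteAmp n := by rw [norm_hermitePhase_sq, hermiteAmp]
  rw [phaseError, Complex.mul_conj, Complex.normSq_eq_norm_sq, h]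
  simp [oscMoment]

/-- The point `(x, y)` is moved to `(0, y)` and then to `(0, 0)`. Hermitian symmetry reduces the
second move to the first with its second argument equal to 0, where the `y²` term drops out. -/
theorem norm_phaseError_le {n : ℕ} {x y T : ℝ} (hx : |x| ≤ T) (hy : |y| ≤ T) :
    ‖phaseError n x y‖ ≤ hermiteAmp n * (T ^ 4 * (Real.exp (T ^ 2 / 2) +
      Real.exp (T ^ 2 / 2) ^ 2) / 4) := by
  have hr := hermiteAmp_nonneg n
  have hT : 0 ≤ T := (abs_nonneg x).trans hx
  have key : ∀ x y, |x| ≤ T → |y| ≤ T → ‖phaseError n x y - phaseError n 0 y‖ ≤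
      hermiteAmp n * (Real.exp (T ^ 2 / 2) ^ 2 * y ^ 2 / 2) * x ^ 2 / 2 +
        hermiteAmp n * (Real.exp (T ^ 2 / 2) / 2) * x ^ 4 / 4 := fun x y hx hy =>
    norm_sub_le_of_norm_deriv_le (T := T) (f := fun x => phaseError n x y)
      (fun z => hasDerivAt_phaseError n z y)
      (fun z hz => norm_deriv_phaseError_le hz hy) hx
  have h1 := key x y hx hy
  have h2 := key y 0 hy (by simpa using hT)
  rw [phaseError_zero_zero, sub_zero, ← conj_phaseError, RCLike.norm_conj] at h2
  have hx2 : x ^ 2 ≤ T ^ 2 := sq_le_sq' (by linarith [neg_abs_le x]) (by linarith [le_abs_self x])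
  have hy2 : y ^ 2 ≤ T ^ 2 := sq_le_sq' (by linarith [neg_abs_le y]) (by linarith [le_abs_self y])
  have hx4 : x ^ 4 ≤ T ^ 4 := by nlinarith [sq_nonneg x, sq_nonneg T]
  have hy4 : y ^ 4 ≤ T ^ 4 := by nlinarith [sq_nonneg y, sq_nonneg T]
  calc _ = ‖(phaseError n x y - phaseError n 0 y) + phaseError n 0 y‖ := by rw [sub_add_cancel]
    _ ≤ _ := norm_add_le _ _
    _ ≤ _ := add_le_add h1 h2
    _ ≤ (hermiteAmp n * (Real.exp (T ^ 2 / 2) ^ 2 * T ^ 2 / 2) * T ^ 2 / 2 +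
        hermiteAmp n * (Real.exp (T ^ 2 / 2) / 2) * T ^ 4 / 4) +
        (hermiteAmp n * (Real.exp (T ^ 2 / 2) ^ 2 * 0 ^ 2 / 2) * T ^ 2 / 2 +
        hermiteAmp n * (Real.exp (T ^ 2 / 2) / 2) * T ^ 4 / 4) := by gcongr
    _ = _ := by ring

/-- The correction splits into a multiple of `sin(b(x - y))`, which merges with the leading sine and
becomes the factor `1 - (-1)^n/(2b²)`, and a cosine term already divisible by `x - y`. -/
theorem cexp_mul_oscMoment_im {b : ℝ} (hb : b ≠ 0) (x y : ℝ) :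
    (cexp (I * b * (x - y)) * (oscMoment b x + conj (oscMoment b y))).im =
      (x - y) * Real.cos (b * (x + y)) / (2 * b) - Real.sin (b * (x - y)) / (2 * b ^ 2) := by
  have hb' : (b : ℂ) ≠ 0 := by exact_mod_cast hb
  have e : cexp (I * b * (x - y)) * (oscMoment b x + conj (oscMoment b y)) =
      I * x / (2 * b) * cexp (-(((b * (x + y) : ℝ) : ℂ) * I)) +
      cexp (-(((b * (x + y) : ℝ) : ℂ) * I)) / (4 * b ^ 2) -
      cexp (((b * (x - y) : ℝ) : ℂ) * I) / (2 * b ^ 2) - I * y / (2 * b) *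
        cexp (((b * (x + y) : ℝ) : ℂ) * I) + cexp (((b * (x + y) : ℝ) : ℂ) * I) / (4 * b ^ 2) := by
    have c1 : conj (oscMoment b y) = -I * y * cexp (2 * I * b * y) / (2 * b) +
        (cexp (2 * I * b * y) - 1) / (4 * b ^ 2) := by
      simp [oscMoment, ← Complex.exp_conj, map_ofNat]
    have c2 : cexp (I * b * (x - y)) * cexp (2 * I * b * y) =
        cexp (((b * (x + y) : ℝ) : ℂ) * I) := by
      rw [← Complex.exp_add]; push_cast; ring_nf
    have c3 : cexp (I * b * (x - y)) * cexp (-(2 * I * b) * x) =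
        cexp (-(((b * (x + y) : ℝ) : ℂ) * I)) := by
      rw [← Complex.exp_add]; push_cast; ring_nf
    have c4 : cexp (I * b * (x - y)) = cexp (((b * (x - y) : ℝ) : ℂ) * I) := by
      push_cast; ring_nf
    rw [c1, oscMoment, ← c2, ← c3, ← c4]
    field_simp
    ring
  have n1 : cexp (-(((b * (x + y) : ℝ) : ℂ) * I)) =
      (Real.cos (b * (x + y)) : ℂ) - (Real.sin (b * (x + y)) : ℂ) * I := by
    rw [← neg_mul, Complex.exp_mul_I, Complex.cos_neg, Complex.sin_neg]; push_cast; ring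
  rw [e, n1, Complex.exp_mul_I, Complex.exp_mul_I, ← ofReal_cos, ← ofReal_sin, ← ofReal_cos,
    ← ofReal_sin]
  have d1 : (2 * (b : ℂ)) = ((2 * b : ℝ) : ℂ) := by push_cast; ring
  have d2 : (4 * (b : ℂ) ^ 2) = ((4 * b ^ 2 : ℝ) : ℂ) := by push_cast; ring
  have d3 : (2 * (b : ℂ) ^ 2) = ((2 * b ^ 2 : ℝ) : ℂ) := by push_cast; ring
  rw [d1, d2, d3]
  simp only [add_im, sub_im, mul_im, div_ofReal_im, div_ofReal_re, mul_re, I_re, I_im, ofReal_re,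
    ofReal_im, add_re, sub_re]
  field_simp
  ring

/-- Second order expansion of `(x - y) K(x, y)` for the Hermite kernel `K`. -/
theorem sub_mul_hermiteKernel_eq (n : ℕ) (x y : ℝ) :
    (x - y) * hermiteKernel n x y =
      Real.sqrt (2 * n + 2) * hermiteAmp n / 2 *
        ((1 - (-1) ^ n / (2 * (2 * n + 2))) * Real.sin (Real.sqrt (2 * n + 2) * (x - y)) +
          (x - y) * ((-1) ^ n * Real.cos (Real.sqrt (2 * n + 2) * (x + y)) /
            (2 * Real.sqrt (2 * n + 2)))) +
      Real.sqrt (2 * n + 2) / 2 *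
        (cexp (I * Real.sqrt (2 * n + 2) * (x - y)) * phaseError n x y).im := by
  have hb2 : (2 * n + 2 : ℝ) = Real.sqrt (2 * n + 2) ^ 2 := (Real.sq_sqrt (by positivity)).symm
  have hb := (sqrt_two_mul_add_two_pos n).ne'
  have hW : phaseError n x y = hermitePhase n x * conj (hermitePhase n y) - hermiteAmp n -
    (((-1) ^ n * hermiteAmp n : ℝ) : ℂ) *
    (oscMoment (Real.sqrt (2 * n + 2)) x + conj (oscMoment (Real.sqrt (2 * n + 2)) y)) := by
    rw [phaseError]; push_cast; ring
  have h1 : cexp (I * Real.sqrt (2 * n + 2) * (x - y)) *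
      (hermitePhase n x * conj (hermitePhase n y)) =
      (hermiteFun n x - I * hermiteFun (n + 1) x) *
        (hermiteFun n y + I * hermiteFun (n + 1) y) := by
    rw [conj_hermitePhase, hermitePhase]
    have : cexp (I * Real.sqrt (2 * n + 2) * (x - y)) * cexp (-(I * Real.sqrt (2 * n + 2) * x)) *
        cexp (I * Real.sqrt (2 * n + 2) * y) = 1 := by
      rw [← Complex.exp_add, ← Complex.exp_add, ← Complex.exp_zero]; ring_nf
    linear_combination (hermiteFun n x - I * hermiteFun (n + 1) x) *
        (hermiteFun n y + I * hermiteFun (n + 1) y) * this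
  have h2 : cexp (I * Real.sqrt (2 * n + 2) * (x - y)) * phaseError n x y =
      (hermiteFun n x - I * hermiteFun (n + 1) x) * (hermiteFun n y + I * hermiteFun (n + 1) y) -
      hermiteAmp n * cexp (((Real.sqrt (2 * n + 2) * (x - y) : ℝ) : ℂ) * I) -
      (((-1) ^ n * hermiteAmp n : ℝ) : ℂ) * (cexp (I * Real.sqrt (2 * n + 2) * (x - y)) *
       (oscMoment (Real.sqrt (2 * n + 2)) x + conj (oscMoment (Real.sqrt (2 * n + 2)) y))) := by
    rw [← h1, hW]
    have : cexp (((Real.sqrt (2 * n + 2) * (x - y) : ℝ) : ℂ) * I) =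
      cexp (I * Real.sqrt (2 * n + 2) * (x - y)) := by push_cast; ring_nf
    rw [this]; ring
  have h3 : (cexp (I * Real.sqrt (2 * n + 2) * (x - y)) * phaseError n x y).im =
      (hermiteFun n x * hermiteFun (n + 1) y - hermiteFun (n + 1) x * hermiteFun n y) -
      hermiteAmp n * Real.sin (Real.sqrt (2 * n + 2) * (x - y)) -
      (-1) ^ n * hermiteAmp n * ((x - y) * Real.cos (Real.sqrt (2 * n + 2) * (x + y)) /
        (2 * Real.sqrt (2 * n + 2)) -
        Real.sin (Real.sqrt (2 * n + 2) * (x - y)) / (2 * Real.sqrt (2 * n + 2) ^ 2)) := by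
    rw [h2, sub_im, sub_im, im_ofReal_mul, im_ofReal_mul, cexp_mul_oscMoment_im hb,
      exp_ofReal_mul_I_im]
    simp
    ring
  rw [sub_mul_hermiteKernel, h3]
  rw [← hb2]
  ring

theorem phaseError_self_im (n : ℕ) (y : ℝ) : (phaseError n y y).im = 0 := by
  have := congrArg Complex.im (conj_phaseError n y y)
  simp at this; linarith

/-- Hermitian symmetry makes the imaginary part vanish on the diagonal. The mean value inequality in
`x` then yields the factor `|x - y|` needed to divide the Christoffel–Darboux formula by `x - y`. -/
theorem abs_im_cexp_mul_phaseError_le {n : ℕ} {x y T : ℝ} (hx : |x| ≤ T) (hy : |y| ≤ T) :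
    |(cexp (I * Real.sqrt (2 * n + 2) * (x - y)) * phaseError n x y).im| ≤
      hermiteAmp n * (Real.exp (T ^ 2 / 2) + Real.exp (T ^ 2 / 2) ^ 2) *
        (Real.sqrt (2 * n + 2) * T ^ 4 / 4 + T ^ 3 / 2) * |x - y| := by
  set b := Real.sqrt (2 * n + 2) with hb
  have hb0 : 0 ≤ b := Real.sqrt_nonneg _
  have hT : 0 ≤ T := (abs_nonneg x).trans hx
  have hr := hermiteAmp_nonneg n
  set g : ℝ → ℂ := fun x => cexp (I * b * (x - y)) * phaseError n x y with hg
  have e : ∀ x : ℝ, cexp (I * b * (x - y)) = cexp (-(I * b * y)) * cexp (I * b * x) := fun x => by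
    rw [← Complex.exp_add]; ring_nf
  have n1 : ∀ x : ℝ, ‖cexp (I * b * (x - y))‖ = 1 := fun x => by
    rw [Complex.norm_exp]; simp
  set g' : ℝ → ℂ := fun x => I * b * cexp (I * b * (x - y)) * phaseError n x y +
    cexp (I * b * (x - y)) * (x * cexp (-(2 * I * b) * x) *
      (conj (hermitePhase n x) * conj (hermitePhase n y) -
        conj (hermitePhase n 0) * conj (hermitePhase n 0))) with hg'
  have hd : ∀ x, HasDerivAt g (g' x) x := by
    intro x
    have h1 := (hasDerivAt_cexp_mul_ofReal (I * b) x).const_mul (cexp (-(I * b * y)))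
    have h2 := h1.mul (hasDerivAt_phaseError n x y)
    simp only [hg, hg', e]
    convert! h2 using 1
    ring
  have hbd : ∀ x ∈ Set.Icc (-T) T, ‖g' x‖ ≤ hermiteAmp n * (Real.exp (T ^ 2 / 2) +
      Real.exp (T ^ 2 / 2) ^ 2) * (b * T ^ 4 / 4 + T ^ 3 / 2) := by
    intro x hx
    have hx' : |x| ≤ T := abs_le.2 hx
    have hx2 : x ^ 2 ≤ T ^ 2 := sq_le_sq' hx.1 hx.2
    have hy2 : y ^ 2 ≤ T ^ 2 := sq_le_sq' (by linarith [neg_abs_le y]) (by linarith [le_abs_self y])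
    have h1 := norm_phaseError_le (n := n) hx' hy
    have h2 := norm_deriv_phaseError_le (n := n) hx' hy
    rw [← hb] at h2
    refine (norm_add_le _ _).trans ?_
    rw [norm_mul (cexp _), n1, one_mul, norm_mul, norm_mul, n1, norm_mul, norm_I, norm_real,
      Real.norm_of_nonneg hb0, one_mul, mul_one]
    calc _ ≤ b * (hermiteAmp n * (T ^ 4 * (Real.exp (T ^ 2 / 2) +
          Real.exp (T ^ 2 / 2) ^ 2) / 4)) + T * (hermiteAmp n * (Real.exp (T ^ 2 / 2) ^ 2 * T ^ 2 / 2) +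
        hermiteAmp n * (Real.exp (T ^ 2 / 2) / 2) * T ^ 2) := by
          refine add_le_add (mul_le_mul_of_nonneg_left h1 hb0) (h2.trans ?_)
          gcongr
      _ = _ := by ring
  have hmv := Convex.norm_image_sub_le_of_norm_hasDerivWithin_le (s := Set.Icc (-T) T)
    (fun x _ => (hd x).hasDerivWithinAt) hbd (convex_Icc _ _) (abs_le.1 hy) (abs_le.1 hx)
  have hgy : (g y).im = 0 := by simp [hg, phaseError_self_im]
  calc _ = |(g x - g y).im| := by rw [sub_im, hgy, sub_zero]
    _ ≤ ‖g x - g y‖ := abs_im_le_norm _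
    _ ≤ _ := hmv

/-- Up to a small error, the Hermite kernel is a multiple of the sinc kernel plus an
explicit oscillating term. -/
theorem abs_hermiteKernel_sub_le {n : ℕ} {x y T : ℝ} (hx : |x| ≤ T) (hy : |y| ≤ T) (hxy : x ≠ y) :
    |hermiteKernel n x y - Real.sqrt (2 * n + 2) * hermiteAmp n / 2 *
      ((1 - (-1) ^ n / (2 * (2 * n + 2))) *
        (Real.sin (Real.sqrt (2 * n + 2) * (x - y)) / (x - y)) +
        (-1) ^ n * Real.cos (Real.sqrt (2 * n + 2) * (x + y)) / (2 * Real.sqrt (2 * n + 2)))| ≤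
      Real.sqrt (2 * n + 2) * hermiteAmp n / 2 * (Real.exp (T ^ 2 / 2) + Real.exp (T ^ 2 / 2) ^ 2) *
        (Real.sqrt (2 * n + 2) * T ^ 4 / 4 + T ^ 3 / 2) := by
  have h := sub_mul_hermiteKernel_eq n x y
  have hne : x - y ≠ 0 := sub_ne_zero.2 hxy
  have hb := abs_im_cexp_mul_phaseError_le (n := n) hx hy
  refine le_of_mul_le_mul_right ?_ (abs_pos.2 hne)
  rw [← abs_mul]
  have e : (hermiteKernel n x y - Real.sqrt (2 * n + 2) * hermiteAmp n / 2 *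
      ((1 - (-1) ^ n / (2 * (2 * n + 2))) *
        (Real.sin (Real.sqrt (2 * n + 2) * (x - y)) / (x - y)) +
        (-1) ^ n * Real.cos (Real.sqrt (2 * n + 2) * (x + y)) / (2 * Real.sqrt (2 * n + 2)))) *
        (x - y) = Real.sqrt (2 * n + 2) / 2 *
        (cexp (I * Real.sqrt (2 * n + 2) * (x - y)) * phaseError n x y).im := by
    have hd : Real.sin (Real.sqrt (2 * n + 2) * (x - y)) / (x - y) * (x - y) =
      Real.sin (Real.sqrt (2 * n + 2) * (x - y)) := div_mul_cancel₀ _ hne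
    linear_combination h - Real.sqrt (2 * n + 2) * hermiteAmp n / 2 *
      (1 - (-1) ^ n / (2 * (2 * n + 2))) * hd
  rw [e, abs_mul, abs_of_nonneg (by positivity)]
  calc _ ≤ _ := mul_le_mul_of_nonneg_left hb (by positivity)
    _ = _ := by ring

end HermiteKernelExpansion

/-! ### Fourier transforms of functions on a window -/

section WindowFourier

open Complex ComplexConjugate

theorem integral_mul_norm_sq_le {α : Type*} [MeasurableSpace α] {μ : Measure α} {g : α → ℝ}
    {u : α → ℂ} (hg : MemLp g 2 μ) (hg0 : ∀ x, 0 ≤ g x) (hu : MemLp u 2 μ) :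
    (∫ x, g x * ‖u x‖ ∂μ) ^ 2 ≤ (∫ x, g x ^ 2 ∂μ) * ∫ x, ‖u x‖ ^ 2 ∂μ := by
  have h := integral_mul_le_Lp_mul_Lq_of_nonneg Real.HolderConjugate.two_two
    (Filter.Eventually.of_forall hg0) (Filter.Eventually.of_forall fun x => norm_nonneg (u x))
    (by simpa using hg) (by simpa using hu.norm)
  simp only [Real.rpow_two, ← Real.sqrt_eq_rpow] at h
  have h1 : 0 ≤ ∫ x, g x ^ 2 ∂μ := integral_nonneg fun x => by positivity
  have h2 : 0 ≤ ∫ x, ‖u x‖ ^ 2 ∂μ := integral_nonneg fun x => by positivity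
  have h0 : 0 ≤ ∫ x, g x * ‖u x‖ ∂μ := integral_nonneg fun x => by
    have := hg0 x; positivity
  calc _ ≤ (Real.sqrt (∫ x, g x ^ 2 ∂μ) * Real.sqrt (∫ x, ‖u x‖ ^ 2 ∂μ)) ^ 2 := by gcongr
    _ = _ := by rw [mul_pow, Real.sq_sqrt h1, Real.sq_sqrt h2]

variable {T : ℝ}

theorem memLp_restrict_Icc {g : ℝ → ℝ} (hg : Continuous g) (a b : ℝ) :
    MemLp g 2 (volume.restrict (Set.Icc a b)) := by
  rw [memLp_two_iff_integrable_sq hg.aestronglyMeasurable]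
  exact (hg.pow 2).continuousOn.integrableOn_Icc

theorem integral_abs_pow_mul_norm_sq_le (hT : 0 ≤ T) {u : ℝ → ℂ}
    (hu : MemLp u 2 (volume.restrict (Set.Icc (-T) T))) (k : ℕ) :
    (∫ x in Set.Icc (-T) T, |x| ^ k * ‖u x‖) ^ 2 ≤
      2 * T ^ (2 * k + 1) / (2 * k + 1) * ∫ x in Set.Icc (-T) T, ‖u x‖ ^ 2 := by
  have h := integral_mul_norm_sq_le (g := fun x => |x| ^ k)
    (memLp_restrict_Icc (continuous_abs.pow k) (-T) T) (fun x => by positivity) hu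
  have e : ∫ x in Set.Icc (-T) T, (|x| ^ k) ^ 2 = 2 * T ^ (2 * k + 1) / (2 * k + 1) := by
    rw [integral_Icc_eq_integral_Ioc, ← intervalIntegral.integral_of_le (by linarith)]
    have : (fun x : ℝ => (|x| ^ k) ^ 2) = fun x => x ^ (2 * k) := by
      funext x; rw [← pow_mul, mul_comm k, pow_mul, sq_abs, ← pow_mul]
    rw [this, integral_pow, Odd.neg_pow ⟨k, rfl⟩]
    push_cast; ring
  rwa [e] at h

/-- The Fourier transform `ω ↦ ∫ u(x) exp(-iωx) dμ(x)`. -/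
noncomputable def angularFourier (μ : Measure ℝ) (u : ℝ → ℂ) (ω : ℝ) : ℂ :=
  ∫ x, u x * cexp (-(I * ω * x)) ∂μ

theorem norm_cexp_neg_I_mul (ω x : ℝ) : ‖cexp (-(I * ω * x))‖ = 1 := by
  rw [Complex.norm_exp]; simp

theorem integrable_mul_cexp {μ : Measure ℝ} {u : ℝ → ℂ} (hu : Integrable u μ) (ω : ℝ) :
    Integrable (fun x => u x * cexp (-(I * ω * x))) μ :=
  hu.mul_bdd (c := 1) (by fun_prop) (Filter.Eventually.of_forall fun x =>
    (norm_cexp_neg_I_mul ω x).le)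

theorem continuous_angularFourier {μ : Measure ℝ} {u : ℝ → ℂ} (hu : Integrable u μ) :
    Continuous (angularFourier μ u) := by
  refine continuous_of_dominated (bound := fun x => ‖u x‖)
    (fun ω => (integrable_mul_cexp hu ω).aestronglyMeasurable)
    (fun ω => Filter.Eventually.of_forall fun x => ?_) hu.norm
    (Filter.Eventually.of_forall fun x => by fun_prop)
  rw [norm_mul, norm_cexp_neg_I_mul, mul_one]

theorem norm_cexp_sub_cexp_le (ω ω' x : ℝ) :
    ‖cexp (-(I * ω * x)) - cexp (-(I * ω' * x))‖ ≤ |ω - ω'| * |x| := by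
  have e : cexp (-(I * ω * x)) - cexp (-(I * ω' * x)) = cexp (-(I * ω' * x)) *
      (cexp (I * ((-(ω - ω') * x : ℝ) : ℂ)) - 1) := by
    rw [mul_sub, mul_one, ← Complex.exp_add]
    congr 2; push_cast; ring
  rw [e, norm_mul, norm_cexp_neg_I_mul, one_mul]
  refine Real.norm_exp_I_mul_ofReal_sub_one_le.trans (le_of_eq ?_)
  rw [Real.norm_eq_abs, abs_mul, abs_neg]

theorem norm_angularFourier_sq_le (hT : 0 ≤ T) {u : ℝ → ℂ}
    (hu : MemLp u 2 (volume.restrict (Set.Icc (-T) T))) (ω : ℝ) :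
    ‖angularFourier (volume.restrict (Set.Icc (-T) T)) u ω‖ ^ 2 ≤
      2 * T * ∫ x in Set.Icc (-T) T, ‖u x‖ ^ 2 := by
  have h := integral_abs_pow_mul_norm_sq_le hT hu 0
  simp only [pow_zero, one_mul, mul_zero, zero_add, pow_one, Nat.cast_zero, div_one] at h
  refine le_trans ?_ h
  gcongr
  refine (norm_integral_le_integral_norm _).trans (le_of_eq ?_)
  simp only [norm_mul, norm_cexp_neg_I_mul, mul_one]

theorem norm_angularFourier_sub_sq_le (hT : 0 ≤ T) {u : ℝ → ℂ}
    (hu : MemLp u 2 (volume.restrict (Set.Icc (-T) T))) (ω ω' : ℝ) :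
    ‖angularFourier (volume.restrict (Set.Icc (-T) T)) u ω -
      angularFourier (volume.restrict (Set.Icc (-T) T)) u ω'‖ ^ 2 ≤
      (ω - ω') ^ 2 * (2 * T ^ 3 / 3 * ∫ x in Set.Icc (-T) T, ‖u x‖ ^ 2) := by
  have hi : Integrable u (volume.restrict (Set.Icc (-T) T)) := hu.integrable (by norm_num)
  have hxi : Integrable (fun x => |x| ^ 1 * ‖u x‖) (volume.restrict (Set.Icc (-T) T)) := by
    have := (hi.norm.const_mul T)
    refine this.mono' (by fun_prop) ((ae_restrict_mem measurableSet_Icc).mono fun x hx => ?_)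
    rw [Real.norm_of_nonneg (by positivity), pow_one]
    gcongr
    exact abs_le.2 hx
  have h := integral_abs_pow_mul_norm_sq_le hT hu 1
  have h1 : ‖angularFourier (volume.restrict (Set.Icc (-T) T)) u ω -
      angularFourier (volume.restrict (Set.Icc (-T) T)) u ω'‖ ≤
      |ω - ω'| * ∫ x in Set.Icc (-T) T, |x| ^ 1 * ‖u x‖ := by
    rw [angularFourier, angularFourier, ← integral_sub (integrable_mul_cexp hi _)
      (integrable_mul_cexp hi _), ← integral_const_mul]
    refine norm_integral_le_of_norm_le (hxi.const_mul _) (Filter.Eventually.of_forall fun x => ?_)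
    rw [← mul_sub, norm_mul, pow_one]
    calc _ ≤ ‖u x‖ * (|ω - ω'| * |x|) := by gcongr; exact norm_cexp_sub_cexp_le _ _ _
      _ = _ := by ring
  calc _ ≤ (|ω - ω'| * ∫ x in Set.Icc (-T) T, |x| ^ 1 * ‖u x‖) ^ 2 := by gcongr
    _ = (ω - ω') ^ 2 * (∫ x in Set.Icc (-T) T, |x| ^ 1 * ‖u x‖) ^ 2 := by rw [mul_pow, sq_abs]
    _ ≤ _ := by
      gcongr
      refine h.trans (le_of_eq ?_)
      norm_num

end WindowFourier

/-! ### Mass near the endpoints of an interval for slowly varying functions -/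

section Averaging

open intervalIntegral

/-- A slowly varying function has a controlled fraction of its mass near the endpoint. -/
theorem integral_le_integral_sub_endpoint {G : ℝ → ℝ} (hG : Continuous G) (hG0 : ∀ x, 0 ≤ G x)
    {D b c : ℝ} (hb : 2 ≤ b) (hc0 : 0 ≤ c) (hc : c ≤ b / 2)
    (h : ∀ x y, G x ≤ 2 * G y + (x - y) ^ 2 * D) (hD : 0 ≤ D) :
    ∫ x in (0)..c, G x ≤ (1 - 0.3 / b ^ 4) * (∫ x in (0)..b, G x) - 0.55 / b * G b +
      0.5875 / b * D := by
  have hi : ∀ x y, IntervalIntegrable G volume x y := fun x y => hG.intervalIntegrable x y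
  have hmono : ∀ {x y z w : ℝ}, x ≤ y → y ≤ z → z ≤ w →
      ∫ s in y..z, G s ≤ ∫ s in x..w, G s := fun hxy hyz hzw =>
    integral_mono_interval hxy hyz hzw (Filter.Eventually.of_forall hG0) (hi _ _)
  have hb0 : 0 < b := by linarith
  have hbb : 2 / b ≤ b / 2 := by
    rw [div_le_div_iff₀ hb0 (by norm_num)]; nlinarith
  have hbp : 0 < 2 / b := by positivity
  set M := ∫ s in c..b, G s with hM
  have hM0 : 0 ≤ M := integral_nonneg (by linarith) fun x _ => hG0 x
  have hsplit : ∫ s in (0)..b, G s = (∫ s in (0)..c, G s) + M :=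
    (integral_add_adjacent_intervals (hi _ _) (hi _ _)).symm
  have h1 : ∫ s in (b - 2 / b)..b, G s ≤ M := hmono (by linarith) (by linarith) le_rfl
  have h2 : ∫ s in (b / 2)..b, G s ≤ M := hmono (by linarith) (by linarith) le_rfl
  -- The endpoint value is compared with the average of `G` over a final stretch of length `2/b`,
  -- which lies in `[c, b]`.
  have h3 : G b * (2 / b) ≤ 2 * M + (2 / b) * ((2 / b) ^ 2 * D) := by
    have : ∫ s in (b - 2 / b)..b, G b ≤ ∫ s in (b - 2 / b)..b, (2 * G s + (2 / b) ^ 2 * D) := by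
      refine integral_mono_on (by linarith) (by simp) ((hG.const_mul 2).add_const _ |>.intervalIntegrable _ _)
        fun s hs => (h b s).trans ?_
      have : (b - s) ^ 2 ≤ (2 / b) ^ 2 := by
        have := hs.1; have := hs.2
        gcongr
        linarith
      gcongr
    rw [intervalIntegral.integral_const, integral_add ((hi _ _).const_mul 2) (by simp), intervalIntegral.integral_const_mul,
      intervalIntegral.integral_const] at this
    simp only [sub_sub_cancel, smul_eq_mul] at this
    linarith
  -- Translation by `b/2` carries `[0, b/2]` onto `[b/2, b]`, so the mass on `[0, c]` is controlled
  -- by `M`.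
  have h4 : ∫ s in (0)..c, G s ≤ 2 * M + b / 2 * ((b / 2) ^ 2 * D) := by
    have h5 : ∫ s in (0)..c, G s ≤ ∫ s in (0)..(b / 2), G s := hmono le_rfl hc0 hc
    have hs : Continuous fun s => G (s + b / 2) := by fun_prop
    have h6 : ∫ s in (0)..(b / 2), G s ≤
        ∫ s in (0)..(b / 2), (2 * G (s + b / 2) + (b / 2) ^ 2 * D) := by
      refine integral_mono_on (by linarith) (hi _ _)
        ((hs.const_mul 2).add_const _ |>.intervalIntegrable _ _)
        fun s _ => (h s (s + b / 2)).trans (le_of_eq ?_)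
      ring
    rw [integral_add ((hs.const_mul 2).intervalIntegrable _ _) (by simp), intervalIntegral.integral_const_mul, intervalIntegral.integral_const,
      integral_comp_add_right (fun s => G s) (b / 2)] at h6
    simp only [zero_add, add_halves, sub_zero, smul_eq_mul] at h6
    linarith
  have hb4 : 16 ≤ b ^ 4 := by
    have : (2 : ℝ) ^ 4 ≤ b ^ 4 := by gcongr
    linarith
  have h7 : G b ≤ b * M + 4 / b ^ 2 * D := by
    have := mul_le_mul_of_nonneg_left h3 (by positivity : 0 ≤ b / 2)
    have e1 : b / 2 * (G b * (2 / b)) = G b := by field_simp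
    have e2 : b / 2 * (2 * M + (2 / b) * ((2 / b) ^ 2 * D)) = b * M + 4 / b ^ 2 * D := by
      field_simp; ring
    linarith
  have h8 : 0.55 / b * G b ≤ 0.55 * M + 0.55 / b * D := by
    have := mul_le_mul_of_nonneg_left h7 (by positivity : 0 ≤ 0.55 / b)
    have e1 : 0.55 / b * (b * M + 4 / b ^ 2 * D) = 0.55 * M + 0.55 / b * (4 / b ^ 2 * D) := by
      field_simp
    have e2 : 4 / b ^ 2 * D ≤ 1 * D := by
      gcongr
      rw [div_le_one (by positivity)]; nlinarith
    have e3 := mul_le_mul_of_nonneg_left e2 (by positivity : 0 ≤ 0.55 / b)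
    linarith
  have h9 : 0.3 / b ^ 4 * (∫ s in (0)..c, G s) ≤ 0.0375 * M + 0.0375 / b * D := by
    have := mul_le_mul_of_nonneg_left h4 (by positivity : 0 ≤ 0.3 / b ^ 4)
    have e1 : 0.3 / b ^ 4 * (2 * M + b / 2 * ((b / 2) ^ 2 * D)) =
      0.6 / b ^ 4 * M + 0.0375 / b * D := by field_simp; ring
    have e2 : 0.6 / b ^ 4 * M ≤ 0.0375 * M := by
      gcongr
      rw [div_le_iff₀ (by positivity)]; linarith
    linarith
  have h10 : 0.3 / b ^ 4 * M ≤ 0.01875 * M := by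
    gcongr
    rw [div_le_iff₀ (by positivity)]; linarith
  rw [hsplit]
  have : 0.5875 / b * D = 0.55 / b * D + 0.0375 / b * D := by ring
  rw [this]
  -- The three charges to `M` add up to `0.55 + 0.0375 + 0.01875 < 1`.
  nlinarith

theorem integral_symm_le_integral_sub_endpoints {G : ℝ → ℝ} (hG : Continuous G)
    (hG0 : ∀ x, 0 ≤ G x) {D b c : ℝ} (hb : 2 ≤ b) (hc0 : 0 ≤ c) (hc : c ≤ b / 2)
    (h : ∀ x y, G x ≤ 2 * G y + (x - y) ^ 2 * D) (hD : 0 ≤ D) :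
    ∫ x in (-c)..c, G x ≤ (1 - 0.3 / b ^ 4) * (∫ x in (-b)..b, G x) -
      0.55 / b * (G b + G (-b)) + 1.175 / b * D := by
  have hi : ∀ x y, IntervalIntegrable G volume x y := fun x y => hG.intervalIntegrable x y
  have h1 := integral_le_integral_sub_endpoint hG hG0 hb hc0 hc h hD
  have h2 := integral_le_integral_sub_endpoint (hG.comp continuous_neg) (fun x => hG0 (-x)) hb hc0
    hc (fun x y => by
      simpa [neg_add_eq_sub, sub_sq_comm y x] using h (-x) (-y)) hD
  simp only [Function.comp, integral_comp_neg (fun x => G x), neg_zero] at h2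
  rw [← integral_add_adjacent_intervals (hi (-c) 0) (hi 0 c),
    ← integral_add_adjacent_intervals (hi (-b) 0) (hi 0 b)]
  have : 1.175 / b * D = 0.5875 / b * D + 0.5875 / b * D := by ring
  rw [this]
  linarith

end Averaging

/-! ### Quadratic forms of the Hermite, cosine and sinc kernels -/

section KernelForm

open Complex ComplexConjugate

/-- The quadratic form `∬ k(x, y) u(x) conj u(y) dμ(x) dμ(y)` of the kernel `k`. -/
noncomputable def kernelForm (μ : Measure ℝ) (u : ℝ → ℂ) (k : ℝ → ℝ → ℂ) : ℂ :=
  ∫ p : ℝ × ℝ, k p.1 p.2 * (u p.1 * conj (u p.2)) ∂μ.prod μ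

variable {μ : Measure ℝ} {u : ℝ → ℂ}

theorem integrable_conj_comp (hu : Integrable u μ) : Integrable (fun x => conj (u x)) μ :=
  hu.norm.mono' (continuous_conj.comp_aestronglyMeasurable hu.aestronglyMeasurable)
    (Filter.Eventually.of_forall fun x => by simp)

theorem integrable_mul_conj_prod [SFinite μ] (hu : Integrable u μ) :
    Integrable (fun p : ℝ × ℝ => u p.1 * conj (u p.2)) (μ.prod μ) :=
  hu.mul_prod (integrable_conj_comp hu)

theorem integrable_kernelForm [SFinite μ] (hu : Integrable u μ) {k : ℝ → ℝ → ℂ} {C : ℝ}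
    (hk : AEStronglyMeasurable (fun p : ℝ × ℝ => k p.1 p.2) (μ.prod μ))
    (hC : ∀ᵐ p ∂μ.prod μ, ‖k p.1 p.2‖ ≤ C) :
    Integrable (fun p : ℝ × ℝ => k p.1 p.2 * (u p.1 * conj (u p.2))) (μ.prod μ) :=
  (integrable_mul_conj_prod hu).bdd_mul hk hC

theorem norm_kernelForm_le [SFinite μ] (hu : Integrable u μ) {k : ℝ → ℝ → ℂ} {C : ℝ}
    (hC : ∀ᵐ p ∂μ.prod μ, ‖k p.1 p.2‖ ≤ C) :
    ‖kernelForm μ u k‖ ≤ C * (∫ x, ‖u x‖ ∂μ) ^ 2 := by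
  have h : ∫ p : ℝ × ℝ, ‖u p.1 * conj (u p.2)‖ ∂μ.prod μ = (∫ x, ‖u x‖ ∂μ) ^ 2 := by
    simp only [norm_mul, RCLike.norm_conj]
    rw [integral_prod_mul (fun x => ‖u x‖) (fun x => ‖u x‖), sq]
  rw [← h, ← integral_const_mul]
  refine norm_integral_le_of_norm_le ((integrable_mul_conj_prod hu).norm.const_mul C) ?_
  filter_upwards [hC] with p hp
  rw [norm_mul]
  gcongr

theorem integral_mul_conj_eq (g : ℝ → ℂ) :
    ∫ y, conj (g y) * conj (u y) ∂μ = conj (∫ y, g y * u y ∂μ) := by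
  rw [← integral_conj]; simp

theorem kernelForm_mul_conj [SFinite μ] (g h : ℝ → ℂ) :
    kernelForm μ u (fun x y => g x * conj (h y)) =
      (∫ x, g x * u x ∂μ) * conj (∫ x, h x * u x ∂μ) := by
  rw [kernelForm, ← integral_mul_conj_eq,
    ← integral_prod_mul (fun x => g x * u x) (fun y => conj (h y) * conj (u y))]
  congr 1; funext p; ring

theorem kernelForm_hermiteKernel {n : ℕ} [IsFiniteMeasure μ] {T : ℝ}
    (hμ : ∀ᵐ x ∂μ, |x| ≤ T) (hu : Integrable u μ) :
    kernelForm μ u (fun x y => hermiteKernel n x y) =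
      ((∑ k ∈ Finset.range (n + 1), ‖∫ x, u x * hermiteFun k x ∂μ‖ ^ 2 : ℝ) : ℂ) := by
  have hb : ∀ k, ∃ C, ∀ᵐ x ∂μ, ‖(hermiteFun k x : ℂ)‖ ≤ C := fun k => by
    obtain ⟨C, hC⟩ := (isCompact_Icc (a := -T) (b := T)).exists_bound_of_continuousOn
      (continuous_hermiteFun k).continuousOn
    exact ⟨C, hμ.mono fun x hx => by simpa using hC x (abs_le.1 hx)⟩
  have hi : ∀ k, Integrable (fun x => (hermiteFun k x : ℂ) * u x) μ := fun k => by
    obtain ⟨C, hC⟩ := hb k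
    exact hu.bdd_mul
      (continuous_ofReal.comp (continuous_hermiteFun k)).aestronglyMeasurable hC
  have hk : ∀ k, kernelForm μ u (fun x y => (hermiteFun k x : ℂ) * conj (hermiteFun k y : ℂ)) =
      ((‖∫ x, u x * hermiteFun k x ∂μ‖ ^ 2 : ℝ) : ℂ) := fun k => by
    rw [kernelForm_mul_conj, Complex.mul_conj, Complex.normSq_eq_norm_sq]
    simp only [mul_comm]
  rw [ofReal_sum, ← Finset.sum_congr rfl fun k _ => hk k]
  simp only [kernelForm]
  rw [← integral_finsetSum]
  · congr 1; funext p
    rw [hermiteKernel, ofReal_sum, Finset.sum_mul]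
    simp
  · intro k _
    have := (hi k).mul_prod (integrable_conj_comp (hi k))
    refine this.congr (Filter.Eventually.of_forall fun p => ?_)
    simp only [map_mul]; ring

theorem angularFourier_eq (ω : ℝ) :
    angularFourier μ u ω = ∫ x, cexp (-(I * ω * x)) * u x ∂μ := by
  simp only [angularFourier, mul_comm]

theorem kernelForm_cexp_add [SFinite μ] (b : ℝ) :
    kernelForm μ u (fun x y => cexp (-(I * b * (x + y)))) =
      angularFourier μ u b * conj (angularFourier μ u (-b)) := by
  rw [angularFourier_eq, angularFourier_eq, ← kernelForm_mul_conj]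
  congr 1; funext x y
  rw [← Complex.exp_conj, ← Complex.exp_add]
  congr 1; simp; ring

theorem kernelForm_cos_add [SFinite μ] (hu : Integrable u μ) (b : ℝ) :
    kernelForm μ u (fun x y => Real.cos (b * (x + y))) =
      ((angularFourier μ u b * conj (angularFourier μ u (-b))).re : ℂ) := by
  have h1 := kernelForm_cexp_add (μ := μ) (u := u) b
  have h2 := kernelForm_cexp_add (μ := μ) (u := u) (-b)
  have hint : ∀ b : ℝ, Integrable (fun p : ℝ × ℝ => cexp (-(I * b * (p.1 + p.2))) *
      (u p.1 * conj (u p.2))) (μ.prod μ) := fun b => by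
    refine integrable_kernelForm hu (k := fun x y => cexp (-(I * b * (x + y)))) (C := 1)
      (by fun_prop) (Filter.Eventually.of_forall fun p => ?_)
    have := norm_cexp_neg_I_mul b (p.1 + p.2)
    push_cast at this
    exact this.le
  rw [neg_neg] at h2
  have h3 : conj (angularFourier μ u b * conj (angularFourier μ u (-b))) =
      angularFourier μ u (-b) * conj (angularFourier μ u b) := by
    rw [map_mul, conj_conj, mul_comm]
  rw [re_eq_add_conj, h3, ← h2, ← h1]
  simp only [kernelForm]
  rw [← integral_add (hint b) (hint (-b)), ← integral_div]
  congr 1; funext p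
  have e : (Real.cos (b * (p.1 + p.2)) : ℂ) =
      (cexp (-(I * b * (p.1 + p.2))) + cexp (-(I * ((-b : ℝ) : ℂ) * (p.1 + p.2)))) / 2 := by
    rw [ofReal_cos, Complex.cos, add_comm]
    push_cast
    ring_nf
  rw [e]; ring

theorem abs_re_angularFourier_mul_le (b : ℝ) :
    |(angularFourier μ u b * conj (angularFourier μ u (-b))).re| ≤
      (‖angularFourier μ u b‖ ^ 2 + ‖angularFourier μ u (-b)‖ ^ 2) / 2 := by
  refine (abs_re_le_norm _).trans ?_
  rw [norm_mul, RCLike.norm_conj]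
  nlinarith [sq_nonneg (‖angularFourier μ u b‖ - ‖angularFourier μ u (-b)‖)]

theorem ae_ne_prod [SFinite μ] [NullSingletonClass μ] : ∀ᵐ p ∂μ.prod μ, p.1 ≠ p.2 := by
  have hm : MeasurableSet {p : ℝ × ℝ | p.1 = p.2} := measurableSet_eq_fun measurable_fst measurable_snd
  rw [ae_iff]
  simp only [ne_eq, not_not]
  rw [Measure.measure_prod_null hm]
  refine Filter.Eventually.of_forall fun x => ?_
  have : Prod.mk x ⁻¹' {p : ℝ × ℝ | p.1 = p.2} = {x} := by
    ext y; simp [eq_comm]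
  change μ (Prod.mk x ⁻¹' {p : ℝ × ℝ | p.1 = p.2}) = 0
  rw [this]; simp

theorem integral_cexp_eq_sinc (b : ℝ) {x : ℝ} (hx : x ≠ 0) :
    ∫ ω in (-b)..b, cexp (-(I * ω * x)) = ((2 * (Real.sin (b * x) / x) : ℝ) : ℂ) := by
  have hc : (-(I * x) : ℂ) ≠ 0 := by
    simpa using hx
  have h := integral_exp_mul_complex (a := -b) (b := b) hc
  have e : (fun ω : ℝ => cexp (-(I * ω * x))) = fun ω : ℝ => cexp (-(I * x) * ω) := by
    funext ω; ring_nf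
  rw [e, h]
  have hx' : (x : ℂ) ≠ 0 := by exact_mod_cast hx
  push_cast
  rw [Complex.sin]
  field_simp
  ring_nf
  rw [I_sq]; ring

/-- The sinc kernel is the integral of `exp(-iω(x - y))` over `[-b, b]`, and Fubini converts its
form into band energy. On the diagonal the quotient has the conventional value 0, which is harmless
because the diagonal is null. -/
theorem kernelForm_sinc [SFinite μ] [NullSingletonClass μ] (hu : Integrable u μ) {b : ℝ} (hb : 0 ≤ b) :
    Integrable (fun p : ℝ × ℝ => ((2 * (Real.sin (b * (p.1 - p.2)) / (p.1 - p.2)) : ℝ) : ℂ) *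
      (u p.1 * conj (u p.2))) (μ.prod μ) ∧
    kernelForm μ u (fun x y => ((2 * (Real.sin (b * (x - y)) / (x - y)) : ℝ) : ℂ)) =
      ((∫ ω in (-b)..b, ‖angularFourier μ u ω‖ ^ 2 : ℝ) : ℂ) := by
  have h1 : ∀ ω : ℝ, ((‖angularFourier μ u ω‖ ^ 2 : ℝ) : ℂ) =
      ∫ p : ℝ × ℝ, cexp (-(I * ω * (p.1 - p.2))) * (u p.1 * conj (u p.2)) ∂μ.prod μ := by
    intro ω
    have := kernelForm_mul_conj (μ := μ) (u := u) (fun x => cexp (-(I * ω * x)))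
      (fun x => cexp (-(I * ω * x)))
    rw [← angularFourier_eq, Complex.mul_conj, Complex.normSq_eq_norm_sq] at this
    rw [← this, kernelForm]
    congr 1; funext p
    rw [← Complex.exp_conj, ← Complex.exp_add]
    congr 2; simp; ring
  have hint : Integrable (Function.uncurry fun (ω : ℝ) (p : ℝ × ℝ) =>
      cexp (-(I * ω * (p.1 - p.2))) * (u p.1 * conj (u p.2)))
      ((volume.restrict (Set.uIoc (-b) b)).prod (μ.prod μ)) := by
    have h2 : Integrable (fun q : ℝ × (ℝ × ℝ) => (1 : ℂ) * (u q.2.1 * conj (u q.2.2)))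
      ((volume.restrict (Set.uIoc (-b) b)).prod (μ.prod μ)) := by
      refine Integrable.mul_prod (f := fun _ : ℝ => (1 : ℂ)) ?_ (integrable_mul_conj_prod hu)
      have : IsFiniteMeasure (volume.restrict (Set.uIoc (-b) b)) := by
        rw [Set.uIoc]; infer_instance
      exact integrable_const _
    simp only [one_mul] at h2
    refine h2.bdd_mul (c := 1) (by fun_prop) (Filter.Eventually.of_forall fun q => ?_)
    have := norm_cexp_neg_I_mul q.1 (q.2.1 - q.2.2)
    push_cast at this
    exact this.le
  have hswap := intervalIntegral_integral_swap hint
  have hae : (fun p : ℝ × ℝ => ∫ ω in (-b)..b, cexp (-(I * ω * (p.1 - p.2))) *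
      (u p.1 * conj (u p.2))) =ᵐ[μ.prod μ] fun p : ℝ × ℝ =>
      ((2 * (Real.sin (b * (p.1 - p.2)) / (p.1 - p.2)) : ℝ) : ℂ) * (u p.1 * conj (u p.2)) := by
    filter_upwards [ae_ne_prod (μ := μ)] with p hp
    rw [intervalIntegral.integral_mul_const]
    have := integral_cexp_eq_sinc b (sub_ne_zero.2 hp)
    rw [← this]
    push_cast; rfl
  constructor
  · refine Integrable.congr ?_ hae
    simp_rw [intervalIntegral.integral_of_le (by linarith : -b ≤ b)]
    rw [Set.uIoc_of_le (by linarith)] at hint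
    exact hint.integral_prod_right
  · rw [kernelForm, ← integral_congr_ae hae, ← hswap]
    rw [← intervalIntegral.integral_ofReal]
    simp_rw [h1]

end KernelForm

/-! ### Band energy against Hermite energy on a short window -/

section HermiteLowerBound

open Complex ComplexConjugate

variable {u : ℝ → ℂ} {T : ℝ}

theorem ae_prod_abs_le : ∀ᵐ p ∂(volume.restrict (Set.Icc (-T) T)).prod
    (volume.restrict (Set.Icc (-T) T)), |p.1| ≤ T ∧ |p.2| ≤ T := by
  have h : ∀ᵐ x ∂volume.restrict (Set.Icc (-T) T), |x| ≤ T :=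
    (ae_restrict_mem measurableSet_Icc).mono fun x hx => abs_le.2 hx
  filter_upwards [Measure.quasiMeasurePreserving_fst.ae h,
    Measure.quasiMeasurePreserving_snd.ae h] with p h1 h2 using ⟨h1, h2⟩

theorem integrable_hermiteKernel_form (n : ℕ) (hu : Integrable u (volume.restrict (Set.Icc (-T) T))) :
    Integrable (fun p : ℝ × ℝ => (hermiteKernel n p.1 p.2 : ℂ) * (u p.1 * conj (u p.2)))
      ((volume.restrict (Set.Icc (-T) T)).prod (volume.restrict (Set.Icc (-T) T))) := by
  have hc : Continuous fun p : ℝ × ℝ => (hermiteKernel n p.1 p.2 : ℂ) := by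
    refine continuous_ofReal.comp (continuous_finsetSum _ fun k _ => ?_)
    exact ((continuous_hermiteFun k).comp continuous_fst).mul
      ((continuous_hermiteFun k).comp continuous_snd)
  obtain ⟨C, hC⟩ := ((isCompact_Icc (a := -T) (b := T)).prod
    (isCompact_Icc (a := -T) (b := T))).exists_bound_of_continuousOn hc.continuousOn
  exact integrable_kernelForm hu (k := fun x y => (hermiteKernel n x y : ℂ)) (C := C)
    hc.aestronglyMeasurable
    (ae_prod_abs_le.mono fun p hp => hC p ⟨abs_le.1 hp.1, abs_le.1 hp.2⟩)

/-- The pointwise kernel expansion is integrated against `u(x) conj u(y)`. The remainder is paid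
with the sup norm of the kernel error and `(∫ |u|)² ≤ 2T ∫ |u|²`. -/
theorem hermite_coeff_approx (n : ℕ) (hT : 0 ≤ T)
    (hu : MemLp u 2 (volume.restrict (Set.Icc (-T) T))) :
    |∑ k ∈ Finset.range (n + 1), ‖∫ x in Set.Icc (-T) T, u x * hermiteFun k x‖ ^ 2 -
      Real.sqrt (2 * n + 2) * hermiteAmp n / 2 *
        ((1 - (-1) ^ n / (2 * (2 * n + 2))) * ((∫ ω in (-Real.sqrt (2 * n + 2))..Real.sqrt (2 * n + 2),
          ‖angularFourier (volume.restrict (Set.Icc (-T) T)) u ω‖ ^ 2) / 2) +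
        (-1) ^ n / (2 * Real.sqrt (2 * n + 2)) *
          (angularFourier (volume.restrict (Set.Icc (-T) T)) u (Real.sqrt (2 * n + 2)) *
            conj (angularFourier (volume.restrict (Set.Icc (-T) T)) u (-Real.sqrt (2 * n + 2)))).re)| ≤
      Real.sqrt (2 * n + 2) * hermiteAmp n / 2 * (Real.exp (T ^ 2 / 2) + Real.exp (T ^ 2 / 2) ^ 2) *
        (Real.sqrt (2 * n + 2) * T ^ 4 / 4 + T ^ 3 / 2) *
        (2 * T * ∫ x in Set.Icc (-T) T, ‖u x‖ ^ 2) := by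
  have hi : Integrable u (volume.restrict (Set.Icc (-T) T)) := hu.integrable (by norm_num)
  have hCS := integral_abs_pow_mul_norm_sq_le hT hu 0
  simp only [pow_zero, one_mul, mul_zero, zero_add, pow_one, Nat.cast_zero, div_one] at hCS
  have hmem : ∀ᵐ x ∂volume.restrict (Set.Icc (-T) T), |x| ≤ T :=
    (ae_restrict_mem measurableSet_Icc).mono fun x hx => abs_le.2 hx
  have hK := kernelForm_hermiteKernel (n := n) hmem hi
  obtain ⟨hSi, hS⟩ := kernelForm_sinc hi (Real.sqrt_nonneg (2 * n + 2))
  have hC := kernelForm_cos_add hi (Real.sqrt (2 * n + 2))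
  have hKi := integrable_hermiteKernel_form n hi
  have hCi : Integrable (fun p : ℝ × ℝ => (Real.cos (Real.sqrt (2 * n + 2) * (p.1 + p.2)) : ℂ) *
      (u p.1 * conj (u p.2)))
      ((volume.restrict (Set.Icc (-T) T)).prod (volume.restrict (Set.Icc (-T) T))) := by
    refine integrable_kernelForm hi
      (k := fun x y => (Real.cos (Real.sqrt (2 * n + 2) * (x + y)) : ℂ)) (C := 1)
      (by fun_prop) (Filter.Eventually.of_forall fun p => ?_)
    rw [norm_real]; exact Real.abs_cos_le_one _
  set b := Real.sqrt (2 * n + 2) with hb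
  set A : ℝ := b * hermiteAmp n / 2 * (1 - (-1) ^ n / (2 * (2 * n + 2))) / 2 with hA
  set B : ℝ := b * hermiteAmp n / 2 * ((-1) ^ n / (2 * b)) with hB
  have hform : kernelForm (volume.restrict (Set.Icc (-T) T)) u (fun x y =>
      ((hermiteKernel n x y - A * (2 * (Real.sin (b * (x - y)) / (x - y))) -
        B * Real.cos (b * (x + y)) : ℝ) : ℂ)) =
      kernelForm (volume.restrict (Set.Icc (-T) T)) u (fun x y => hermiteKernel n x y) -
      A * kernelForm (volume.restrict (Set.Icc (-T) T)) u (fun x y =>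
        ((2 * (Real.sin (b * (x - y)) / (x - y)) : ℝ) : ℂ)) -
      B * kernelForm (volume.restrict (Set.Icc (-T) T)) u (fun x y =>
        (Real.cos (b * (x + y)) : ℂ)) := by
    simp only [kernelForm]
    have hd := hKi.sub (hSi.const_mul (A : ℂ))
    simp only [Pi.sub_def] at hd
    rw [← integral_const_mul, ← integral_const_mul, ← integral_sub hKi (hSi.const_mul _),
      ← integral_sub hd (hCi.const_mul _)]
    congr 1; funext p; push_cast; ring
  rw [hK, hS, hC] at hform
  have hbound := norm_kernelForm_le hi (k := fun x y =>
      ((hermiteKernel n x y - A * (2 * (Real.sin (b * (x - y)) / (x - y))) -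
        B * Real.cos (b * (x + y)) : ℝ) : ℂ)) (C := b * hermiteAmp n / 2 *
          (Real.exp (T ^ 2 / 2) + Real.exp (T ^ 2 / 2) ^ 2) * (b * T ^ 4 / 4 + T ^ 3 / 2)) (by
    filter_upwards [ae_prod_abs_le, ae_ne_prod] with p hp hne
    have := abs_hermiteKernel_sub_le (n := n) hp.1 hp.2 hne
    rw [norm_real, Real.norm_eq_abs]
    refine le_trans (le_of_eq ?_) this
    congr 1
    simp only [hA, hB, ← hb]; ring)
  rw [hform, ← ofReal_mul, ← ofReal_mul, ← ofReal_sub, ← ofReal_sub, norm_real,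
    Real.norm_eq_abs] at hbound
  have hr := hermiteAmp_nonneg n
  calc _ = _ := by
        congr 1
        simp only [hA, hB]; ring
    _ ≤ _ := hbound
    _ ≤ _ := by gcongr

/-- The hypothesis is what `24 T³ ≤ b` and `T b ≤ 2.2` imply, as `2.2/24 < 0.0917`. The exponential
is bounded by `1/(1 - T²/2)`. -/
theorem exp_half_add_sq_le (hT4 : T ^ 4 ≤ 0.0917) :
    Real.exp (T ^ 2 / 2) + Real.exp (T ^ 2 / 2) ^ 2 ≤ 2.5691 := by
  have hT2 : T ^ 2 ≤ 0.3029 := by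
    refine le_of_sq_le_sq ?_ (by norm_num)
    calc (T ^ 2) ^ 2 = T ^ 4 := by ring
      _ ≤ 0.0917 := hT4
      _ ≤ _ := by norm_num
  have hS1 : Real.exp (T ^ 2 / 2) ≤ 1.1786 := by
    have h := Real.one_sub_le_exp_neg (T ^ 2 / 2)
    have h2 : Real.exp (T ^ 2 / 2) * Real.exp (-(T ^ 2 / 2)) = 1 := by rw [← Real.exp_add]; simp
    have h3 := mul_le_mul_of_nonneg_left h (Real.exp_pos (T ^ 2 / 2)).le
    nlinarith [Real.exp_pos (T ^ 2 / 2)]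
  have h2 : Real.exp (T ^ 2 / 2) ^ 2 ≤ 1.1786 ^ 2 := by gcongr
  norm_num at h2 hS1 ⊢
  linarith

set_option maxHeartbeats 600000 in
/-- Comparison of the energy of a time-limited function in a frequency band with the energy of
its projection onto the first Hermite functions. -/
theorem integral_band_le_hermite {n : ℕ} (hn : 1 ≤ n) {c : ℝ} (hT : 0 ≤ T) (hc0 : 0 ≤ c)
    (hc : c ≤ Real.sqrt (2 * n + 2) / 2) (hTb : T * Real.sqrt (2 * n + 2) ≤ 2.2)
    (hT3 : 24 * T ^ 3 ≤ Real.sqrt (2 * n + 2))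
    (hu : MemLp u 2 (volume.restrict (Set.Icc (-T) T))) :
    ∫ ω in (-c)..c, ‖angularFourier (volume.restrict (Set.Icc (-T) T)) u ω‖ ^ 2 ≤
      2 * Real.pi * (∑ k ∈ Finset.range (n + 1),
        ‖∫ x in Set.Icc (-T) T, u x * hermiteFun k x‖ ^ 2 +
      T ^ 3 / Real.sqrt (2 * n + 2) * (0.45 * (T * Real.sqrt (2 * n + 2)) ^ 2 +
        0.9 * (T * Real.sqrt (2 * n + 2)) + 0.25) * ∫ x in Set.Icc (-T) T, ‖u x‖ ^ 2) := by
  have hi : Integrable u (volume.restrict (Set.Icc (-T) T)) := hu.integrable (by norm_num)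
  have h1 := hermite_coeff_approx n hT hu
  have hre := abs_re_angularFourier_mul_le (μ := volume.restrict (Set.Icc (-T) T)) (u := u)
    (Real.sqrt (2 * n + 2))
  have hlow := hermiteAmp_lower hn
  have hup := hermiteAmp_upper hn
  have hr := hermiteAmp_nonneg n
  have hb2 : Real.sqrt (2 * n + 2) ^ 2 = 2 * n + 2 := Real.sq_sqrt (by positivity)
  have hn1 : (1 : ℝ) ≤ n := by exact_mod_cast hn
  have hb4 : (2 * n + 2 : ℝ) ^ 2 = Real.sqrt (2 * n + 2) ^ 4 := by
    calc _ = (Real.sqrt (2 * n + 2) ^ 2) ^ 2 := by rw [hb2]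
      _ = _ := by ring
  rw [hb4] at hlow
  set b := Real.sqrt (2 * n + 2) with hb
  have hbge : 2 ≤ b := by
    rw [hb]; apply Real.le_sqrt_of_sq_le; linarith
  have hbpos : 0 < b := by linarith
  set E := ∫ x in Set.Icc (-T) T, ‖u x‖ ^ 2 with hE
  have hE0 : 0 ≤ E := integral_nonneg fun x => by positivity
  set V := angularFourier (volume.restrict (Set.Icc (-T) T)) u with hV
  set F := ∑ k ∈ Finset.range (n + 1), ‖∫ x in Set.Icc (-T) T, u x * hermiteFun k x‖ ^ 2 with hF
  have hG : Continuous fun ω => ‖V ω‖ ^ 2 := (continuous_angularFourier hi).norm.pow 2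
  -- The Lipschitz bound for `V` combined with `(a + d)² ≤ 2a² + 2d²`.
  have hvar : ∀ x y, ‖V x‖ ^ 2 ≤ 2 * ‖V y‖ ^ 2 + (x - y) ^ 2 * (4 * T ^ 3 / 3 * E) := by
    intro x y
    have h := norm_angularFourier_sub_sq_le hT hu x y
    have h' : ‖V x‖ ≤ ‖V y‖ + ‖V x - V y‖ := by
      have := norm_add_le (V y) (V x - V y); rwa [add_sub_cancel] at this
    have h'' : ‖V x‖ ^ 2 ≤ (‖V y‖ + ‖V x - V y‖) ^ 2 := by gcongr
    nlinarith [sq_nonneg (‖V y‖ - ‖V x - V y‖)]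
  -- Energy discarded between `c` and `b` pays for the amplitude deficit `0.3/b⁴` and leaves
  -- `0.55/b` times the endpoint energies to spend on the cosine term.
  have havg := integral_symm_le_integral_sub_endpoints hG (fun _ => by positivity) hbge hc0 hc hvar
    (by positivity)
  set Ib := ∫ ω in (-b)..b, ‖V ω‖ ^ 2 with hIb
  have hIb0 : 0 ≤ Ib := intervalIntegral.integral_nonneg (by linarith) fun _ _ => by positivity
  set P := ‖V b‖ ^ 2 + ‖V (-b)‖ ^ 2 with hP
  have hP0 : 0 ≤ P := by positivity
  set R := (V b * conj (V (-b))).re with hR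
  set S := Real.exp (T ^ 2 / 2) with hS
  have hS0 : 0 ≤ S := (Real.exp_pos _).le
  have hT4 : T ^ 4 ≤ 0.0917 := by
    have e1 : 24 * T ^ 3 * T ≤ b * T := by gcongr
    nlinarith
  have hSle : S + S ^ 2 ≤ 2.5691 := exp_half_add_sq_le hT4
  have hpi := Real.pi_pos
  have hpi3 := Real.pi_gt_d4
  -- the main term and the endpoint term of the expansion
  have hmain : (1 - 0.3 / b ^ 4) * Ib ≤
      2 * Real.pi * (b * hermiteAmp n / 2 * ((1 - (-1) ^ n / (2 * (2 * n + 2))) * (Ib / 2))) := by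
    calc _ ≤ (Real.pi * b * hermiteAmp n / 2 * (1 - (-1) ^ n / (2 * (2 * n + 2)))) * Ib := by gcongr
      _ = _ := by ring
  have hσ : |((-1 : ℝ)) ^ n| = 1 := by simp
  -- The amplitude bound `1.1`, halved by the arithmetic-geometric mean inequality, gives exactly
  -- the available `0.55/b`.
  have hend : |2 * Real.pi * (b * hermiteAmp n / 2 * ((-1) ^ n / (2 * b) * R))| ≤ 0.55 / b * P := by
    have e : 2 * Real.pi * (b * hermiteAmp n / 2 * ((-1) ^ n / (2 * b) * R)) =
        (Real.pi * b * hermiteAmp n / 2) * ((-1) ^ n * R) / b := by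
      field_simp
    rw [e, abs_div, abs_mul, abs_mul, hσ, one_mul, abs_of_pos hbpos,
      abs_of_nonneg (by positivity)]
    calc _ ≤ 1.1 * (P / 2) / b := by gcongr
      _ = _ := by ring
  -- `4 · 1.1 · 2.5691 ≤ 2π · 1.8`, and `1.8` times `(Tb)²/4 + Tb/2` is `0.45 (Tb)² + 0.9 (Tb)`.
  have herr : 2 * Real.pi * (b * hermiteAmp n / 2 * (S + S ^ 2) * (b * T ^ 4 / 4 + T ^ 3 / 2) *
      (2 * T * E)) ≤ 2 * Real.pi * (T ^ 3 / b * (0.45 * (T * b) ^ 2 + 0.9 * (T * b)) * E) := by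
    have e : 2 * Real.pi * (b * hermiteAmp n / 2 * (S + S ^ 2) * (b * T ^ 4 / 4 + T ^ 3 / 2) *
      (2 * T * E)) = (Real.pi * b * hermiteAmp n / 2) * (S + S ^ 2) * (4 *
        (T ^ 3 / b * ((T * b) ^ 2 / 4 + T * b / 2) * E)) := by field_simp; ring
    rw [e]
    calc _ ≤ 1.1 * 2.5691 * (4 * (T ^ 3 / b * ((T * b) ^ 2 / 4 + T * b / 2) * E)) := by gcongr
      _ = 11.30404 * (T ^ 3 / b * ((T * b) ^ 2 / 4 + T * b / 2) * E) := by ring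
      _ ≤ 2 * Real.pi * 1.8 * (T ^ 3 / b * ((T * b) ^ 2 / 4 + T * b / 2) * E) := by
        have h18 : (11.30404 : ℝ) ≤ 2 * Real.pi * 1.8 := by linarith
        gcongr
      _ = _ := by ring
  have hdef : 1.175 / b * (4 * T ^ 3 / 3 * E) ≤ 2 * Real.pi * (T ^ 3 / b * 0.25 * E) := by
    have e : 1.175 / b * (4 * T ^ 3 / 3 * E) = 4.7 / 3 * (T ^ 3 / b * E) := by field_simp; norm_num; ring
    have : 0 ≤ T ^ 3 / b * E := by positivity
    rw [e]
    have h := mul_le_mul_of_nonneg_right hpi3.le this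
    linarith
  have hmul := mul_le_mul_of_nonneg_left (neg_le_of_abs_le h1) (by positivity : 0 ≤ 2 * Real.pi)
  have hend' := neg_le_of_abs_le hend
  linarith

end HermiteLowerBound

/-! ### Scaled Hermite functions in `L²`: orthonormality and Bessel's inequality -/

section ScaledHermite

open Complex ComplexConjugate
open scoped InnerProductSpace

theorem continuous_scaledHermiteFun (α : ℝ) (k : ℕ) : Continuous (scaledHermiteFun α k) :=
  continuous_const.mul ((continuous_hermiteFun k).comp (continuous_id.div_const α))

theorem integral_scaledHermiteFun_mul {α : ℝ} (hα : 0 < α) (j k : ℕ) :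
    ∫ x, scaledHermiteFun α j x * scaledHermiteFun α k x = if j = k then 1 else 0 := by
  have h := Measure.integral_comp_div (fun x => hermiteFun j x * hermiteFun k x) α
  rw [integral_hermiteFun_mul, abs_of_pos hα] at h
  have e : ∀ x, scaledHermiteFun α j x * scaledHermiteFun α k x =
      α⁻¹ * (hermiteFun j (x / α) * hermiteFun k (x / α)) := fun x => by
    have : α ^ (-(1 / 2) : ℝ) * α ^ (-(1 / 2) : ℝ) = α⁻¹ := by
      rw [← Real.rpow_add hα]; norm_num [Real.rpow_neg_one]
    simp only [scaledHermiteFun]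
    linear_combination hermiteFun j (x / α) * hermiteFun k (x / α) * this
  simp_rw [e]
  rw [integral_const_mul, h, smul_eq_mul, ← mul_assoc, inv_mul_cancel₀ hα.ne', one_mul]

theorem memLp_scaledHermiteFun {α : ℝ} (hα : 0 < α) (k : ℕ) :
    MemLp (fun x => (scaledHermiteFun α k x : ℂ)) 2 := by
  suffices h : MemLp (scaledHermiteFun α k) 2 from h.ofReal
  rw [memLp_two_iff_integrable_sq (continuous_scaledHermiteFun α k).aestronglyMeasurable]
  refine not_imp_comm.1 integral_undef ?_
  have := integral_scaledHermiteFun_mul hα k k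
  simp only [sq, this]; simp

/-- The scaled Hermite functions as elements of `L²`. -/
noncomputable def hermiteLp {α : ℝ} (hα : 0 < α) (k : ℕ) : Lp ℂ 2 (volume : Measure ℝ) :=
  (memLp_scaledHermiteFun hα k).toLp _

theorem coeFn_hermiteLp {α : ℝ} (hα : 0 < α) (k : ℕ) :
    hermiteLp hα k =ᵐ[volume] fun x => (scaledHermiteFun α k x : ℂ) :=
  MemLp.coeFn_toLp _

theorem inner_hermiteLp {α : ℝ} (hα : 0 < α) (k : ℕ) (f : Lp ℂ 2 (volume : Measure ℝ)) :
    ⟪hermiteLp hα k, f⟫_ℂ = ∫ y, f y * (scaledHermiteFun α k y : ℂ) := by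
  rw [L2.inner_def]
  refine integral_congr_ae ?_
  filter_upwards [coeFn_hermiteLp hα k] with x hx
  rw [hx, RCLike.inner_apply]
  simp

theorem orthonormal_hermiteLp {α : ℝ} (hα : 0 < α) : Orthonormal ℂ (hermiteLp hα) := by
  rw [orthonormal_iff_ite]
  intro j k
  rw [inner_hermiteLp]
  have : ∫ y, (hermiteLp hα k : ℝ → ℂ) y * (scaledHermiteFun α j y : ℂ) =
      ∫ y, ((scaledHermiteFun α j y * scaledHermiteFun α k y : ℝ) : ℂ) := by
    refine integral_congr_ae ?_
    filter_upwards [coeFn_hermiteLp hα k] with x hx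
    rw [hx]; push_cast; ring
  rw [this, integral_complex_ofReal, integral_scaledHermiteFun_mul hα]
  split_ifs <;> simp

theorem scaledHermiteFun_one (k : ℕ) : scaledHermiteFun 1 k = hermiteFun k := by
  funext x; simp [scaledHermiteFun]

/-- Bessel's inequality for the Hermite functions. -/
theorem sum_norm_integral_mul_hermiteFun_sq_le {G : ℝ → ℂ} (hG : MemLp G 2) (s : Finset ℕ) :
    ∑ k ∈ s, ‖∫ x, G x * hermiteFun k x‖ ^ 2 ≤ ∫ x, ‖G x‖ ^ 2 := by
  have h := (orthonormal_hermiteLp one_pos).sum_inner_products_le (x := hG.toLp G) (s := s)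
  have e1 : ∀ k, ⟪hermiteLp one_pos k, hG.toLp G⟫_ℂ = ∫ x, G x * hermiteFun k x := fun k => by
    rw [inner_hermiteLp, scaledHermiteFun_one]
    refine integral_congr_ae ?_
    filter_upwards [hG.coeFn_toLp] with x hx
    rw [hx]
  have e2 : ‖hG.toLp G‖ ^ 2 = ∫ x, ‖G x‖ ^ 2 := by
    rw [← @inner_self_eq_norm_sq ℂ, L2.inner_def, ← integral_re (L2.integrable_inner _ _)]
    refine integral_congr_ae ?_
    filter_upwards [hG.coeFn_toLp] with x hx
    rw [hx, inner_self_eq_norm_sq]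
  simpa only [e1, e2] using h

end ScaledHermite

/-! ### High Hermite coefficients through Green's formula -/

section HermiteTail

open Complex ComplexConjugate

/-- The Hermite coefficients of `G` of index `n + 1, …, n + N`. -/
noncomputable def hermiteTail (n N : ℕ) (G : ℝ → ℂ) : EuclideanSpace ℂ (Fin N) :=
  WithLp.toLp 2 fun i => ∫ x, G x * hermiteFun (n + 1 + i) x

theorem norm_hermiteTail_sq (n N : ℕ) (G : ℝ → ℂ) :
    ‖hermiteTail n N G‖ ^ 2 = ∑ i : Fin N, ‖∫ x, G x * hermiteFun (n + 1 + i) x‖ ^ 2 := by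
  rw [EuclideanSpace.norm_sq_eq]; rfl

theorem norm_hermiteTail_sq_le {n N : ℕ} {G : ℝ → ℂ} (hG : MemLp G 2) :
    ‖hermiteTail n N G‖ ^ 2 ≤ ∫ x, ‖G x‖ ^ 2 := by
  rw [norm_hermiteTail_sq]
  have h := sum_norm_integral_mul_hermiteFun_sq_le hG
    ((Finset.univ : Finset (Fin N)).image fun i : Fin N => n + 1 + (i : ℕ))
  rwa [Finset.sum_image (fun i _ j _ hij => Fin.ext (by simpa using hij))] at h

variable {g g' g'' : ℝ → ℂ} {R : ℝ}

theorem integral_eq_interval_of_support {F : ℝ → ℂ} (hR : 0 ≤ R) (hF : ∀ x, R < |x| → F x = 0) :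
    ∫ x, F x = ∫ x in (-R)..R, F x := by
  rw [intervalIntegral.integral_of_le (by linarith), ← integral_Icc_eq_integral_Ioc]
  refine (setIntegral_eq_integral_of_forall_compl_eq_zero fun x hx => hF x ?_).symm
  by_contra h
  exact hx (abs_le.1 (not_lt.1 h))

/-- Green's formula for the Hermite operator, for a function of compact support whose second
derivative exists off a countable set. -/
theorem hermite_coeff_green {s : Set ℝ} (hs : s.Countable) (hR : 0 ≤ R)
    (hg : ∀ x, HasDerivAt g (g' x) x) (hg'c : Continuous g')
    (hg' : ∀ x ∉ s, HasDerivAt g' (g'' x) x) (hg''i : IntervalIntegrable g'' volume (-R) R)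
    (hsg : ∀ x, R ≤ |x| → g x = 0) (hsg' : ∀ x, R ≤ |x| → g' x = 0)
    (hsg'' : ∀ x, R < |x| → g'' x = 0) (k : ℕ) :
    (2 * k + 1) * ∫ x, g x * hermiteFun k x =
      (∫ x, ((x ^ 2 : ℝ) * g x) * hermiteFun k x) - ∫ x, g'' x * hermiteFun k x := by
  have hgc : Continuous g := continuous_iff_continuousAt.2 fun x => (hg x).continuousAt
  have hhc : Continuous fun x => (hermiteFun k x : ℂ) :=
    continuous_ofReal.comp (continuous_hermiteFun k)
  have hhc' : Continuous fun x => (hermiteFunDeriv k x : ℂ) :=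
    continuous_ofReal.comp (continuous_hermiteFunDeriv k)
  have hx2 : Continuous fun x : ℝ => ((x ^ 2 : ℝ) : ℂ) := continuous_ofReal.comp (continuous_pow 2)
  have hi1 : IntervalIntegrable (fun x => ((x ^ 2 : ℝ) * g x) * hermiteFun k x) volume (-R) R :=
    ((hx2.mul hgc).mul hhc).intervalIntegrable _ _
  have hi2 : IntervalIntegrable (fun x => (2 * k + 1) * (g x * hermiteFun k x)) volume (-R) R :=
    (continuous_const.mul (hgc.mul hhc)).intervalIntegrable _ _
  have hi3 : IntervalIntegrable (fun x => g'' x * hermiteFun k x) volume (-R) R :=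
    hg''i.mul_continuousOn hhc.continuousOn
  have hd1 : ∀ x, HasDerivAt (fun x => (hermiteFun k x : ℂ)) (hermiteFunDeriv k x : ℂ) x := fun x =>
    (hasDerivAt_hermiteFun k x).ofReal_comp
  have hd2 : ∀ x, HasDerivAt (fun x => (hermiteFunDeriv k x : ℂ))
      (((x ^ 2 - (2 * k + 1)) * hermiteFun k x : ℝ) : ℂ) x := fun x =>
    (hasDerivAt_hermiteFunDeriv k x).ofReal_comp
  -- The Wronskian of `g` and `h_k` is continuous and vanishes at both ends, so exceptional points
  -- of `g'` contribute no jump terms.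
  have hFTC := integral_eq_of_hasDerivAt_off_countable_of_le
    (f := fun x => g x * hermiteFunDeriv k x - g' x * hermiteFun k x)
    (f' := fun x => ((x ^ 2 : ℝ) * g x) * hermiteFun k x - (2 * k + 1) * (g x * hermiteFun k x) -
      g'' x * hermiteFun k x) (a := -R) (b := R) (by linarith) hs
    ((hgc.mul hhc').sub (hg'c.mul hhc)).continuousOn
    (fun x hx => by
      have h := ((hg x).mul (hd2 x)).sub ((hg' x hx.2).mul (hd1 x))
      convert! h using 1
      push_cast; ring)
    ((hi1.sub hi2).sub hi3)
  have hR' : R ≤ |R| := le_abs_self R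
  have hR'' : R ≤ |(-R)| := by rw [abs_neg]; exact hR'
  rw [hsg R hR', hsg' R hR', hsg _ hR'', hsg' _ hR'',
    intervalIntegral.integral_sub (hi1.sub hi2) hi3, intervalIntegral.integral_sub hi1 hi2,
    intervalIntegral.integral_const_mul] at hFTC
  rw [integral_eq_interval_of_support hR (fun x hx => by rw [hsg x hx.le, zero_mul]),
    integral_eq_interval_of_support hR (fun x hx => by rw [hsg x hx.le, mul_zero, zero_mul]),
    integral_eq_interval_of_support hR (fun x hx => by rw [hsg'' x hx, zero_mul])]
  linear_combination -hFTC

/-- Every retained index `k ≥ n+1` has eigenvalue `2k+1 ≥ 2n+3`. Reading Green's formula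
coordinatewise therefore gains `2n+3` at the price of one multiplication by `x²` and one second
derivative. -/
theorem norm_hermiteTail_step {s : Set ℝ} (hs : s.Countable) (hR : 0 ≤ R)
    (hg : ∀ x, HasDerivAt g (g' x) x) (hg'c : Continuous g')
    (hg' : ∀ x ∉ s, HasDerivAt g' (g'' x) x) (hg''i : IntervalIntegrable g'' volume (-R) R)
    (hsg : ∀ x, R ≤ |x| → g x = 0) (hsg' : ∀ x, R ≤ |x| → g' x = 0)
    (hsg'' : ∀ x, R < |x| → g'' x = 0) (n N : ℕ) :
    (2 * n + 3) * ‖hermiteTail n N g‖ ≤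
      ‖hermiteTail n N fun x => (x ^ 2 : ℝ) * g x‖ + ‖hermiteTail n N g''‖ := by
  refine le_trans ?_ (norm_sub_le _ _)
  have h0 : (0 : ℝ) ≤ 2 * n + 3 := by positivity
  rw [← Real.norm_of_nonneg h0, ← norm_real, ← norm_smul]
  refine le_of_sq_le_sq ?_ (norm_nonneg _)
  rw [EuclideanSpace.norm_sq_eq, EuclideanSpace.norm_sq_eq]
  refine Finset.sum_le_sum fun i _ => ?_
  have h := hermite_coeff_green hs hR hg hg'c hg' hg''i hsg hsg' hsg'' (n + 1 + i)
  have e1 : (hermiteTail n N (fun x => (x ^ 2 : ℝ) * g x) - hermiteTail n N g'') i =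
      (2 * ((n + 1 + i : ℕ) : ℂ) + 1) * hermiteTail n N g i := by
    simp only [hermiteTail, PiLp.sub_apply]
    exact h.symm
  rw [e1, PiLp.smul_apply, smul_eq_mul, norm_mul, norm_mul]
  gcongr
  have e2 : (2 * ((n + 1 + i : ℕ) : ℂ) + 1) = ((2 * ((n + 1 + i : ℕ) : ℝ) + 1 : ℝ) : ℂ) := by
    push_cast; ring
  rw [e2, norm_real, norm_real, Real.norm_of_nonneg h0, Real.norm_of_nonneg (by positivity)]
  push_cast
  have : (0 : ℝ) ≤ (i : ℕ) := Nat.cast_nonneg _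
  linarith

end HermiteTail

/-! ### A `C¹` quadratic spline cutoff with explicit derivative bounds -/

section Cutoff

theorem hasDerivAt_max_zero {x : ℝ} (hx : x ≠ 0) :
    HasDerivAt (fun x : ℝ => max x 0) (if 0 < x then 1 else 0) x := by
  rcases lt_or_gt_of_ne hx with h | h
  · rw [if_neg h.not_gt]
    refine (hasDerivAt_const x (0 : ℝ)).congr_of_eventuallyEq ?_
    filter_upwards [gt_mem_nhds h] with y hy using max_eq_right hy.le
  · rw [if_pos h]
    refine (hasDerivAt_id x).congr_of_eventuallyEq ?_
    filter_upwards [lt_mem_nhds h] with y hy using max_eq_left hy.le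

/-- At the corner the square is `O(x²)`, so it is differentiable there; hence the spline is `C¹`,
which is all the regularity Green's formula uses. -/
theorem hasDerivAt_max_zero_sq (x : ℝ) :
    HasDerivAt (fun x : ℝ => max x 0 ^ 2) (2 * max x 0) x := by
  rcases eq_or_ne x 0 with rfl | hx
  · rw [hasDerivAt_iff_isLittleO_nhds_zero]
    simp only [zero_add, max_self, ne_eq, OfNat.ofNat_ne_zero, not_false_eq_true, zero_pow,
      sub_zero, mul_zero, smul_zero]
    refine Asymptotics.IsBigO.trans_isLittleO (g := fun x : ℝ => x ^ 2) ?_ ?_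
    · refine Asymptotics.IsBigO.of_bound 1 (Filter.Eventually.of_forall fun y => ?_)
      rw [one_mul, norm_pow, norm_pow]
      gcongr
      rw [Real.norm_eq_abs, Real.norm_eq_abs, abs_of_nonneg (le_max_right _ _)]
      exact max_le (le_abs_self y) (abs_nonneg y)
    · simpa using Asymptotics.isLittleO_pow_id (𝕜 := ℝ) (n := 2) (by norm_num)
  · have := (hasDerivAt_max_zero hx).pow 2
    convert! this using 1
    rcases lt_or_gt_of_ne hx with h | h
    · simp [max_eq_right h.le]
    · simp [h]

/-- A `C¹` quadratic spline that decreases from `1` to `0` on `[0, 1]`. -/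
noncomputable def splineStep (s : ℝ) : ℝ :=
  1 - 2 * max s 0 ^ 2 + 4 * max (s - 1 / 2) 0 ^ 2 - 2 * max (s - 1) 0 ^ 2

/-- The derivative of `splineStep`. -/
noncomputable def splineStepDeriv (s : ℝ) : ℝ :=
  -4 * max s 0 + 8 * max (s - 1 / 2) 0 - 4 * max (s - 1) 0

/-- The second derivative of `splineStep`, away from the knots `0`, `1/2`, `1`. -/
noncomputable def splineStepDeriv2 (s : ℝ) : ℝ :=
  -4 * (if 0 < s then 1 else 0) + 8 * (if 0 < s - 1 / 2 then 1 else 0) -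
    4 * (if 0 < s - 1 then 1 else 0)

theorem hasDerivAt_splineStep (s : ℝ) : HasDerivAt splineStep (splineStepDeriv s) s := by
  have h1 := hasDerivAt_max_zero_sq s
  have h2 := (hasDerivAt_max_zero_sq (s - 1 / 2)).comp_sub_const s (1 / 2)
  have h3 := (hasDerivAt_max_zero_sq (s - 1)).comp_sub_const s 1
  convert! (((h1.const_mul 2).const_sub 1).add (h2.const_mul 4)).sub (h3.const_mul 2) using 1
  rw [splineStepDeriv]; ring

theorem hasDerivAt_splineStepDeriv {s : ℝ} (h0 : s ≠ 0) (h1 : s ≠ 1 / 2) (h2 : s ≠ 1) :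
    HasDerivAt splineStepDeriv (splineStepDeriv2 s) s := by
  have k1 := hasDerivAt_max_zero h0
  have k2 := (hasDerivAt_max_zero (sub_ne_zero.2 h1)).comp_sub_const s (1 / 2)
  have k3 := (hasDerivAt_max_zero (sub_ne_zero.2 h2)).comp_sub_const s 1
  exact ((k1.const_mul (-4)).add (k2.const_mul 8)).sub (k3.const_mul 4)

theorem continuous_splineStepDeriv : Continuous splineStepDeriv := by
  unfold splineStepDeriv; fun_prop

theorem measurable_splineStepDeriv2 : Measurable splineStepDeriv2 := by
  have h : ∀ c : ℝ, Measurable fun s : ℝ => if 0 < s - c then (1 : ℝ) else 0 := fun c =>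
    Measurable.ite (measurableSet_lt measurable_const (measurable_id.sub_const c))
      measurable_const measurable_const
  have h0 := h 0
  simp only [sub_zero] at h0
  exact ((h0.const_mul _).add ((h (1 / 2)).const_mul _)).sub ((h 1).const_mul _)

theorem splineStep_of_nonpos {s : ℝ} (hs : s ≤ 0) :
    splineStep s = 1 ∧ splineStepDeriv s = 0 ∧ splineStepDeriv2 s = 0 := by
  have h1 : s - 1 / 2 ≤ 0 := by linarith
  have h2 : s - 1 ≤ 0 := by linarith
  simp only [splineStep, splineStepDeriv, splineStepDeriv2, max_eq_right hs, max_eq_right h1,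
    max_eq_right h2, if_neg (not_lt.2 hs), if_neg (not_lt.2 h1), if_neg (not_lt.2 h2)]
  norm_num

theorem splineStep_of_one_le {s : ℝ} (hs : 1 ≤ s) : splineStep s = 0 ∧ splineStepDeriv s = 0 := by
  have h0 : 0 ≤ s := by linarith
  have h1 : 0 ≤ s - 1 / 2 := by linarith
  have h2 : 0 ≤ s - 1 := by linarith
  simp only [splineStep, splineStepDeriv, max_eq_left h0, max_eq_left h1, max_eq_left h2]
  constructor <;> ring

theorem splineStepDeriv2_of_one_lt {s : ℝ} (hs : 1 < s) : splineStepDeriv2 s = 0 := by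
  rw [splineStepDeriv2, if_pos (by linarith), if_pos (by linarith), if_pos (by linarith)]
  norm_num

theorem splineStep_bounds (s : ℝ) :
    |splineStep s| ≤ 1 ∧ |splineStepDeriv s| ≤ 2 ∧ |splineStepDeriv2 s| ≤ 4 := by
  rcases le_or_gt s 0 with h | h
  · obtain ⟨h1, h2, h3⟩ := splineStep_of_nonpos h
    rw [h1, h2, h3]; norm_num
  rcases le_or_gt s (1 / 2) with h' | h'
  · have e1 : s - 1 / 2 ≤ 0 := by linarith
    have e2 : s - 1 ≤ 0 := by linarith
    simp only [splineStep, splineStepDeriv, splineStepDeriv2, max_eq_left h.le, max_eq_right e1,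
      max_eq_right e2, if_pos h, if_neg (not_lt.2 e1), if_neg (not_lt.2 e2)]
    refine ⟨abs_le.2 ⟨?_, ?_⟩, abs_le.2 ⟨?_, ?_⟩, by norm_num⟩ <;> nlinarith
  rcases le_or_gt s 1 with h'' | h''
  · have e1 : 0 < s - 1 / 2 := by linarith
    have e2 : s - 1 ≤ 0 := by linarith
    simp only [splineStep, splineStepDeriv, splineStepDeriv2, max_eq_left h.le, max_eq_left e1.le,
      max_eq_right e2, if_pos h, if_pos e1, if_neg (not_lt.2 e2)]
    refine ⟨abs_le.2 ⟨?_, ?_⟩, abs_le.2 ⟨?_, ?_⟩, by norm_num⟩ <;> nlinarith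
  · obtain ⟨h1, h2⟩ := splineStep_of_one_le h''.le
    rw [h1, h2, splineStepDeriv2_of_one_lt h'']; norm_num

/-- An even `C¹` cutoff, equal to `1` on `[-b/2, b/2]` and to `0` outside `[-0.7b, 0.7b]`. -/
noncomputable def cutoff (b ω : ℝ) : ℝ :=
  splineStep ((ω - b / 2) / (b / 5)) + splineStep ((-ω - b / 2) / (b / 5)) - 1

/-- The derivative of `cutoff`. -/
noncomputable def cutoffDeriv (b ω : ℝ) : ℝ :=
  (splineStepDeriv ((ω - b / 2) / (b / 5)) - splineStepDeriv ((-ω - b / 2) / (b / 5))) / (b / 5)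

/-- The second derivative of `cutoff`, away from finitely many points. -/
noncomputable def cutoffDeriv2 (b ω : ℝ) : ℝ :=
  (splineStepDeriv2 ((ω - b / 2) / (b / 5)) + splineStepDeriv2 ((-ω - b / 2) / (b / 5))) /
    (b / 5) ^ 2

variable {b : ℝ}

theorem hasDerivAt_cutoff (ω : ℝ) : HasDerivAt (cutoff b) (cutoffDeriv b ω) ω := by
  have i1 := ((hasDerivAt_id ω).sub_const (b / 2)).div_const (b / 5)
  have i2 := ((hasDerivAt_neg ω).sub_const (b / 2)).div_const (b / 5)
  have h1 := (hasDerivAt_splineStep ((ω - b / 2) / (b / 5))).comp ω i1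
  have h2 := (hasDerivAt_splineStep ((-ω - b / 2) / (b / 5))).comp ω i2
  convert! (h1.add h2).sub_const 1 using 1
  rw [cutoffDeriv]; ring

/-- The points where `cutoff` is not twice differentiable. -/
def cutoffKnots (b : ℝ) : Set ℝ :=
  (fun ω => (ω - b / 2) / (b / 5)) ⁻¹' {0, 1 / 2, 1} ∪
    (fun ω => (-ω - b / 2) / (b / 5)) ⁻¹' {0, 1 / 2, 1}

theorem countable_cutoffKnots (hb : 0 < b) : (cutoffKnots b).Countable := by
  have hb' : b / 5 ≠ 0 := by positivity
  refine Set.Countable.union ?_ ?_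
  · refine Set.Countable.preimage_of_injOn (Set.toFinite _).countable fun x _ y _ h => ?_
    have : (x - b / 2) / (b / 5) = (y - b / 2) / (b / 5) := h
    rw [div_left_inj' hb'] at this
    linarith
  · refine Set.Countable.preimage_of_injOn (Set.toFinite _).countable fun x _ y _ h => ?_
    have : (-x - b / 2) / (b / 5) = (-y - b / 2) / (b / 5) := h
    rw [div_left_inj' hb'] at this
    linarith

theorem hasDerivAt_cutoffDeriv {ω : ℝ} (hω : ω ∉ cutoffKnots b) :
    HasDerivAt (cutoffDeriv b) (cutoffDeriv2 b ω) ω := by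
  simp only [cutoffKnots, Set.mem_union, Set.mem_preimage, Set.mem_insert_iff,
    Set.mem_singleton_iff, not_or] at hω
  obtain ⟨⟨a1, a2, a3⟩, c1, c2, c3⟩ := hω
  have i1 := ((hasDerivAt_id ω).sub_const (b / 2)).div_const (b / 5)
  have i2 := ((hasDerivAt_neg ω).sub_const (b / 2)).div_const (b / 5)
  have h1 := (hasDerivAt_splineStepDeriv a1 a2 a3).comp ω i1
  have h2 := (hasDerivAt_splineStepDeriv c1 c2 c3).comp ω i2
  convert! (h1.sub h2).div_const (b / 5) using 1
  rw [cutoffDeriv2]; ring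

theorem continuous_cutoffDeriv : Continuous (cutoffDeriv b) := by
  unfold cutoffDeriv
  have := continuous_splineStepDeriv
  fun_prop

theorem measurable_cutoffDeriv2 : Measurable (cutoffDeriv2 b) := by
  unfold cutoffDeriv2
  have := measurable_splineStepDeriv2
  fun_prop

/-- For each `ω` one of the two spline arguments is nonpositive, so that term is the constant 1 with
zero derivatives and a single spline remains. Rescaling by `b/5` turns the bounds 2 and 4 into
`10/b` and `100/b²`. -/
theorem cutoff_bounds (hb : 0 < b) (ω : ℝ) :
    |cutoff b ω| ≤ 1 ∧ |cutoffDeriv b ω| ≤ 10 / b ∧ |cutoffDeriv2 b ω| ≤ 100 / b ^ 2 := by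
  have hb5 : 0 < b / 5 := by positivity
  have key : ∀ s r : ℝ, r ≤ 0 → |splineStep s + splineStep r - 1| ≤ 1 ∧
      |(splineStepDeriv s - splineStepDeriv r) / (b / 5)| ≤ 10 / b ∧
      |(splineStepDeriv2 s + splineStepDeriv2 r) / (b / 5) ^ 2| ≤ 100 / b ^ 2 ∧
      |(splineStepDeriv r - splineStepDeriv s) / (b / 5)| ≤ 10 / b := by
    intro s r hr
    obtain ⟨h1, h2, h3⟩ := splineStep_of_nonpos hr
    obtain ⟨k1, k2, k3⟩ := splineStep_bounds s
    rw [h1, h2, h3, sub_zero, add_zero, add_sub_cancel_right, zero_sub, neg_div, abs_neg,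
      abs_div (splineStepDeriv s), abs_div (splineStepDeriv2 s), abs_of_pos hb5, abs_of_pos (pow_pos hb5 2)]
    have e : |splineStepDeriv s| / (b / 5) ≤ 10 / b := by
      rw [div_le_div_iff₀ hb5 hb]; nlinarith
    refine ⟨k1, e, ?_, e⟩
    rw [div_le_div_iff₀ (by positivity) (by positivity)]; nlinarith [sq_nonneg b]
  rcases le_total 0 ω with h | h
  · obtain ⟨h1, h2, h3, -⟩ := key ((ω - b / 2) / (b / 5)) ((-ω - b / 2) / (b / 5))
      (div_nonpos_of_nonpos_of_nonneg (by linarith) hb5.le)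
    exact ⟨h1, h2, h3⟩
  · obtain ⟨h1, -, h3, h2⟩ := key ((-ω - b / 2) / (b / 5)) ((ω - b / 2) / (b / 5))
      (div_nonpos_of_nonpos_of_nonneg (by linarith) hb5.le)
    rw [cutoff, cutoffDeriv, cutoffDeriv2]
    exact ⟨by rwa [add_comm (splineStep _)], h2, by rwa [add_comm (splineStepDeriv2 _)]⟩

theorem cutoff_of_abs_le (hb : 0 < b) {ω : ℝ} (hω : |ω| ≤ b / 2) :
    cutoff b ω = 1 ∧ cutoffDeriv b ω = 0 ∧ cutoffDeriv2 b ω = 0 := by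
  have hb5 : 0 < b / 5 := by positivity
  obtain ⟨l, u⟩ := abs_le.1 hω
  obtain ⟨a1, a2, a3⟩ := splineStep_of_nonpos (s := (ω - b / 2) / (b / 5))
    (div_nonpos_of_nonpos_of_nonneg (by linarith) hb5.le)
  obtain ⟨c1, c2, c3⟩ := splineStep_of_nonpos (s := (-ω - b / 2) / (b / 5))
    (div_nonpos_of_nonpos_of_nonneg (by linarith) hb5.le)
  rw [cutoff, cutoffDeriv, cutoffDeriv2, a1, a2, a3, c1, c2, c3]
  norm_num

theorem cutoff_of_le_abs (hb : 0 < b) {ω : ℝ} (hω : 7 / 10 * b ≤ |ω|) :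
    cutoff b ω = 0 ∧ cutoffDeriv b ω = 0 := by
  have hb5 : 0 < b / 5 := by positivity
  rcases le_total 0 ω with h | h
  · rw [abs_of_nonneg h] at hω
    obtain ⟨a1, a2⟩ := splineStep_of_one_le (s := (ω - b / 2) / (b / 5))
      ((one_le_div hb5).2 (by linarith))
    obtain ⟨c1, c2, -⟩ := splineStep_of_nonpos (s := (-ω - b / 2) / (b / 5))
      (div_nonpos_of_nonpos_of_nonneg (by linarith) hb5.le)
    rw [cutoff, cutoffDeriv, a1, a2, c1, c2]; norm_num
  · rw [abs_of_nonpos h] at hω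
    obtain ⟨a1, a2⟩ := splineStep_of_one_le (s := (-ω - b / 2) / (b / 5))
      ((one_le_div hb5).2 (by linarith))
    obtain ⟨c1, c2, -⟩ := splineStep_of_nonpos (s := (ω - b / 2) / (b / 5))
      (div_nonpos_of_nonpos_of_nonneg (by linarith) hb5.le)
    rw [cutoff, cutoffDeriv, a1, a2, c1, c2]; norm_num

theorem cutoffDeriv2_of_lt_abs (hb : 0 < b) {ω : ℝ} (hω : 7 / 10 * b < |ω|) :
    cutoffDeriv2 b ω = 0 := by
  have hb5 : 0 < b / 5 := by positivity
  rcases le_total 0 ω with h | h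
  · rw [abs_of_nonneg h] at hω
    obtain ⟨-, -, c3⟩ := splineStep_of_nonpos (s := (-ω - b / 2) / (b / 5))
      (div_nonpos_of_nonpos_of_nonneg (by linarith) hb5.le)
    rw [cutoffDeriv2, c3, splineStepDeriv2_of_one_lt ((one_lt_div hb5).2 (by linarith))]; norm_num
  · rw [abs_of_nonpos h] at hω
    obtain ⟨-, -, c3⟩ := splineStep_of_nonpos (s := (ω - b / 2) / (b / 5))
      (div_nonpos_of_nonpos_of_nonneg (by linarith) hb5.le)
    rw [cutoffDeriv2, c3, splineStepDeriv2_of_one_lt ((one_lt_div hb5).2 (by linarith))]; norm_num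

end Cutoff

/-! ### Summation of a recursive inequality with quadratic-geometric terms -/

section SeriesBound

/-- `∑_{i ≥ j} (A + B i + C i²) θ^(i-j)`. -/
noncomputable def quadGeom (θ A B C j : ℝ) : ℝ :=
  A / (1 - θ) + B * (j / (1 - θ) + θ / (1 - θ) ^ 2) +
    C * (j ^ 2 / (1 - θ) + 2 * j * θ / (1 - θ) ^ 2 + θ * (1 + θ) / (1 - θ) ^ 3)

theorem quadGeom_sub {θ : ℝ} (hθ : θ < 1) (A B C j : ℝ) :
    quadGeom θ A B C j - θ * quadGeom θ A B C (j + 1) = A + B * j + C * j ^ 2 := by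
  have : 1 - θ ≠ 0 := by linarith
  unfold quadGeom
  field_simp
  ring

theorem quadGeom_nonneg {θ A B C j : ℝ} (hθ0 : 0 ≤ θ) (hθ : θ < 1) (hA : 0 ≤ A) (hB : 0 ≤ B)
    (hC : 0 ≤ C) (hj : 0 ≤ j) : 0 ≤ quadGeom θ A B C j := by
  have : 0 < 1 - θ := by linarith
  unfold quadGeom
  positivity

/-- The tail sums `Q j` of the right-hand series satisfy the step with equality, so `σ - Q` is
nondecreasing. The a priori bound by `D θ₁^j`, together with `Q ≥ 0`, forces `σ 0 ≤ Q 0`. -/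
theorem le_of_step_le {σ : ℕ → ℝ} {K D θ₁ θ₂ A₁ B₁ C₁ A₂ B₂ C₂ : ℝ} (hK : 0 ≤ K)
    (h1 : 0 ≤ θ₁) (h1' : θ₁ < 1) (h2 : 0 ≤ θ₂) (h2' : θ₂ < 1) (hA₁ : 0 ≤ A₁) (hB₁ : 0 ≤ B₁)
    (hC₁ : 0 ≤ C₁) (hA₂ : 0 ≤ A₂) (hB₂ : 0 ≤ B₂) (hC₂ : 0 ≤ C₂)
    (hstep : ∀ j : ℕ, σ j ≤ σ (j + 1) + K * (θ₁ ^ j * (A₁ + B₁ * j + C₁ * j ^ 2) +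
      θ₂ ^ j * (A₂ + B₂ * j + C₂ * j ^ 2)))
    (hσ : ∀ j, σ j ≤ D * θ₁ ^ j) :
    σ 0 ≤ K * (quadGeom θ₁ A₁ B₁ C₁ 0 + quadGeom θ₂ A₂ B₂ C₂ 0) := by
  set Q : ℕ → ℝ := fun j => K * (θ₁ ^ j * quadGeom θ₁ A₁ B₁ C₁ j + θ₂ ^ j * quadGeom θ₂ A₂ B₂ C₂ j)
    with hQ
  have hQ0 : ∀ j, 0 ≤ Q j := fun j => by
    have := quadGeom_nonneg h1 h1' hA₁ hB₁ hC₁ (Nat.cast_nonneg j)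
    have := quadGeom_nonneg h2 h2' hA₂ hB₂ hC₂ (Nat.cast_nonneg j)
    positivity
  have hmono : Monotone fun j => σ j - Q j := by
    refine monotone_nat_of_le_succ fun j => ?_
    have e : Q j - Q (j + 1) = K * (θ₁ ^ j * (A₁ + B₁ * j + C₁ * j ^ 2) +
      θ₂ ^ j * (A₂ + B₂ * j + C₂ * j ^ 2)) := by
      rw [← quadGeom_sub h1' A₁ B₁ C₁ j, ← quadGeom_sub h2' A₂ B₂ C₂ j]
      simp only [hQ]; push_cast; ring
    have := hstep j
    change σ j - Q j ≤ σ (j + 1) - Q (j + 1)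
    linarith
  have hlim : Filter.Tendsto (fun j : ℕ => D * θ₁ ^ j) Filter.atTop (nhds (D * 0)) :=
    (tendsto_pow_atTop_nhds_zero_of_lt_one h1 h1').const_mul D
  rw [mul_zero] at hlim
  have h0 : σ 0 - Q 0 ≤ 0 := ge_of_tendsto' hlim fun j => by
    have h2 : σ 0 - Q 0 ≤ σ j - Q j := hmono (Nat.zero_le j)
    have h3 := hσ j
    have h4 := hQ0 j
    linarith
  have e0 : Q 0 = K * (quadGeom θ₁ A₁ B₁ C₁ 0 + quadGeom θ₂ A₂ B₂ C₂ 0) := by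
    simp [hQ]
  linarith

end SeriesBound

/-! ### Derivatives of the window transform -/

section AngularDeriv

open Complex

variable {u : ℝ → ℂ} {T : ℝ}

theorem hasDerivAt_angularFourier {μ : Measure ℝ} (hu : Integrable u μ)
    (hxu : Integrable (fun x : ℝ => (x : ℂ) * u x) μ) (ω : ℝ) :
    HasDerivAt (angularFourier μ u) (angularFourier μ (fun x : ℝ => -I * ((x : ℂ) * u x)) ω) ω := by
  have h := (hasDerivAt_integral_of_dominated_loc_of_deriv_le (μ := μ)
    (F := fun ω x => u x * cexp (-(I * (ω : ℝ) * x)))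
    (F' := fun ω (x : ℝ) => -I * ((x : ℂ) * u x) * cexp (-(I * (ω : ℝ) * x))) (x₀ := ω)
    (s := Set.univ) (bound := fun x : ℝ => ‖(x : ℂ) * u x‖) Filter.univ_mem
    (Filter.Eventually.of_forall fun ω => (integrable_mul_cexp hu ω).aestronglyMeasurable)
    (integrable_mul_cexp hu ω) (integrable_mul_cexp (hxu.const_mul (-I)) ω).aestronglyMeasurable
    (Filter.Eventually.of_forall fun x ω _ => ?_) hxu.norm
    (Filter.Eventually.of_forall fun x ω _ => ?_)).2
  · exact h
  · rw [norm_mul, norm_cexp_neg_I_mul, norm_mul, norm_neg, norm_I, one_mul, mul_one]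
  · have e : ∀ ω : ℝ, cexp (-(I * (ω : ℝ) * x)) = cexp (-(I * x) * ω) := fun ω => by ring_nf
    simp only [e]
    have := (hasDerivAt_cexp_mul_ofReal (-(I * x)) ω).const_mul (u x)
    convert! this using 1
    ring

theorem norm_angularFourier_pow_sq_le (hT : 0 ≤ T)
    (hu : MemLp u 2 (volume.restrict (Set.Icc (-T) T))) (k : ℕ) {v : ℝ → ℂ}
    (hv : ∀ x, ‖v x‖ = |x| ^ k * ‖u x‖) (ω : ℝ) :
    ‖angularFourier (volume.restrict (Set.Icc (-T) T)) v ω‖ ^ 2 ≤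
      2 * T ^ (2 * k + 1) / (2 * k + 1) * ∫ x in Set.Icc (-T) T, ‖u x‖ ^ 2 := by
  refine le_trans ?_ (integral_abs_pow_mul_norm_sq_le hT hu k)
  gcongr
  refine (norm_integral_le_integral_norm _).trans (le_of_eq ?_)
  simp only [norm_mul, norm_cexp_neg_I_mul, mul_one, hv]

theorem integrable_ofReal_mul (hu : Integrable u (volume.restrict (Set.Icc (-T) T))) :
    Integrable (fun x : ℝ => (x : ℂ) * u x) (volume.restrict (Set.Icc (-T) T)) := by
  refine hu.bdd_mul (c := T) continuous_ofReal.aestronglyMeasurable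
    ((ae_restrict_mem measurableSet_Icc).mono fun x hx => ?_)
  rw [norm_real]; exact abs_le.2 hx

end AngularDeriv

/-! ### Derivatives of `ω^(2j)` times the cutoff times the window transform -/

section MonomialCutoff

open Complex

theorem abs_pow_two_mul_le {M ω : ℝ} (hω : |ω| ≤ M) (j : ℕ) : |ω ^ (2 * j)| ≤ (M ^ 2) ^ j := by
  rw [abs_pow, ← pow_mul]; gcongr

theorem abs_deriv_pow_two_mul_le {M ω : ℝ} (hM : 0 < M) (hω : |ω| ≤ M) (j : ℕ) :
    |((2 * j : ℕ) : ℝ) * ω ^ (2 * j - 1)| ≤ (M ^ 2) ^ j * (2 * j / M) := by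
  rcases j with _ | j
  -- At `j = 0` the truncated exponent `2j - 1` does no harm, because its coefficient is 0.
  · simp
  · rw [abs_mul, abs_pow, Nat.abs_cast]
    calc _ ≤ ((2 * (j + 1) : ℕ) : ℝ) * M ^ (2 * (j + 1) - 1) := by gcongr
      _ = _ := by
        rw [show 2 * (j + 1) - 1 = 2 * j + 1 by omega]
        push_cast
        field_simp
        ring

theorem abs_deriv2_pow_two_mul_le {M ω : ℝ} (hM : 0 < M) (hω : |ω| ≤ M) (j : ℕ) :
    |((2 * j : ℕ) : ℝ) * (((2 * j - 1 : ℕ) : ℝ) * ω ^ (2 * j - 1 - 1))| ≤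
      (M ^ 2) ^ j * (4 * j ^ 2 / M ^ 2) := by
  rcases j with _ | j
  · simp
  · rw [abs_mul, abs_mul, abs_pow, Nat.abs_cast, Nat.abs_cast]
    calc _ ≤ ((2 * (j + 1) : ℕ) : ℝ) * (((2 * (j + 1) : ℕ) : ℝ) * M ^ (2 * (j + 1) - 1 - 1)) := by
          gcongr; omega
      _ = _ := by
        rw [show 2 * (j + 1) - 1 - 1 = 2 * j by omega]
        push_cast
        field_simp
        ring

/-- The second derivative of `ω ^ (2 j) φ(ω) V(ω)` for the cutoff `φ`, in terms of the derivatives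
of `V`. -/
noncomputable def cutoffProdDeriv2 (b : ℝ) (V V' V'' : ℝ → ℂ) (j : ℕ) (ω : ℝ) : ℂ :=
  ((((2 * j : ℕ) : ℝ) * (((2 * j - 1 : ℕ) : ℝ) * ω ^ (2 * j - 1 - 1)) * cutoff b ω +
      2 * ((((2 * j : ℕ) : ℝ) * ω ^ (2 * j - 1)) * cutoffDeriv b ω) +
      ω ^ (2 * j) * cutoffDeriv2 b ω : ℝ) : ℂ) * V ω +
    2 * ((((2 * j : ℕ) : ℝ) * ω ^ (2 * j - 1) * cutoff b ω + ω ^ (2 * j) * cutoffDeriv b ω : ℝ) : ℂ) *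
      V' ω + ((ω ^ (2 * j) * cutoff b ω : ℝ) : ℂ) * V'' ω

/-- The first derivative of `ω ^ (2 j) φ(ω) V(ω)`. -/
noncomputable def cutoffProdDeriv (b : ℝ) (V V' : ℝ → ℂ) (j : ℕ) (ω : ℝ) : ℂ :=
  ((((2 * j : ℕ) : ℝ) * ω ^ (2 * j - 1) * cutoff b ω + ω ^ (2 * j) * cutoffDeriv b ω : ℝ) : ℂ) *
    V ω + ((ω ^ (2 * j) * cutoff b ω : ℝ) : ℂ) * V' ω

variable {b : ℝ} {V V' V'' : ℝ → ℂ}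

theorem hasDerivAt_pow_mul_cutoff (j : ℕ) (ω : ℝ) :
    HasDerivAt (fun ω => ω ^ (2 * j) * cutoff b ω)
      (((2 * j : ℕ) : ℝ) * ω ^ (2 * j - 1) * cutoff b ω + ω ^ (2 * j) * cutoffDeriv b ω) ω :=
  (hasDerivAt_pow (2 * j) ω).mul (hasDerivAt_cutoff ω)

theorem hasDerivAt_cutoffProd (hV : ∀ ω, HasDerivAt V (V' ω) ω) (j : ℕ) (ω : ℝ) :
    HasDerivAt (fun ω => ((ω ^ (2 * j) * cutoff b ω : ℝ) : ℂ) * V ω)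
      (cutoffProdDeriv b V V' j ω) ω :=
  (hasDerivAt_pow_mul_cutoff j ω).ofReal_comp.mul (hV ω)

theorem hasDerivAt_cutoffProdDeriv (hV : ∀ ω, HasDerivAt V (V' ω) ω)
    (hV' : ∀ ω, HasDerivAt V' (V'' ω) ω) (j : ℕ) {ω : ℝ} (hω : ω ∉ cutoffKnots b) :
    HasDerivAt (cutoffProdDeriv b V V' j) (cutoffProdDeriv2 b V V' V'' j ω) ω := by
  have h1 := (((hasDerivAt_pow (2 * j - 1) ω).const_mul ((2 * j : ℕ) : ℝ)).mul
    (hasDerivAt_cutoff (b := b) ω)).add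
    ((hasDerivAt_pow (2 * j) ω).mul (hasDerivAt_cutoffDeriv hω))
  have h2 := (h1.ofReal_comp.mul (hV ω)).add
    ((hasDerivAt_pow_mul_cutoff (b := b) j ω).ofReal_comp.mul (hV' ω))
  convert! h2 using 1
  rw [cutoffProdDeriv2]
  simp only [Pi.add_apply, Pi.mul_apply]
  push_cast
  ring

theorem norm_ofReal_comb_le {x y z : ℝ} {v v' v'' : ℂ} {X Y Z U U' U'' : ℝ} (hx : |x| ≤ X)
    (hy : |y| ≤ Y) (hz : |z| ≤ Z) (hv : ‖v‖ ≤ U) (hv' : ‖v'‖ ≤ U') (hv'' : ‖v''‖ ≤ U'') :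
    ‖(x : ℂ) * v + 2 * (y : ℂ) * v' + (z : ℂ) * v''‖ ≤ X * U + 2 * Y * U' + Z * U'' := by
  have hX := (abs_nonneg x).trans hx
  have hY := (abs_nonneg y).trans hy
  have hZ := (abs_nonneg z).trans hz
  refine (norm_add₃_le).trans ?_
  rw [norm_mul, norm_mul, norm_mul, norm_mul, norm_real, norm_real, norm_real, Real.norm_eq_abs,
    Real.norm_eq_abs, Real.norm_eq_abs]
  have : ‖(2 : ℂ)‖ = 2 := by simp
  rw [this]
  gcongr

variable {U U' U'' : ℝ}

theorem norm_cutoffProdDeriv2_le (hb : 0 < b) (hV : ∀ ω, ‖V ω‖ ≤ U) (hV' : ∀ ω, ‖V' ω‖ ≤ U')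
    (hV'' : ∀ ω, ‖V'' ω‖ ≤ U'') (j : ℕ) {ω : ℝ} (hω : |ω| ≤ 7 / 10 * b) :
    ‖cutoffProdDeriv2 b V V' V'' j ω‖ ≤ ((7 / 10 * b) ^ 2) ^ j *
      ((4 * j ^ 2 / (7 / 10 * b) ^ 2 + 2 * (2 * j / (7 / 10 * b)) * (10 / b) + 100 / b ^ 2) * U +
        2 * (2 * j / (7 / 10 * b) + 10 / b) * U' + U'') := by
  have hM : 0 < 7 / 10 * b := by positivity
  obtain ⟨c0, c1, c2⟩ := cutoff_bounds hb ω
  have q0 := abs_pow_two_mul_le hω j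
  have q1 := abs_deriv_pow_two_mul_le hM hω j
  have q2 := abs_deriv2_pow_two_mul_le hM hω j
  set M := 7 / 10 * b
  refine (norm_ofReal_comb_le (X := (M ^ 2) ^ j * (4 * j ^ 2 / M ^ 2) * 1 +
    2 * ((M ^ 2) ^ j * (2 * j / M) * (10 / b)) + (M ^ 2) ^ j * (100 / b ^ 2))
    (Y := (M ^ 2) ^ j * (2 * j / M) * 1 + (M ^ 2) ^ j * (10 / b)) (Z := (M ^ 2) ^ j * 1)
    ?_ ?_ ?_ (hV ω) (hV' ω) (hV'' ω)).trans (le_of_eq ?_)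
  · refine (abs_add_three _ _ _).trans ?_
    rw [abs_mul, abs_mul 2, abs_mul (_ * _) (cutoffDeriv b ω), abs_mul (_ ^ _) (cutoffDeriv2 b ω),
      abs_two]
    gcongr
  · refine (abs_add_le _ _).trans ?_
    rw [abs_mul, abs_mul (_ ^ _)]
    gcongr
  · rw [abs_mul]
    gcongr
  · ring

/-- On the inner half-band the cutoff has zero derivatives and the monomial is smaller. Treating
this region apart from the collar replaces the ratio `0.49` by `0.25` and drops the large constants
that come from the cutoff. -/
theorem norm_cutoffProdDeriv2_le_inner (hb : 0 < b) (hV : ∀ ω, ‖V ω‖ ≤ U)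
    (hV' : ∀ ω, ‖V' ω‖ ≤ U') (hV'' : ∀ ω, ‖V'' ω‖ ≤ U'') (j : ℕ) {ω : ℝ} (hω : |ω| ≤ b / 2) :
    ‖cutoffProdDeriv2 b V V' V'' j ω‖ ≤ ((b / 2) ^ 2) ^ j *
      ((4 * j ^ 2 / (b / 2) ^ 2) * U + 2 * (2 * j / (b / 2)) * U' + U'') := by
  have hM : 0 < b / 2 := by positivity
  obtain ⟨c0, c1, c2⟩ := cutoff_of_abs_le hb hω
  have q0 := abs_pow_two_mul_le hω j
  have q1 := abs_deriv_pow_two_mul_le hM hω j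
  have q2 := abs_deriv2_pow_two_mul_le hM hω j
  rw [cutoffProdDeriv2, c0, c1, c2]
  simp only [mul_one, mul_zero, add_zero]
  refine (norm_ofReal_comb_le q2 q1 q0 (hV ω) (hV' ω) (hV'' ω)).trans (le_of_eq ?_)
  ring

theorem cutoffProdDeriv2_of_lt_abs (hb : 0 < b) (j : ℕ) {ω : ℝ} (hω : 7 / 10 * b < |ω|) :
    cutoffProdDeriv2 b V V' V'' j ω = 0 := by
  obtain ⟨c0, c1⟩ := cutoff_of_le_abs hb hω.le
  rw [cutoffProdDeriv2, c0, c1, cutoffDeriv2_of_lt_abs hb hω]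
  simp

theorem measurable_cutoffProdDeriv2 (hV : Continuous V) (hV' : Continuous V')
    (hV'' : Continuous V'') (j : ℕ) : Measurable (cutoffProdDeriv2 b V V' V'' j) := by
  have h0 : Continuous (cutoff b) :=
    continuous_iff_continuousAt.2 fun ω => (hasDerivAt_cutoff ω).continuousAt
  have h1 : Continuous (cutoffDeriv b) := continuous_cutoffDeriv
  have h2 : Measurable (cutoffDeriv2 b) := measurable_cutoffDeriv2
  unfold cutoffProdDeriv2
  have := hV.measurable
  have := hV'.measurable
  have := hV''.measurable
  have := h0.measurable
  have := h1.measurable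
  fun_prop

end MonomialCutoff

/-! ### Iteration of the Green step: decay of the Hermite tail -/

section CutoffTail

open Complex

variable {b : ℝ}

theorem norm_hermiteTail_le_of_bounds {n N : ℕ} (hb : 0 < b) {G : ℝ → ℂ} (hG : Measurable G)
    {s₁ s₂ : ℝ} (hs₁ : 0 ≤ s₁) (hs₂ : 0 ≤ s₂) (h1 : ∀ ω, |ω| ≤ 7 / 10 * b → ‖G ω‖ ≤ s₁)
    (h2 : ∀ ω, |ω| ≤ b / 2 → ‖G ω‖ ≤ s₂) (h0 : ∀ ω, 7 / 10 * b < |ω| → G ω = 0) :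
    ‖hermiteTail n N G‖ ≤ Real.sqrt b * (0.6325 * s₁ + s₂) := by
  set B : ℝ → ℝ := fun ω => (Set.Icc (-(7 / 10 * b)) (7 / 10 * b)).indicator (fun _ => s₁ ^ 2) ω +
    (Set.Icc (-(b / 2)) (b / 2)).indicator (fun _ => s₂ ^ 2 - s₁ ^ 2) ω with hB
  have hi1 : Integrable ((Set.Icc (-(7 / 10 * b)) (7 / 10 * b)).indicator (fun _ => s₁ ^ 2)) :=
    (integrable_indicator_iff measurableSet_Icc).2 (by simp)
  have hi2 : Integrable ((Set.Icc (-(b / 2)) (b / 2)).indicator (fun _ => s₂ ^ 2 - s₁ ^ 2)) :=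
    (integrable_indicator_iff measurableSet_Icc).2 (by simp)
  have hBi : Integrable B := hi1.add hi2
  have hle : ∀ ω, ‖G ω‖ ^ 2 ≤ B ω := by
    intro ω
    rcases le_or_gt |ω| (b / 2) with h | h
    · have hm : |ω| ≤ 7 / 10 * b := by linarith
      simp only [hB]
      rw [Set.indicator_of_mem (Set.mem_Icc.2 (abs_le.1 hm)),
        Set.indicator_of_mem (Set.mem_Icc.2 (abs_le.1 h))]
      have := h2 ω h
      have : ‖G ω‖ ^ 2 ≤ s₂ ^ 2 := by gcongr
      linarith
    · have hnm : ω ∉ Set.Icc (-(b / 2)) (b / 2) := fun hm => h.not_ge (abs_le.2 hm)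
      simp only [hB]
      rw [Set.indicator_of_notMem hnm, add_zero]
      rcases le_or_gt |ω| (7 / 10 * b) with h' | h'
      · rw [Set.indicator_of_mem (Set.mem_Icc.2 (abs_le.1 h'))]
        have := h1 ω h'
        gcongr
      · rw [Set.indicator_of_notMem (fun hm => h'.not_ge (abs_le.2 (Set.mem_Icc.1 hm))), h0 ω h']
        simp
  have hG2 : MemLp G 2 := by
    rw [memLp_two_iff_integrable_sq_norm hG.aestronglyMeasurable]
    refine hBi.mono' (hG.norm.pow_const 2).aestronglyMeasurable (Filter.Eventually.of_forall fun ω => ?_)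
    rw [Real.norm_of_nonneg (by positivity)]
    exact hle ω
  have hint : ∫ ω, ‖G ω‖ ^ 2 ≤ 0.4 * b * s₁ ^ 2 + b * s₂ ^ 2 := by
    calc _ ≤ ∫ ω, B ω := integral_mono ((memLp_two_iff_integrable_sq_norm
          hG.aestronglyMeasurable).1 hG2) hBi hle
      _ = _ := by
        simp only [hB]
        rw [integral_add hi1 hi2, integral_indicator_const _ measurableSet_Icc,
          integral_indicator_const _ measurableSet_Icc, Real.volume_real_Icc_of_le (by linarith),
          Real.volume_real_Icc_of_le (by linarith)]
        simp only [smul_eq_mul]; ring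
  refine le_of_sq_le_sq (((norm_hermiteTail_sq_le hG2).trans hint).trans ?_) (by positivity)
  rw [mul_pow, Real.sq_sqrt hb.le]
  have h3 := mul_nonneg hs₁ hs₂
  -- The collar `b/2 < |ω| ≤ 0.7 b` has measure `0.4 b` and the inner interval measure `b`; `0.6325`
  -- is `√0.4` rounded up.
  have h4 : 0.4 * s₁ ^ 2 + s₂ ^ 2 ≤ (0.6325 * s₁ + s₂) ^ 2 := by nlinarith [sq_nonneg s₁]
  calc _ = b * (0.4 * s₁ ^ 2 + s₂ ^ 2) := by ring
    _ ≤ _ := by gcongr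

variable {V V' V'' : ℝ → ℂ} {U t : ℝ}

/-- The high Hermite coefficients of a slowly varying function are small after a cutoff. -/
theorem norm_hermiteTail_cutoff_le {n N : ℕ} (hb : 0 < b) (hbn : b ^ 2 ≤ 2 * n + 3) (ht : 0 ≤ t)
    (hV : ∀ ω, HasDerivAt V (V' ω) ω) (hV' : ∀ ω, HasDerivAt V' (V'' ω) ω) (hV''c : Continuous V'')
    (hU : ∀ ω, ‖V ω‖ ≤ U) (hU' : ∀ ω, ‖V' ω‖ ≤ 0.5774 * (t / b) * U)
    (hU'' : ∀ ω, ‖V'' ω‖ ≤ 0.4473 * (t / b) ^ 2 * U) :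
    ‖hermiteTail n N fun ω => (cutoff b ω : ℂ) * V ω‖ ≤
      Real.sqrt b * U / b ^ 4 * (232.5 + 20.4 * t + 1.16 * t ^ 2) := by
  have hU0 : 0 ≤ U := (norm_nonneg _).trans (hU 0)
  have hVc : Continuous V := continuous_iff_continuousAt.2 fun ω => (hV ω).continuousAt
  have hV'c : Continuous V' := continuous_iff_continuousAt.2 fun ω => (hV' ω).continuousAt
  have hcc : Continuous (cutoff b) :=
    continuous_iff_continuousAt.2 fun ω => (hasDerivAt_cutoff ω).continuousAt
  have hM : 0 < 7 / 10 * b := by positivity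
  set g : ℕ → ℝ → ℂ := fun j ω => ((ω ^ (2 * j) * cutoff b ω : ℝ) : ℂ) * V ω with hg
  -- Division by `b^(2j)` puts the Green step in the form required by `le_of_step_le`, with ratios
  -- `0.7² = 0.49` and `0.5² = 0.25`.
  set σ : ℕ → ℝ := fun j => ‖hermiteTail n N (g j)‖ / (b ^ 2) ^ j with hσ
  -- the Green step
  have hstep : ∀ j, b ^ 2 * ‖hermiteTail n N (g j)‖ ≤ ‖hermiteTail n N (g (j + 1))‖ +
      Real.sqrt b * (0.6325 * (((7 / 10 * b) ^ 2) ^ j * ((4 * j ^ 2 / (7 / 10 * b) ^ 2 +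
        2 * (2 * j / (7 / 10 * b)) * (10 / b) + 100 / b ^ 2) * U +
        2 * (2 * j / (7 / 10 * b) + 10 / b) * (0.5774 * (t / b) * U) +
        0.4473 * (t / b) ^ 2 * U)) + ((b / 2) ^ 2) ^ j * ((4 * j ^ 2 / (b / 2) ^ 2) * U +
        2 * (2 * j / (b / 2)) * (0.5774 * (t / b) * U) + 0.4473 * (t / b) ^ 2 * U)) := by
    intro j
    have hmeas := measurable_cutoffProdDeriv2 (b := b) hVc hV'c hV''c j
    have hd := norm_hermiteTail_step (countable_cutoffKnots hb) hM.le
      (hasDerivAt_cutoffProd (b := b) hV j) (g' := cutoffProdDeriv b V V' j)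
      (g'' := cutoffProdDeriv2 b V V' V'' j)
      (by
        have h1 : Continuous (cutoffDeriv b) := continuous_cutoffDeriv
        unfold cutoffProdDeriv
        fun_prop)
      (fun ω hω => hasDerivAt_cutoffProdDeriv hV hV' j hω)
      (by
        rw [intervalIntegrable_iff]
        refine Measure.integrableOn_of_bounded (M := ((7 / 10 * b) ^ 2) ^ j *
          ((4 * j ^ 2 / (7 / 10 * b) ^ 2 + 2 * (2 * j / (7 / 10 * b)) * (10 / b) + 100 / b ^ 2) * U +
          2 * (2 * j / (7 / 10 * b) + 10 / b) * (0.5774 * (t / b) * U) + 0.4473 * (t / b) ^ 2 * U))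
          (by simp) hmeas.aestronglyMeasurable ?_
        refine (ae_restrict_mem measurableSet_uIoc).mono fun ω hω => ?_
        rw [Set.uIoc_of_le (by linarith)] at hω
        exact norm_cutoffProdDeriv2_le hb hU hU' hU'' j (abs_le.2 ⟨hω.1.le, hω.2⟩))
      (fun ω hω => by rw [(cutoff_of_le_abs hb hω).1]; simp)
      (fun ω hω => by
        obtain ⟨c0, c1⟩ := cutoff_of_le_abs hb hω
        rw [cutoffProdDeriv, c0, c1]; simp)
      (fun ω hω => cutoffProdDeriv2_of_lt_abs hb j hω) n N
    have hsup := norm_hermiteTail_le_of_bounds (n := n) (N := N) hb hmeas (by positivity)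
      (by positivity) (fun ω hω => norm_cutoffProdDeriv2_le hb hU hU' hU'' j hω)
      (fun ω hω => norm_cutoffProdDeriv2_le_inner hb hU hU' hU'' j hω)
      (fun ω hω => cutoffProdDeriv2_of_lt_abs hb j hω)
    have e : (fun x => ((x ^ 2 : ℝ) : ℂ) * (((x ^ (2 * j) * cutoff b x : ℝ) : ℂ) * V x)) =
        g (j + 1) := by
      funext x; simp only [hg]; push_cast; ring
    rw [e] at hd
    have h3 : b ^ 2 * ‖hermiteTail n N (g j)‖ ≤ (2 * n + 3) * ‖hermiteTail n N (g j)‖ := by gcongr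
    exact (h3.trans hd).trans (by gcongr)
  -- Since `g j` is supported in `|ω| ≤ 0.7 b`, the normalized tails tend to 0 and the iteration
  -- leaves no remainder.
  have hcrude : ∀ j, σ j ≤ Real.sqrt b * (1.6325 * U) * 0.49 ^ j := by
    intro j
    have hbd : ∀ ω, |ω| ≤ 7 / 10 * b → ‖g j ω‖ ≤ ((7 / 10 * b) ^ 2) ^ j * U := fun ω hω => by
      simp only [hg]
      rw [norm_mul, norm_real, Real.norm_eq_abs, abs_mul]
      have h1 := abs_pow_two_mul_le hω j
      have h2 := (cutoff_bounds hb ω).1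
      calc _ ≤ (((7 / 10 * b) ^ 2) ^ j * 1) * U := by gcongr; exact hU ω
        _ = _ := by ring
    have := norm_hermiteTail_le_of_bounds (n := n) (N := N) hb (G := g j)
      (Continuous.measurable (by simp only [hg]; fun_prop)) (by positivity) (by positivity) hbd
      (fun ω hω => hbd ω (by linarith))
      (fun ω hω => by simp only [hg]; rw [(cutoff_of_le_abs hb hω.le).1]; simp)
    simp only [hσ]
    rw [div_le_iff₀ (by positivity)]
    refine this.trans (le_of_eq ?_)
    have e : ((7 / 10 * b) ^ 2) ^ j = 0.49 ^ j * (b ^ 2) ^ j := by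
      rw [← mul_pow]; congr 1; ring
    rw [e]; ring
  have hσstep : ∀ j : ℕ, σ j ≤ σ (j + 1) + Real.sqrt b * U / b ^ 4 *
      (0.49 ^ j * (0.6325 * (100 + 11.548 * t + 0.4473 * t ^ 2) +
        0.6325 * (57.15 + 3.3 * t) * j + 0.6325 * 8.164 * j ^ 2) +
      0.25 ^ j * (0.4473 * t ^ 2 + 4.6192 * t * j + 16 * j ^ 2)) := by
    intro j
    have h := hstep j
    have e1 : ((7 / 10 * b) ^ 2) ^ j = 0.49 ^ j * (b ^ 2) ^ j := by
      rw [← mul_pow]; congr 1; ring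
    have e2 : ((b / 2) ^ 2) ^ j = 0.25 ^ j * (b ^ 2) ^ j := by
      rw [← mul_pow]; congr 1; ring
    rw [e1, e2] at h
    have hp : 0 < b ^ 2 * (b ^ 2) ^ j := by positivity
    simp only [hσ]
    have hj : (0 : ℝ) ≤ j := Nat.cast_nonneg j
    have f1 : (4 * (j : ℝ) ^ 2 / (7 / 10 * b) ^ 2 + 2 * (2 * j / (7 / 10 * b)) * (10 / b) +
        100 / b ^ 2) * U + 2 * (2 * j / (7 / 10 * b) + 10 / b) * (0.5774 * (t / b) * U) +
        0.4473 * (t / b) ^ 2 * U ≤ U / b ^ 2 * (100 + 11.548 * t + 0.4473 * t ^ 2 +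
          (57.15 + 3.3 * t) * j + 8.164 * j ^ 2) := by
      have e3 : (4 * (j : ℝ) ^ 2 / (7 / 10 * b) ^ 2 + 2 * (2 * j / (7 / 10 * b)) * (10 / b) +
        100 / b ^ 2) * U + 2 * (2 * j / (7 / 10 * b) + 10 / b) * (0.5774 * (t / b) * U) +
        0.4473 * (t / b) ^ 2 * U = U / b ^ 2 * (100 + 11.548 * t + 0.4473 * t ^ 2 +
          (400 / 7 + 0.5774 * 40 / 7 * t) * j + 400 / 49 * j ^ 2) := by
        field_simp; ring
      rw [e3]
      gcongr <;> norm_num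
    have f2 : (4 * (j : ℝ) ^ 2 / (b / 2) ^ 2) * U + 2 * (2 * j / (b / 2)) * (0.5774 * (t / b) * U) +
        0.4473 * (t / b) ^ 2 * U = U / b ^ 2 * (0.4473 * t ^ 2 + 4.6192 * t * j + 16 * j ^ 2) := by
      field_simp; ring
    rw [f2] at h
    have h4 : b ^ 2 * ‖hermiteTail n N (g j)‖ ≤ ‖hermiteTail n N (g (j + 1))‖ +
        Real.sqrt b * (0.6325 * (0.49 ^ j * (b ^ 2) ^ j * (U / b ^ 2 * (100 + 11.548 * t +
          0.4473 * t ^ 2 + (57.15 + 3.3 * t) * j + 8.164 * j ^ 2))) + 0.25 ^ j * (b ^ 2) ^ j *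
          (U / b ^ 2 * (0.4473 * t ^ 2 + 4.6192 * t * j + 16 * j ^ 2))) := by
      refine h.trans ?_
      gcongr
    have h5 := div_le_div_of_nonneg_right h4 hp.le
    have e5 : b ^ 2 * ‖hermiteTail n N (g j)‖ / (b ^ 2 * (b ^ 2) ^ j) =
        ‖hermiteTail n N (g j)‖ / (b ^ 2) ^ j := by field_simp
    rw [e5] at h5
    refine h5.trans (le_of_eq ?_)
    have hp' : (b ^ 2) ^ j ≠ 0 := by positivity
    rw [pow_succ (b ^ 2) j]
    generalize (b ^ 2) ^ j = p at hp'
    field_simp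
  have hfin := le_of_step_le (σ := σ) (by positivity) (by norm_num) (by norm_num) (by norm_num)
    (by norm_num) (by positivity) (by positivity) (by norm_num) (by positivity) (by positivity)
    (by norm_num) hσstep hcrude
  have e0 : σ 0 = ‖hermiteTail n N fun ω => (cutoff b ω : ℂ) * V ω‖ := by
    simp [hσ, hg]
  rw [e0] at hfin
  refine hfin.trans (mul_le_mul_of_nonneg_left ?_ (by positivity))
  simp only [quadGeom]
  norm_num
  nlinarith [sq_nonneg t]

/-- The Hermite tail of the band-localized window transform. -/
theorem norm_hermiteTail_cutoff_angularFourier_le {n : ℕ} {u : ℝ → ℂ} {T : ℝ} (hT : 0 ≤ T)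
    (hTb : 2.2 ≤ T * Real.sqrt (2 * n + 2)) (hu : MemLp u 2 (volume.restrict (Set.Icc (-T) T)))
    (N : ℕ) :
    ‖hermiteTail n N fun ω => (cutoff (Real.sqrt (2 * n + 2)) ω : ℂ) *
      angularFourier (volume.restrict (Set.Icc (-T) T)) u ω‖ ^ 2 ≤
      2 * Real.pi * ((24 * T ^ 3 / Real.sqrt (2 * n + 2)) ^ 2 *
        ∫ x in Set.Icc (-T) T, ‖u x‖ ^ 2) := by
  have hi : Integrable u (volume.restrict (Set.Icc (-T) T)) := hu.integrable (by norm_num)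
  have hb := sqrt_two_mul_add_two_pos n
  have hb2 : Real.sqrt (2 * n + 2) ^ 2 = 2 * n + 2 := Real.sq_sqrt (by positivity)
  set b := Real.sqrt (2 * n + 2)
  set E := ∫ x in Set.Icc (-T) T, ‖u x‖ ^ 2 with hE
  have hE0 : 0 ≤ E := integral_nonneg fun x => by positivity
  set t := T * b with ht
  have ht0 : 0 ≤ t := by positivity
  have htb : t / b = T := by rw [ht]; field_simp
  set U := Real.sqrt (2 * T * E) with hU
  have hU2 : U ^ 2 = 2 * T * E := Real.sq_sqrt (by positivity)
  have i1 := integrable_ofReal_mul hi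
  have i2 : Integrable (fun x : ℝ => (x : ℂ) * (-I * ((x : ℂ) * u x)))
      (volume.restrict (Set.Icc (-T) T)) := integrable_ofReal_mul (i1.const_mul (-I))
  have hmain := norm_hermiteTail_cutoff_le (n := n) (N := N) hb (by linarith) ht0 (U := U)
    (hasDerivAt_angularFourier hi i1) (hasDerivAt_angularFourier (i1.const_mul (-I)) i2)
    (continuous_angularFourier (i2.const_mul (-I)))
    (fun ω => by
      refine le_of_sq_le_sq ?_ (by positivity)
      rw [hU2]
      exact norm_angularFourier_sq_le hT hu ω)
    (fun ω => by
      refine le_of_sq_le_sq ?_ (by positivity)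
      -- The first moment contributes `2T³/3 = T² · 2T / 3`, and `0.5774` is `1/√3` rounded up.
      -- Likewise `0.4473` below is `1/√5` rounded up.
      refine (norm_angularFourier_pow_sq_le hT hu 1 (fun x => by simp) ω).trans ?_
      rw [mul_pow, hU2, htb, ← hE]
      have : 0 ≤ T ^ 3 * E := by positivity
      norm_num
      nlinarith)
    (fun ω => by
      refine le_of_sq_le_sq ?_ (by positivity)
      refine (norm_angularFourier_pow_sq_le hT hu 2 (fun x => by simp; rw [← sq_abs x]; ring) ω).trans ?_
      rw [mul_pow, hU2, htb, ← hE]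
      have : 0 ≤ T ^ 5 * E := by positivity
      norm_num
      nlinarith)
  -- Nearly an equality at the threshold `t = 2.2`.
  have hX : 232.5 + 20.4 * t + 1.16 * t ^ 2 ≤ 58.48 * t ^ 2 := by nlinarith
  -- The right side is the size that reproduces `24 T³ / b` after squaring, since `24² = 576`. One
  -- factor `t` is traded for `2.2`.
  have h1 : (232.5 + 20.4 * t + 1.16 * t ^ 2) ^ 2 ≤ 576 * Real.pi * t ^ 5 := by
    have hpi := Real.pi_gt_d2
    calc _ ≤ (58.48 * t ^ 2) ^ 2 := by gcongr
      _ = 3419.9104 * t ^ 4 := by ring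
      _ ≤ (576 * 3.14 * 2.2) * t ^ 4 := by gcongr; norm_num
      _ = 576 * 3.14 * t ^ 4 * 2.2 := by ring
      _ ≤ 576 * Real.pi * t ^ 4 * t := by gcongr
      _ = _ := by ring
  calc _ ≤ (Real.sqrt b * U / b ^ 4 * (232.5 + 20.4 * t + 1.16 * t ^ 2)) ^ 2 := by gcongr
    _ = b * (2 * T * E) / b ^ 8 * (232.5 + 20.4 * t + 1.16 * t ^ 2) ^ 2 := by
      rw [mul_pow, div_pow, mul_pow, Real.sq_sqrt hb.le, hU2]; ring
    _ ≤ b * (2 * T * E) / b ^ 8 * (576 * Real.pi * t ^ 5) := by gcongr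
    _ = _ := by
      rw [ht]; field_simp; ring

end CutoffTail

/-! ### The `L²` Fourier transform and the Fourier integral -/

section LpFourier

open Complex ComplexConjugate
open scoped SchwartzMap

theorem fourier_eq_angularFourier (g : ℝ → ℂ) (ξ : ℝ) :
    𝓕 g ξ = angularFourier volume g (2 * Real.pi * ξ) := by
  rw [Real.fourier_eq', angularFourier]
  congr 1; funext x
  rw [smul_eq_mul, mul_comm]
  congr 2
  simp
  ring

theorem continuous_fourier_of_integrable {g : ℝ → ℂ} (hg : Integrable g) : Continuous (𝓕 g) := by
  have : 𝓕 g = fun ξ => angularFourier volume g (2 * Real.pi * ξ) :=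
    funext (fourier_eq_angularFourier g)
  rw [this]
  exact (continuous_angularFourier hg).comp (continuous_const_mul _)

/-- The Fourier transform on `L²` agrees with the Fourier integral on integrable functions. -/
theorem Lp_fourier_ae_eq (f : Lp ℂ 2 (volume : Measure ℝ)) (hf : Integrable f) :
    (𝓕 f : Lp ℂ 2 (volume : Measure ℝ)) =ᵐ[volume] 𝓕 (f : ℝ → ℂ) := by
  refine ae_eq_of_integral_contDiff_smul_eq
    ((Lp.memLp _).locallyIntegrable (by norm_num))
    (continuous_fourier_of_integrable hf).locallyIntegrable fun g hg hgs => ?_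
  have hs : HasCompactSupport fun x => (g x : ℂ) := hgs.comp_left (g := fun x : ℝ => (x : ℂ)) rfl
  have hsm : ContDiff ℝ (⊤ : ℕ∞) fun x => (g x : ℂ) := ofRealCLM.contDiff.comp hg
  set ψ : 𝓢(ℝ, ℂ) := hs.toSchwartzMap hsm with hψ
  have hψx : ∀ x, ψ x = (g x : ℂ) := fun x => rfl
  -- The `L²` transform agrees with the distributional one, and the multiplication formula moves the
  -- transform from the test function onto `f`. Testing with all smooth compactly supported
  -- functions identifies the two.
  have h1 := congrArg (fun d => d ψ) (Lp.fourier_toTemperedDistribution_eq f)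
  simp only [TemperedDistribution.fourier_apply, Lp.toTemperedDistribution_apply] at h1
  have h2 : ∫ ξ, 𝓕 ψ ξ • f ξ = ∫ x, ψ x • 𝓕 (f : ℝ → ℂ) x := by
    simpa using! VectorFourier.integral_fourierIntegral_smul_eq_flip (L := innerₗ ℝ)
      Real.continuous_fourierChar continuous_inner ψ.integrable hf
  rw [h2] at h1
  simpa [hψx] using h1.symm

end LpFourier

/-! ### Multiplication operators, Fourier multipliers and the Hermite projection -/

section Multiplier

open Complex ComplexConjugate
open scoped InnerProductSpace

theorem memLp_mul_of_bound {m : ℝ → ℝ} (hm : Measurable m) (hb : ∀ x, |m x| ≤ 1)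
    (f : Lp ℂ 2 (volume : Measure ℝ)) : MemLp (fun x => (m x : ℂ) * f x) 2 := by
  refine (Lp.memLp f).of_le ((hm.complex_ofReal.aestronglyMeasurable).mul
    (Lp.aestronglyMeasurable f)) (Filter.Eventually.of_forall fun x => ?_)
  rw [norm_mul, norm_real]
  exact mul_le_of_le_one_left (norm_nonneg _) (hb x)

/-- Multiplication by a real function bounded by `1`, as an operator on `L²`. -/
noncomputable def mulLp {m : ℝ → ℝ} (hm : Measurable m) (hb : ∀ x, |m x| ≤ 1) :
    Lp ℂ 2 (volume : Measure ℝ) →L[ℂ] Lp ℂ 2 (volume : Measure ℝ) :=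
  LinearMap.mkContinuous
    { toFun := fun f => (memLp_mul_of_bound hm hb f).toLp _
      map_add' := fun f g => by
        rw [← MemLp.toLp_add, MemLp.toLp_eq_toLp_iff]
        filter_upwards [Lp.coeFn_add f g] with x hx
        rw [hx, Pi.add_apply, Pi.add_apply, mul_add]
      map_smul' := fun c f => by
        rw [RingHom.id_apply, ← MemLp.toLp_const_smul, MemLp.toLp_eq_toLp_iff]
        filter_upwards [Lp.coeFn_smul c f] with x hx
        rw [hx, Pi.smul_apply, Pi.smul_apply, smul_eq_mul, smul_eq_mul]
        ring }
    1 fun f => by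
      rw [one_mul]
      refine Lp.norm_le_norm_of_ae_le ?_
      filter_upwards [(memLp_mul_of_bound hm hb f).coeFn_toLp] with x hx
      simp only [LinearMap.coe_mk, AddHom.coe_mk]
      rw [hx, norm_mul, norm_real]
      exact mul_le_of_le_one_left (norm_nonneg _) (hb x)

variable {m : ℝ → ℝ} (hm : Measurable m) (hb : ∀ x, |m x| ≤ 1)

theorem coeFn_mulLp (f : Lp ℂ 2 (volume : Measure ℝ)) :
    mulLp hm hb f =ᵐ[volume] fun x => (m x : ℂ) * f x :=
  (memLp_mul_of_bound hm hb f).coeFn_toLp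

theorem norm_mulLp_le (f : Lp ℂ 2 (volume : Measure ℝ)) : ‖mulLp hm hb f‖ ≤ ‖f‖ := by
  refine Lp.norm_le_norm_of_ae_le ?_
  filter_upwards [coeFn_mulLp hm hb f] with x hx
  rw [hx, norm_mul, norm_real]
  exact mul_le_of_le_one_left (norm_nonneg _) (hb x)

theorem inner_mulLp (f g : Lp ℂ 2 (volume : Measure ℝ)) :
    ⟪mulLp hm hb f, g⟫_ℂ = ⟪f, mulLp hm hb g⟫_ℂ := by
  rw [L2.inner_def, L2.inner_def]
  refine integral_congr_ae ?_
  filter_upwards [coeFn_mulLp hm hb f, coeFn_mulLp hm hb g] with x h1 h2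
  rw [h1, h2, RCLike.inner_apply, RCLike.inner_apply, map_mul, conj_ofReal]
  ring

theorem norm_Lp_sq (f : Lp ℂ 2 (volume : Measure ℝ)) : ‖f‖ ^ 2 = ∫ x, ‖f x‖ ^ 2 := by
  rw [← @inner_self_eq_norm_sq ℂ, L2.inner_def, ← integral_re (L2.integrable_inner _ _)]
  congr 1; funext x
  rw [inner_self_eq_norm_sq]

theorem isOrthoProj_mulLp (h01 : ∀ x, m x * m x = m x) : IsOrthoProj (mulLp hm hb) where
  symm := inner_mulLp hm hb
  idem f := by
    refine Lp.ext ?_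
    filter_upwards [coeFn_mulLp hm hb f, coeFn_mulLp hm hb (mulLp hm hb f)] with x h1 h2
    rw [h2, h1, ← mul_assoc, ← ofReal_mul, h01]

/-- The Fourier multiplier with symbol `m`, an operator on `L²`. -/
noncomputable def fourierMul {m : ℝ → ℝ} (hm : Measurable m) (hb : ∀ x, |m x| ≤ 1) :
    Lp ℂ 2 (volume : Measure ℝ) →L[ℂ] Lp ℂ 2 (volume : Measure ℝ) :=
  (Lp.fourierTransformₗᵢ ℝ ℂ).symm.toContinuousLinearEquiv.toContinuousLinearMap ∘L
    mulLp hm hb ∘L (Lp.fourierTransformₗᵢ ℝ ℂ).toContinuousLinearEquiv.toContinuousLinearMap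

theorem fourier_fourierMul (f : Lp ℂ 2 (volume : Measure ℝ)) :
    (𝓕 (fourierMul hm hb f) : Lp ℂ 2 (volume : Measure ℝ)) =
      mulLp hm hb (𝓕 f : Lp ℂ 2 (volume : Measure ℝ)) :=
  (Lp.fourierTransformₗᵢ ℝ ℂ).apply_symm_apply _

theorem isOrthoProj_fourierMul (h01 : ∀ x, m x * m x = m x) : IsOrthoProj (fourierMul hm hb) where
  symm f g := by
    rw [← Lp.inner_fourier_eq, ← Lp.inner_fourier_eq f, fourier_fourierMul, fourier_fourierMul,
      inner_mulLp]
  idem f := by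
    apply (Lp.fourierTransformₗᵢ ℝ ℂ).injective
    change (𝓕 (fourierMul hm hb (fourierMul hm hb f)) : Lp ℂ 2 (volume : Measure ℝ)) =
      (𝓕 (fourierMul hm hb f) : Lp ℂ 2 (volume : Measure ℝ))
    rw [fourier_fourierMul, fourier_fourierMul, (isOrthoProj_mulLp hm hb h01).idem]

/-- The orthogonal projection onto the first `n + 1` scaled Hermite functions. -/
noncomputable def hermiteProj {α : ℝ} (hα : 0 < α) (n : ℕ) :
    Lp ℂ 2 (volume : Measure ℝ) →L[ℂ] Lp ℂ 2 (volume : Measure ℝ) :=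
  ∑ k ∈ Finset.range (n + 1), (innerSL ℂ (hermiteLp hα k)).smulRight (hermiteLp hα k)

theorem hermiteProj_apply {α : ℝ} (hα : 0 < α) (n : ℕ) (f : Lp ℂ 2 (volume : Measure ℝ)) :
    hermiteProj hα n f = ∑ k ∈ Finset.range (n + 1), ⟪hermiteLp hα k, f⟫_ℂ • hermiteLp hα k := by
  simp [hermiteProj]

theorem inner_hermiteLp_hermiteProj {α : ℝ} (hα : 0 < α) (n k : ℕ)
    (f : Lp ℂ 2 (volume : Measure ℝ)) :
    ⟪hermiteLp hα k, hermiteProj hα n f⟫_ℂ =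
      if k ∈ Finset.range (n + 1) then ⟪hermiteLp hα k, f⟫_ℂ else 0 := by
  rw [hermiteProj_apply, inner_sum]
  simp only [inner_smul_right, orthonormal_iff_ite.1 (orthonormal_hermiteLp hα)]
  simp

theorem isOrthoProj_hermiteProj {α : ℝ} (hα : 0 < α) (n : ℕ) :
    IsOrthoProj (hermiteProj hα n) where
  symm f g := by
    rw [hermiteProj_apply, hermiteProj_apply, sum_inner, inner_sum]
    refine Finset.sum_congr rfl fun k _ => ?_
    rw [inner_smul_left, inner_smul_right, inner_conj_symm, mul_comm]
  idem f := by
    rw [hermiteProj_apply hα n (hermiteProj hα n f), hermiteProj_apply hα n f]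
    refine Finset.sum_congr rfl fun k hk => ?_
    rw [← hermiteProj_apply, inner_hermiteLp_hermiteProj, if_pos hk]

theorem norm_hermiteProj_sq {α : ℝ} (hα : 0 < α) (n : ℕ) (f : Lp ℂ 2 (volume : Measure ℝ)) :
    ‖hermiteProj hα n f‖ ^ 2 = ∑ k ∈ Finset.range (n + 1), ‖⟪hermiteLp hα k, f⟫_ℂ‖ ^ 2 := by
  rw [← (isOrthoProj_hermiteProj hα n).re_inner_self', hermiteProj_apply, inner_sum, re_sum]
  refine Finset.sum_congr rfl fun k _ => ?_
  rw [inner_smul_right, ← inner_conj_symm f, Complex.mul_conj, Complex.normSq_eq_norm_sq, ofReal_re]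

end Multiplier

/-! ### Completeness of the Hermite functions -/

section Completeness

open Complex ComplexConjugate
open scoped InnerProductSpace

variable {α : ℝ}

theorem memLp_pow_mul_scaledHermiteFun (hα : 0 < α) (m k : ℕ) :
    MemLp (fun x => (((x / α) ^ m * hermiteFun k (x / α) : ℝ) : ℂ)) 2 := by
  suffices h : MemLp (fun x => (x / α) ^ m * hermiteFun k (x / α)) 2 from h.ofReal
  have hc : Continuous fun x : ℝ => (x / α) ^ m * hermiteFun k (x / α) := by
    have := continuous_hermiteFun k
    fun_prop
  rw [memLp_two_iff_integrable_sq hc.aestronglyMeasurable]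
  have h := (integrable_eval_mul_hermiteFun_mul (Polynomial.X ^ (2 * m)) k k).comp_div hα.ne'
  refine h.congr (Filter.Eventually.of_forall fun x => ?_)
  simp only [Polynomial.eval_pow, Polynomial.eval_X]
  ring

/-- A square integrable function orthogonal to all Hermite functions is orthogonal to all
products of monomials and Hermite functions. -/
theorem integral_mul_pow_mul_hermiteFun_eq_zero (hα : 0 < α) {v : ℝ → ℂ} (hv : MemLp v 2)
    (h : ∀ k, ∫ x, v x * hermiteFun k (x / α) = 0) (m k : ℕ) :
    ∫ x, v x * (((x / α) ^ m * hermiteFun k (x / α) : ℝ) : ℂ) = 0 := by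
  have hi : ∀ m k, Integrable fun x => v x * (((x / α) ^ m * hermiteFun k (x / α) : ℝ) : ℂ) :=
    fun m k => hv.integrable_mul (memLp_pow_mul_scaledHermiteFun hα m k)
  induction m generalizing k with
  | zero => simpa using h k
  | succ m ih =>
    rcases k with _ | k
    · have e : ∀ x : ℝ, v x * (((x / α) ^ (m + 1) * hermiteFun 0 (x / α) : ℝ) : ℂ) =
          ((-(Real.sqrt (2 * (0 : ℕ) + 2) / 2) : ℝ) : ℂ) *
            (v x * (((x / α) ^ m * hermiteFun (0 + 1) (x / α) : ℝ) : ℂ)) := fun x => by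
        have hr := (hasDerivAt_hermiteFun 0 (x / α)).unique (hasDerivAt_hermiteFun_aux 0 (x / α))
        simp only [hermiteP, Polynomial.derivative_one, Polynomial.eval_zero, mul_zero, zero_mul,
          zero_sub] at hr
        rw [mul_left_comm, ← ofReal_mul]
        congr 2
        rw [pow_succ]
        linear_combination (x / α) ^ m / 2 * hr
      simp_rw [e]
      rw [integral_const_mul, ih, mul_zero]
    · have e : ∀ x : ℝ, v x * (((x / α) ^ (m + 1) * hermiteFun (k + 1) (x / α) : ℝ) : ℂ) =
          ((-(Real.sqrt (2 * k + 2) / 2) : ℝ) : ℂ) *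
            (v x * (((x / α) ^ m * hermiteFun k (x / α) : ℝ) : ℂ)) +
          ((-(Real.sqrt (2 * ((k + 1 : ℕ) : ℝ) + 2) / 2) : ℝ) : ℂ) *
            (v x * (((x / α) ^ m * hermiteFun (k + 2) (x / α) : ℝ) : ℂ)) := fun x => by
        have hr := hermiteFun_recurrence k (x / α)
        rw [mul_left_comm, mul_left_comm _ (v x), ← mul_add, ← ofReal_mul, ← ofReal_mul,
          ← ofReal_add]
        congr 2
        rw [pow_succ]
        linear_combination (x / α) ^ m / 2 * hr
      simp_rw [e]
      rw [integral_add ((hi m k).const_mul _) ((hi m (k + 2)).const_mul _), integral_const_mul,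
        integral_const_mul, ih, ih, mul_zero, mul_zero, add_zero]

theorem hermiteFun_zero_pos (x : ℝ) : 0 < hermiteFun 0 x := by
  rw [hermiteFun_eq]
  have := hermiteConst_pos 0
  have := Real.exp_pos (-x ^ 2 / 2)
  simp only [hermiteP, Polynomial.eval_one, mul_one]
  positivity

/-- Half of the Gaussian absorbs the exponential, by `2|ωx| ≤ x²/(2α²) + 2ω²α²`. This gives the
dominating function for integrating a power series term by term. -/
theorem memLp_exp_abs_mul_hermiteFun_zero (hα : 0 < α) (ω : ℝ) :
    MemLp (fun x => Real.exp (|ω * x|) * hermiteFun 0 (x / α)) 2 := by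
  have hc : Continuous fun x : ℝ => Real.exp (|ω * x|) * hermiteFun 0 (x / α) := by
    have := continuous_hermiteFun 0
    fun_prop
  rw [memLp_two_iff_integrable_sq hc.aestronglyMeasurable]
  have h := (integrable_exp_neg_mul_sq (b := 1 / (2 * α ^ 2)) (by positivity)).const_mul
    (hermiteConst 0 ^ 2 * Real.exp (2 * ω ^ 2 * α ^ 2))
  refine h.mono' (hc.pow 2).aestronglyMeasurable (Filter.Eventually.of_forall fun x => ?_)
  rw [Real.norm_of_nonneg (by positivity), hermiteFun_eq]
  simp only [hermiteP, Polynomial.eval_one, mul_one]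
  rw [mul_pow, mul_pow, ← Real.exp_nat_mul, ← Real.exp_nat_mul, mul_left_comm, mul_assoc,
    ← Real.exp_add, ← Real.exp_add]
  refine mul_le_mul_of_nonneg_left (Real.exp_le_exp.2 ?_) (by positivity)
  rw [abs_mul]
  have e : (|x| / α / 1 - 2 * |ω| * α) ^ 2 = x ^ 2 / α ^ 2 - 4 * (|ω| * |x|) + 4 * ω ^ 2 * α ^ 2 := by
    rw [← sq_abs x, ← sq_abs ω]; field_simp; ring
  have h2 := sq_nonneg (|x| / α / 1 - 2 * |ω| * α)
  rw [e] at h2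
  have e3 : -(1 / (2 * α ^ 2)) * x ^ 2 = -(x ^ 2 / α ^ 2) / 2 := by field_simp
  rw [e3, div_pow]
  push_cast
  linarith

/-- Expanding `exp(-iωx)` in powers of `x` leaves integrals of `v` against monomials times `h_0`,
all of which vanish. -/
theorem angularFourier_mul_hermiteFun_zero_eq_zero (hα : 0 < α) {v : ℝ → ℂ} (hv : MemLp v 2)
    (h : ∀ k, ∫ x, v x * hermiteFun k (x / α) = 0) (ω : ℝ) :
    angularFourier volume (fun x => v x * hermiteFun 0 (x / α)) ω = 0 := by
  have hm : ∀ x : ℝ, HasSum (fun k : ℕ => (v x * hermiteFun 0 (x / α)) *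
      ((-(I * ω * x)) ^ k / (k.factorial : ℂ)))
      ((v x * hermiteFun 0 (x / α)) * cexp (-(I * ω * x))) := fun x => by
    have := NormedSpace.expSeries_div_hasSum_exp (𝔸 := ℂ) (-(I * ω * x))
    rw [← Complex.exp_eq_exp_ℂ] at this
    exact this.mul_left _
  have hb : Integrable fun x => ‖v x‖ * (Real.exp |ω * x| * hermiteFun 0 (x / α)) :=
    hv.norm.integrable_mul (memLp_exp_abs_mul_hermiteFun_zero hα ω)
  have hbs : ∀ x : ℝ, HasSum (fun k : ℕ => ‖v x‖ * hermiteFun 0 (x / α) *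
      (|ω * x| ^ k / (k.factorial : ℝ))) (‖v x‖ * (Real.exp |ω * x| * hermiteFun 0 (x / α))) :=
    fun x => by
      have := NormedSpace.expSeries_div_hasSum_exp (𝔸 := ℝ) |ω * x|
      rw [← Real.exp_eq_exp_ℝ] at this
      have h2 := this.mul_left (‖v x‖ * hermiteFun 0 (x / α))
      rwa [show ‖v x‖ * (Real.exp |ω * x| * hermiteFun 0 (x / α)) =
        ‖v x‖ * hermiteFun 0 (x / α) * Real.exp |ω * x| by ring]
  have hsum := hasSum_integral_of_dominated_convergence (μ := volume)
    (F := fun (k : ℕ) (x : ℝ) => (v x * hermiteFun 0 (x / α)) *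
      ((-(I * ω * x)) ^ k / (k.factorial : ℂ)))
    (f := fun x => (v x * hermiteFun 0 (x / α)) * cexp (-(I * ω * x)))
    (bound := fun k x => ‖v x‖ * hermiteFun 0 (x / α) * (|ω * x| ^ k / (k.factorial : ℝ)))
    (fun k => by
      have h0 := continuous_hermiteFun 0
      exact (hv.aestronglyMeasurable.mul (by fun_prop : Continuous fun x : ℝ =>
        (hermiteFun 0 (x / α) : ℂ)).aestronglyMeasurable).mul
        (by fun_prop : Continuous fun x : ℝ =>
          ((-(I * ω * x)) ^ k / (k.factorial : ℂ))).aestronglyMeasurable)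
    (fun k => Filter.Eventually.of_forall fun x => by
      rw [norm_mul, norm_mul, norm_div, norm_pow, norm_neg, norm_mul, norm_mul, norm_I, one_mul,
        norm_real, norm_real, norm_real, Real.norm_of_nonneg (hermiteFun_zero_pos _).le,
        Complex.norm_natCast, abs_mul, Real.norm_eq_abs, Real.norm_eq_abs])
    (Filter.Eventually.of_forall fun x => (hbs x).summable)
    (hb.congr (Filter.Eventually.of_forall fun x => (hbs x).tsum_eq.symm))
    (Filter.Eventually.of_forall hm)
  have hz : ∀ k : ℕ, ∫ x, (v x * hermiteFun 0 (x / α)) *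
      ((-(I * ω * x)) ^ k / (k.factorial : ℂ)) = 0 := fun k => by
    have e : ∀ x : ℝ, (v x * hermiteFun 0 (x / α)) * ((-(I * ω * x)) ^ k / (k.factorial : ℂ)) =
        ((-(I * ω * α)) ^ k / (k.factorial : ℂ)) *
          (v x * (((x / α) ^ k * hermiteFun 0 (x / α) : ℝ) : ℂ)) := fun x => by
      have hα' : (α : ℂ) ≠ 0 := by exact_mod_cast hα.ne'
      have : (-(I * ω * x)) = (-(I * ω * α)) * (x / α) := by field_simp
      rw [this, mul_pow]
      push_cast
      ring
    simp_rw [e]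
    rw [integral_const_mul, integral_mul_pow_mul_hermiteFun_eq_zero hα hv h, mul_zero]
  simp only [hz] at hsum
  exact hsum.unique hasSum_zero

/-- The Hermite functions are complete in `L²`. -/
theorem eq_zero_of_inner_hermiteLp_eq_zero (hα : 0 < α) (f : Lp ℂ 2 (volume : Measure ℝ))
    (h : ∀ k, ⟪hermiteLp hα k, f⟫_ℂ = 0) : f = 0 := by
  have hα' : α ^ (-(1 / 2) : ℝ) ≠ 0 := (Real.rpow_pos_of_pos hα _).ne'
  have hk : ∀ k, ∫ x, f x * (hermiteFun k (x / α) : ℂ) = 0 := fun k => by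
    have h1 := h k
    rw [inner_hermiteLp] at h1
    have e : ∀ x : ℝ, f x * (scaledHermiteFun α k x : ℂ) =
        ((α ^ (-(1 / 2) : ℝ) : ℝ) : ℂ) * (f x * (hermiteFun k (x / α) : ℂ)) := fun x => by
      rw [scaledHermiteFun]; push_cast; ring
    simp_rw [e] at h1
    rw [integral_const_mul] at h1
    exact (mul_eq_zero.1 h1).resolve_left (by exact_mod_cast hα')
  have hF := angularFourier_mul_hermiteFun_zero_eq_zero hα (Lp.memLp f) hk
  have hm := memLp_pow_mul_scaledHermiteFun hα 0 0
  simp only [pow_zero, one_mul] at hm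
  have hGi : Integrable fun x => f x * (hermiteFun 0 (x / α) : ℂ) := (Lp.memLp f).integrable_mul hm
  have hc0 : Continuous fun x : ℝ => (hermiteFun 0 (x / α) : ℂ) := by
    have := continuous_hermiteFun 0
    fun_prop
  have hG2 : MemLp (fun x => f x * (hermiteFun 0 (x / α) : ℂ)) 2 := by
    refine (Lp.memLp f).of_le_mul (c := hermiteConst 0)
      ((Lp.aestronglyMeasurable f).mul hc0.aestronglyMeasurable)
      (Filter.Eventually.of_forall fun x => ?_)
    rw [norm_mul, mul_comm, norm_real, Real.norm_of_nonneg (hermiteFun_zero_pos _).le, hermiteFun_eq]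
    simp only [hermiteP, Polynomial.eval_one, mul_one]
    gcongr
    refine mul_le_of_le_one_right (hermiteConst_pos 0).le (Real.exp_le_one_iff.2 ?_)
    have := sq_nonneg (x / α)
    linarith
  -- `G = f h_0` is integrable and square integrable with zero transform, so Plancherel gives `G =
  -- 0`. The Gaussian has no zeros, hence `f = 0`.
  set G := hG2.toLp _ with hG
  have hGae : G =ᵐ[volume] fun x => f x * (hermiteFun 0 (x / α) : ℂ) := hG2.coeFn_toLp
  have h1 := Lp_fourier_ae_eq G (hGi.congr hGae.symm)
  have h2 : ∀ ξ, 𝓕 (G : ℝ → ℂ) ξ = 0 := fun ξ => by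
    rw [fourier_eq_angularFourier, ← hF (2 * Real.pi * ξ), angularFourier, angularFourier]
    refine integral_congr_ae ?_
    filter_upwards [hGae] with x hx
    rw [hx]
  have h3 : (𝓕 G : Lp ℂ 2 (volume : Measure ℝ)) = 0 := by
    refine Lp.ext ?_
    filter_upwards [h1, Lp.coeFn_zero ℂ 2 (volume : Measure ℝ)] with ξ hξ hξ0
    rw [hξ, h2, hξ0]; rfl
  have h4 : G = 0 := by
    rw [← norm_eq_zero, ← Lp.norm_fourier_eq, h3, norm_zero]
  refine Lp.ext ?_
  rw [h4] at hGae
  filter_upwards [hGae, Lp.coeFn_zero ℂ 2 (volume : Measure ℝ)] with x hx hx0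
  rw [hx0] at hx ⊢
  have hne : (hermiteFun 0 (x / α) : ℂ) ≠ 0 := by exact_mod_cast (hermiteFun_zero_pos _).ne'
  exact (mul_eq_zero.1 hx.symm).resolve_right hne

/-- Parseval in the Hermite basis: the squared distance is the limit of partial sums over indices
above `n`, so finite tails bounded uniformly in `N` suffice. -/
theorem norm_sub_hermiteProj_sq_le (hα : 0 < α) {n : ℕ} {w : Lp ℂ 2 (volume : Measure ℝ)} {C : ℝ}
    (h : ∀ N, ∑ i : Fin N, ‖⟪hermiteLp hα (n + 1 + i), w⟫_ℂ‖ ^ 2 ≤ C) :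
    ‖w - hermiteProj hα n w‖ ^ 2 ≤ C := by
  set v := w - hermiteProj hα n w with hv
  have hspan : (Submodule.span ℂ (Set.range (hermiteLp hα)))ᗮ = ⊥ := by
    rw [Submodule.eq_bot_iff]
    intro f hf
    refine eq_zero_of_inner_hermiteLp_eq_zero hα f fun k => ?_
    exact (Submodule.mem_orthogonal _ f).1 hf _ (Submodule.subset_span ⟨k, rfl⟩)
  set B := HilbertBasis.mkOfOrthogonalEqBot (orthonormal_hermiteLp hα) hspan with hB
  have hBk : ∀ k, B k = hermiteLp hα k := fun k => by rw [hB, HilbertBasis.coe_mkOfOrthogonalEqBot]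
  have hs := (B.hasSum_inner_mul_inner v v).mapL reCLM
  have e : ∀ k, reCLM (⟪v, B k⟫_ℂ * ⟪B k, v⟫_ℂ) = ‖⟪hermiteLp hα k, v⟫_ℂ‖ ^ 2 := fun k => by
    rw [hBk, ← inner_conj_symm v, mul_comm, Complex.mul_conj, Complex.normSq_eq_norm_sq]
    simp only [reCLM_apply, ofReal_re]
  have e2 : reCLM ⟪v, v⟫_ℂ = ‖v‖ ^ 2 := @inner_self_eq_norm_sq ℂ _ _ _ _ v
  simp only [e, e2] at hs
  have hcoef : ∀ k, ⟪hermiteLp hα k, v⟫_ℂ =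
      if k ∈ Finset.range (n + 1) then 0 else ⟪hermiteLp hα k, w⟫_ℂ := fun k => by
    rw [hv, inner_sub_right, inner_hermiteLp_hermiteProj]
    split_ifs <;> simp
  refine le_of_tendsto' (hs.tendsto_sum_nat.comp (Filter.tendsto_add_atTop_nat (n + 1))) fun N => ?_
  simp only [Function.comp]
  rw [add_comm N, Finset.sum_range_add]
  have h0 : ∑ k ∈ Finset.range (n + 1), ‖⟪hermiteLp hα k, v⟫_ℂ‖ ^ 2 = 0 :=
    Finset.sum_eq_zero fun k hk => by rw [hcoef, if_pos hk]; simp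
  rw [h0, zero_add, ← Fin.sum_univ_eq_sum_range (fun i => ‖⟪hermiteLp hα (n + 1 + i), v⟫_ℂ‖ ^ 2)]
  refine le_trans (le_of_eq (Finset.sum_congr rfl fun i _ => ?_)) (h N)
  rw [hcoef, if_neg (by simp; omega)]

end Completeness

/-! ### Reduction to unit scale: time variable `x/α`, frequency variable `ω = 2π α ξ` -/

section Scaling

open Complex ComplexConjugate
open scoped InnerProductSpace

theorem integral_eq_smul_setIntegral_comp_mul {E : Type*} [NormedAddCommGroup E] [NormedSpace ℝ E]
    {α T : ℝ} (hα : 0 < α) {F : ℝ → E} (hF : ∀ᵐ x, T < |x| → F x = 0) :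
    ∫ x, F x = α • ∫ x in Set.Icc (-(T / α)) (T / α), F (α * x) := by
  have h1 : ∫ x, F x = ∫ x, (Set.Icc (-T) T).indicator F x := by
    refine integral_congr_ae ?_
    filter_upwards [hF] with x hx
    by_cases h : x ∈ Set.Icc (-T) T
    · rw [Set.indicator_of_mem h]
    · rw [Set.indicator_of_notMem h]
      exact hx (lt_of_not_ge fun h' => h (abs_le.1 h'))
  have h2 : ∀ x, (Set.Icc (-(T / α)) (T / α)).indicator (fun x => F (α * x)) x =
      (Set.Icc (-T) T).indicator F (α * x) := fun x => by
    have : x ∈ Set.Icc (-(T / α)) (T / α) ↔ α * x ∈ Set.Icc (-T) T := by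
      rw [Set.mem_Icc, Set.mem_Icc, le_div_iff₀' hα, ← neg_div, div_le_iff₀' hα]
    simp only [Set.indicator_apply, this]
  rw [h1, ← integral_indicator measurableSet_Icc, integral_congr_ae (Filter.Eventually.of_forall h2),
    Measure.integral_comp_mul_left, smul_smul, abs_of_pos (inv_pos.2 hα), mul_inv_cancel₀ hα.ne',
    one_smul]

variable {α T : ℝ} {z : Lp ℂ 2 (volume : Measure ℝ)}

/-- The dilate `√α z(α x)` of a function. -/
noncomputable def dilate (α : ℝ) (z : ℝ → ℂ) (x : ℝ) : ℂ := (Real.sqrt α : ℂ) * z (α * x)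

theorem integrable_of_ae_support (hz : ∀ᵐ x, T < |x| → z x = 0) : Integrable z := by
  have h : IntegrableOn z (Set.Icc (-T) T) :=
    ((Lp.memLp z).restrict _).integrable (by norm_num)
  refine h.integrable_of_ae_notMem_eq_zero ?_
  filter_upwards [hz] with x hx h'
  exact hx (lt_of_not_ge fun h'' => h' (abs_le.1 h''))

theorem integral_mul_eq_setIntegral_dilate_mul (hα : 0 < α) (hz : ∀ᵐ x, T < |x| → z x = 0)
    (g : ℝ → ℂ) :
    ∫ x, z x * g x = Real.sqrt α *
      ∫ x in Set.Icc (-(T / α)) (T / α), dilate α z x * g (α * x) := by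
  rw [integral_eq_smul_setIntegral_comp_mul (T := T) hα (by
    filter_upwards [hz] with x hx h using by rw [hx h, zero_mul]), ← integral_const_mul,
    ← integral_smul]
  congr 1; funext x
  rw [dilate, ← mul_assoc, ← mul_assoc, ← ofReal_mul, Real.mul_self_sqrt hα.le, real_smul, mul_assoc]

theorem memLp_dilate (hα : 0 < α) (hz : ∀ᵐ x, T < |x| → z x = 0) (s : Set ℝ) :
    MemLp (dilate α z) 2 (volume.restrict s) := by
  refine MemLp.restrict s (MemLp.const_mul ?_ _)
  rw [memLp_two_iff_integrable_sq_norm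
    ((integrable_of_ae_support hz).comp_mul_left' hα.ne').aestronglyMeasurable]
  exact ((memLp_two_iff_integrable_sq_norm (Lp.aestronglyMeasurable z)).1
    (Lp.memLp z)).comp_mul_left' hα.ne'

theorem norm_sq_eq_setIntegral_dilate (hα : 0 < α) (hz : ∀ᵐ x, T < |x| → z x = 0) :
    ‖z‖ ^ 2 = ∫ x in Set.Icc (-(T / α)) (T / α), ‖dilate α z x‖ ^ 2 := by
  rw [norm_Lp_sq, integral_eq_smul_setIntegral_comp_mul (T := T) hα (by
    filter_upwards [hz] with x hx h using by rw [hx h]; simp), ← integral_smul]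
  congr 1; funext x
  rw [dilate, norm_mul, mul_pow, norm_real, Real.norm_of_nonneg (Real.sqrt_nonneg _),
    Real.sq_sqrt hα.le, smul_eq_mul]

theorem sqrt_mul_rpow_neg_half (hα : 0 < α) : Real.sqrt α * α ^ (-(1 / 2) : ℝ) = 1 := by
  rw [Real.sqrt_eq_rpow, ← Real.rpow_add hα]; norm_num

theorem mul_rpow_neg_half (hα : 0 < α) : α * α ^ (-(1 / 2) : ℝ) = Real.sqrt α := by
  have h := congrArg (Real.sqrt α * ·) (sqrt_mul_rpow_neg_half hα)
  simpa only [← mul_assoc, Real.mul_self_sqrt hα.le, mul_one] using h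

theorem inner_hermiteLp_eq_setIntegral_dilate (hα : 0 < α) (hz : ∀ᵐ x, T < |x| → z x = 0)
    (k : ℕ) : ⟪hermiteLp hα k, z⟫_ℂ =
      ∫ x in Set.Icc (-(T / α)) (T / α), dilate α z x * hermiteFun k x := by
  rw [inner_hermiteLp, integral_mul_eq_setIntegral_dilate_mul hα hz, ← integral_const_mul]
  congr 1; funext x
  rw [scaledHermiteFun, mul_div_cancel_left₀ _ hα.ne', ofReal_mul, mul_left_comm,
    ← mul_assoc (Real.sqrt α : ℂ), ← ofReal_mul, sqrt_mul_rpow_neg_half hα, ofReal_one, one_mul]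

theorem fourier_ae_eq_angularFourier_dilate (hα : 0 < α) (hz : ∀ᵐ x, T < |x| → z x = 0) :
    (𝓕 z : Lp ℂ 2 (volume : Measure ℝ)) =ᵐ[volume] fun ξ => Real.sqrt α *
      angularFourier (volume.restrict (Set.Icc (-(T / α)) (T / α))) (dilate α z)
        (2 * Real.pi * α * ξ) := by
  filter_upwards [Lp_fourier_ae_eq z (integrable_of_ae_support hz)] with ξ hξ
  rw [hξ, fourier_eq_angularFourier, angularFourier,
    integral_mul_eq_setIntegral_dilate_mul hα hz, angularFourier]
  congr 2; funext x
  congr 2; push_cast; ring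

theorem fourier_hermiteLp_ae_eq (hα : 0 < α) (k : ℕ) :
    (𝓕 (hermiteLp hα k) : Lp ℂ 2 (volume : Measure ℝ)) =ᵐ[volume] fun ξ =>
      Real.sqrt α * (Real.sqrt (2 * Real.pi) * (-I) ^ k * hermiteFun k (2 * Real.pi * α * ξ)) := by
  have hc := coeFn_hermiteLp hα k
  have hi : Integrable fun x => (scaledHermiteFun α k x : ℂ) :=
    (((integrable_hermiteFun k).comp_div hα.ne').const_mul _).ofReal
  filter_upwards [Lp_fourier_ae_eq _ (hi.congr hc.symm)] with ξ hξ
  have h1 : angularFourier volume (hermiteLp hα k) (2 * Real.pi * ξ) =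
      ∫ x, (fun y : ℝ => (α ^ (-(1 / 2) : ℝ) : ℝ) * ((hermiteFun k y : ℂ) *
        cexp (-(I * ((2 * Real.pi * (α * ξ) : ℝ) : ℂ) * y)))) (x / α) := by
    refine integral_congr_ae ?_
    filter_upwards [hc] with x hx
    have hα' : (α : ℂ) ≠ 0 := by exact_mod_cast hα.ne'
    rw [hx, scaledHermiteFun, ofReal_mul, mul_assoc]
    congr 3
    push_cast
    field_simp
  have h2 := fourier_hermiteFun k (α * ξ)
  rw [fourier_eq_angularFourier, angularFourier] at h2
  rw [hξ, fourier_eq_angularFourier, h1, Measure.integral_comp_div (fun y : ℝ =>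
    ((α ^ (-(1 / 2) : ℝ) : ℝ) : ℂ) * ((hermiteFun k y : ℂ) *
      cexp (-(I * ((2 * Real.pi * (α * ξ) : ℝ) : ℂ) * y)))) α, integral_const_mul, h2,
    abs_of_pos hα, real_smul, ← mul_assoc, ← ofReal_mul, mul_rpow_neg_half hα]
  congr 3
  ring_nf

variable {M : ℝ → ℝ}

theorem norm_fourierMul_sq_eq (hα : 0 < α) (hz : ∀ᵐ x, T < |x| → z x = 0)
    (hm : Measurable fun ξ => M (2 * Real.pi * α * ξ))
    (hb : ∀ ξ, |M (2 * Real.pi * α * ξ)| ≤ 1) :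
    ‖fourierMul hm hb z‖ ^ 2 = 1 / (2 * Real.pi) * ∫ ω, M ω ^ 2 *
      ‖angularFourier (volume.restrict (Set.Icc (-(T / α)) (T / α))) (dilate α z) ω‖ ^ 2 := by
  have hκ : 0 < 2 * Real.pi * α := by positivity
  have h := Measure.integral_comp_mul_left (fun ω => α * (M ω ^ 2 *
    ‖angularFourier (volume.restrict (Set.Icc (-(T / α)) (T / α))) (dilate α z) ω‖ ^ 2))
    (2 * Real.pi * α)
  rw [← Lp.norm_fourier_eq, fourier_fourierMul, norm_Lp_sq]
  trans α * ((2 * Real.pi * α)⁻¹ * ∫ ω, M ω ^ 2 *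
      ‖angularFourier (volume.restrict (Set.Icc (-(T / α)) (T / α))) (dilate α z) ω‖ ^ 2)
  · rw [integral_const_mul, integral_const_mul, smul_eq_mul, abs_of_pos (inv_pos.2 hκ)] at h
    rw [mul_left_comm, ← h, ← integral_const_mul]
    refine integral_congr_ae ?_
    filter_upwards [coeFn_mulLp hm hb (𝓕 z), fourier_ae_eq_angularFourier_dilate hα hz] with ξ h1 h2
    rw [h1, h2, norm_mul, norm_mul, norm_real, norm_real, mul_pow, mul_pow,
      Real.norm_of_nonneg (Real.sqrt_nonneg _), Real.sq_sqrt hα.le, Real.norm_eq_abs, sq_abs]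
    ring
  · field_simp

/-- By Plancherel and the eigenfunction property, up to a unimodular `(-i)^k` the coefficients of
the filtered function are Hermite coefficients of `M` times the window transform. This lets Green's
formula act on the frequency side. -/
theorem norm_inner_hermiteLp_fourierMul_sq (hα : 0 < α) (hz : ∀ᵐ x, T < |x| → z x = 0)
    (hm : Measurable fun ξ => M (2 * Real.pi * α * ξ))
    (hb : ∀ ξ, |M (2 * Real.pi * α * ξ)| ≤ 1) (k : ℕ) :
    ‖⟪hermiteLp hα k, fourierMul hm hb z⟫_ℂ‖ ^ 2 = 1 / (2 * Real.pi) * ‖∫ ω, ((M ω : ℂ) *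
      angularFourier (volume.restrict (Set.Icc (-(T / α)) (T / α))) (dilate α z) ω) *
        hermiteFun k ω‖ ^ 2 := by
  have hκ : 0 < 2 * Real.pi * α := by positivity
  have hπ : 0 < 2 * Real.pi := by positivity
  set V := angularFourier (volume.restrict (Set.Icc (-(T / α)) (T / α))) (dilate α z)
  have h := Measure.integral_comp_mul_left (fun ω => (((α * Real.sqrt (2 * Real.pi) : ℝ) : ℂ) *
    conj ((-I) ^ k)) * (((M ω : ℂ) * V ω) * hermiteFun k ω)) (2 * Real.pi * α)
  have h1 : ⟪hermiteLp hα k, fourierMul hm hb z⟫_ℂ = ∫ ξ, (((α * Real.sqrt (2 * Real.pi) : ℝ) : ℂ) *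
      conj ((-I) ^ k)) * (((M (2 * Real.pi * α * ξ) : ℂ) * V (2 * Real.pi * α * ξ)) *
        hermiteFun k (2 * Real.pi * α * ξ)) := by
    rw [← Lp.inner_fourier_eq, fourier_fourierMul, L2.inner_def]
    refine integral_congr_ae ?_
    filter_upwards [coeFn_mulLp hm hb (𝓕 z), fourier_ae_eq_angularFourier_dilate hα hz,
      fourier_hermiteLp_ae_eq hα k] with ξ h1 h2 h3
    have e : ((α * Real.sqrt (2 * Real.pi) : ℝ) : ℂ) =
        Real.sqrt α * Real.sqrt α * Real.sqrt (2 * Real.pi) := by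
      rw [← ofReal_mul, Real.mul_self_sqrt hα.le, ofReal_mul]
    rw [h1, h2, h3, RCLike.inner_apply, map_mul, map_mul, map_mul, conj_ofReal, conj_ofReal,
      conj_ofReal, e]
    ring
  rw [h1, h, integral_const_mul, norm_smul, norm_mul, norm_mul, norm_real, RCLike.norm_conj,
    norm_pow, norm_neg, norm_I, one_pow, mul_one, Real.norm_of_nonneg (abs_nonneg _),
    abs_of_pos (inv_pos.2 hκ), Real.norm_of_nonneg (by positivity), mul_pow, mul_pow, mul_pow,
    Real.sq_sqrt hπ.le]
  field_simp

end Scaling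

/-! ### The two regimes and their assembly -/

section Main

open Complex
open scoped InnerProductSpace

theorem splineStep_nonneg (s : ℝ) : 0 ≤ splineStep s := by
  rcases le_or_gt s 0 with h | h
  · rw [(splineStep_of_nonpos h).1]; norm_num
  rcases le_or_gt s (1 / 2) with h' | h'
  · rw [splineStep, max_eq_left h.le, max_eq_right (by linarith), max_eq_right (by linarith)]
    nlinarith
  rcases le_or_gt s 1 with h'' | h''
  · rw [splineStep, max_eq_left h.le, max_eq_left (by linarith), max_eq_right (by linarith)]
    nlinarith
  · rw [(splineStep_of_one_le h''.le).1]

theorem cutoff_nonneg {b : ℝ} (hb : 0 < b) (ω : ℝ) : 0 ≤ cutoff b ω := by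
  have hb5 : 0 < b / 5 := by positivity
  rcases le_total 0 ω with h | h
  · have h1 := splineStep_nonneg ((ω - b / 2) / (b / 5))
    rw [cutoff, (splineStep_of_nonpos (s := (-ω - b / 2) / (b / 5))
      (div_nonpos_of_nonpos_of_nonneg (by linarith) hb5.le)).1]
    linarith
  · have h1 := splineStep_nonneg ((-ω - b / 2) / (b / 5))
    rw [cutoff, (splineStep_of_nonpos (s := (ω - b / 2) / (b / 5))
      (div_nonpos_of_nonpos_of_nonneg (by linarith) hb5.le)).1]
    linarith

theorem measurable_cutoff (b : ℝ) : Measurable (cutoff b) :=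
  (continuous_iff_continuousAt.2 fun ω => (hasDerivAt_cutoff ω).continuousAt).measurable

/-- The indicator function of `[-R, R]`. -/
noncomputable def window (R : ℝ) : ℝ → ℝ := (Set.Icc (-R) R).indicator 1

theorem measurable_window (R : ℝ) : Measurable (window R) :=
  measurable_one.indicator measurableSet_Icc

theorem window_eq (R x : ℝ) : window R x = if |x| ≤ R then 1 else 0 := by
  simp [window, Set.indicator_apply, abs_le]

theorem abs_window_le (R x : ℝ) : |window R x| ≤ 1 := by
  rw [window_eq]; split_ifs <;> norm_num

theorem window_mul_self (R x : ℝ) : window R x * window R x = window R x := by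
  rw [window_eq]; split_ifs <;> norm_num

theorem norm_fourierMul_le {m : ℝ → ℝ} (hm : Measurable m) (hb : ∀ x, |m x| ≤ 1)
    (f : Lp ℂ 2 (volume : Measure ℝ)) : ‖fourierMul hm hb f‖ ≤ ‖f‖ := by
  rw [← Lp.norm_fourier_eq, fourier_fourierMul, ← Lp.norm_fourier_eq f]
  exact norm_mulLp_le hm hb _

theorem fourier_sub_fourierMul {m : ℝ → ℝ} (hm : Measurable m) (hb : ∀ x, |m x| ≤ 1)
    (f : Lp ℂ 2 (volume : Measure ℝ)) :
    (𝓕 (f - fourierMul hm hb f) : Lp ℂ 2 (volume : Measure ℝ)) = 𝓕 f - mulLp hm hb (𝓕 f) := by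
  rw [← fourier_fourierMul]
  exact map_sub (Lp.fourierTransformₗᵢ ℝ ℂ) _ _

theorem coeFn_sub_mulLp {m : ℝ → ℝ} (hm : Measurable m) (hb : ∀ x, |m x| ≤ 1)
    (f : Lp ℂ 2 (volume : Measure ℝ)) :
    f - mulLp hm hb f =ᵐ[volume] fun x => ((1 - m x : ℝ) : ℂ) * f x := by
  filter_upwards [Lp.coeFn_sub f (mulLp hm hb f), coeFn_mulLp hm hb f] with x h1 h2
  rw [h1, Pi.sub_apply, h2]
  push_cast; ring

theorem norm_sub_fourierMul_le_of_le {m m' : ℝ → ℝ} (hm : Measurable m) (hb : ∀ x, |m x| ≤ 1)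
    (hm' : Measurable m') (hb' : ∀ x, |m' x| ≤ 1) (h : ∀ x, |1 - m x| ≤ |1 - m' x|)
    (f : Lp ℂ 2 (volume : Measure ℝ)) :
    ‖f - fourierMul hm hb f‖ ≤ ‖f - fourierMul hm' hb' f‖ := by
  rw [← Lp.norm_fourier_eq, fourier_sub_fourierMul,
    ← Lp.norm_fourier_eq (f - fourierMul hm' hb' f), fourier_sub_fourierMul]
  refine Lp.norm_le_norm_of_ae_le ?_
  filter_upwards [coeFn_sub_mulLp hm hb (𝓕 f), coeFn_sub_mulLp hm' hb' (𝓕 f)] with x h1 h2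
  rw [h1, h2, norm_mul, norm_mul, norm_real, norm_real]
  exact mul_le_mul_of_nonneg_right (h x) (norm_nonneg _)

theorem norm_sub_mulLp_sq {m : ℝ → ℝ} (hm : Measurable m) (hb : ∀ x, |m x| ≤ 1) {s : Set ℝ}
    (hs : MeasurableSet s) (h0 : ∀ x ∈ s, m x = 0) (h1 : ∀ x ∉ s, m x = 1)
    (f : Lp ℂ 2 (volume : Measure ℝ)) :
    ‖f - mulLp hm hb f‖ ^ 2 = ∫ x in s, ‖f x‖ ^ 2 := by
  rw [norm_Lp_sq, ← integral_indicator hs]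
  refine integral_congr_ae ?_
  filter_upwards [coeFn_sub_mulLp hm hb f] with x hx
  rw [hx]
  by_cases h : x ∈ s
  · rw [Set.indicator_of_mem h, h0 x h]; simp
  · rw [Set.indicator_of_notMem h, h1 x h]; simp

/-- The restriction to `[-T, T]`, as an operator on `L²`. -/
noncomputable abbrev timeProj (T : ℝ) :
    Lp ℂ 2 (volume : Measure ℝ) →L[ℂ] Lp ℂ 2 (volume : Measure ℝ) :=
  mulLp (measurable_window T) (abs_window_le T)

theorem measurable_window_dilated (α c : ℝ) : Measurable fun ξ => window c (2 * Real.pi * α * ξ) :=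
  (measurable_window c).comp (measurable_const_mul _)

/-- The restriction of the angular frequency to `[-c / α, c / α]`, as an operator on `L²`. -/
noncomputable abbrev bandProj (α c : ℝ) :
    Lp ℂ 2 (volume : Measure ℝ) →L[ℂ] Lp ℂ 2 (volume : Measure ℝ) :=
  fourierMul (measurable_window_dilated α c) fun ξ => abs_window_le c (2 * Real.pi * α * ξ)

theorem measurableSet_lt_abs (R : ℝ) : MeasurableSet {t : ℝ | R < |t|} :=
  measurableSet_lt measurable_const measurable_id.abs

theorem IsAlmostTimeLimited.norm_sub_timeProj_le {ε T : ℝ} {f : Lp ℂ 2 (volume : Measure ℝ)}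
    (hε : 0 ≤ ε) (h : IsAlmostTimeLimited ε T f) : ‖f - timeProj T f‖ ≤ ε * ‖f‖ := by
  refine (sq_le_sq₀ (norm_nonneg _) (by positivity)).1 ?_
  rw [mul_pow, norm_sub_mulLp_sq (s := {t : ℝ | T < |t|}) _ _ (measurableSet_lt_abs T)
    (fun x hx => by rw [window_eq, if_neg (not_le.2 hx)])
    (fun x hx => by rw [window_eq, if_pos (not_lt.1 hx)])]
  exact h

theorem IsAlmostBandLimited.norm_sub_bandProj_le {ε α c : ℝ} {f : Lp ℂ 2 (volume : Measure ℝ)}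
    (hα : 0 < α) (hε : 0 ≤ ε) (h : IsAlmostBandLimited ε (c / α) f) :
    ‖f - bandProj α c f‖ ≤ ε * ‖f‖ := by
  refine (sq_le_sq₀ (norm_nonneg _) (by positivity)).1 ?_
  have hπ : 0 < 2 * Real.pi := by positivity
  have hms : MeasurableSet {ξ : ℝ | c < |2 * Real.pi * α * ξ|} :=
    measurableSet_lt measurable_const (measurable_const_mul _).abs
  rw [mul_pow, ← Lp.norm_fourier_eq, fourier_sub_fourierMul,
    norm_sub_mulLp_sq (s := {ξ : ℝ | c < |2 * Real.pi * α * ξ|}) _ _ hms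
    (fun x hx => by rw [window_eq, if_neg (not_le.2 hx)])
    (fun x hx => by rw [window_eq, if_pos (not_lt.1 hx)])]
  refine le_trans (le_of_eq ?_) h
  rw [← integral_indicator hms, ← integral_indicator (measurableSet_lt_abs _)]
  have h1 := Measure.integral_comp_div (fun ξ => 1 / (2 * Real.pi) *
    {ξ : ℝ | c < |2 * Real.pi * α * ξ|}.indicator
      (fun x => ‖(𝓕 f : Lp ℂ 2 (volume : Measure ℝ)) x‖ ^ 2) ξ) (2 * Real.pi)
  rw [integral_const_mul, integral_const_mul, abs_of_pos hπ, smul_eq_mul,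
    ← mul_assoc (2 * Real.pi), mul_one_div_cancel hπ.ne', one_mul] at h1
  rw [← h1, ← integral_const_mul]
  congr 1; funext ω
  have e : ω / (2 * Real.pi) ∈ {ξ : ℝ | c < |2 * Real.pi * α * ξ|} ↔
      ω ∈ {ω : ℝ | c / α < |ω|} := by
    rw [Set.mem_ofPred_eq, Set.mem_ofPred_eq, div_lt_iff₀ hα,
      show 2 * Real.pi * α * (ω / (2 * Real.pi)) = ω * α by field_simp, abs_mul, abs_of_pos hα]
  simp only [Set.indicator_apply, e]
  split_ifs
  · rw [unitaryFourier, norm_mul, mul_pow, norm_real, Real.norm_of_nonneg (by positivity), div_pow,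
      one_pow, Real.sq_sqrt hπ.le]
  · rw [mul_zero]

theorem eLpNorm_restrict_sub_scaledHermiteProj {α : ℝ} (hα : 0 < α) (T : ℝ) (n : ℕ)
    (f : Lp ℂ 2 (volume : Measure ℝ)) :
    eLpNorm (fun x : ℝ => f x - scaledHermiteProj α n f x) 2 (volume.restrict (Set.Icc (-T) T)) =
      ENNReal.ofReal ‖timeProj T (f - hermiteProj hα n f)‖ := by
  rw [← eLpNorm_indicator_eq_eLpNorm_restrict measurableSet_Icc, ofReal_norm, Lp.enorm_def]
  refine eLpNorm_congr_ae ?_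
  have hK : hermiteProj hα n f =ᵐ[volume] scaledHermiteProj α n f := by
    rw [hermiteProj_apply]
    have hk : ∀ k, (⟪hermiteLp hα k, f⟫_ℂ • hermiteLp hα k : Lp ℂ 2 (volume : Measure ℝ)) =ᵐ[volume]
        fun x => (∫ y : ℝ, f y * (scaledHermiteFun α k y : ℂ)) * (scaledHermiteFun α k x : ℂ) :=
      fun k => by
        filter_upwards [Lp.coeFn_smul ⟪hermiteLp hα k, f⟫_ℂ (hermiteLp hα k),
          coeFn_hermiteLp hα k] with x h1 h2
        rw [h1, Pi.smul_apply, h2, inner_hermiteLp, smul_eq_mul]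
    filter_upwards [Lp.coeFn_finsetSum (Finset.range (n + 1)) fun k =>
      (⟪hermiteLp hα k, f⟫_ℂ • hermiteLp hα k : Lp ℂ 2 (volume : Measure ℝ)),
      ae_all_iff.2 hk] with x h1 h2
    rw [h1, Finset.sum_apply, scaledHermiteProj]
    exact Finset.sum_congr rfl fun k _ => h2 k
  filter_upwards [hK, coeFn_mulLp (measurable_window T) (abs_window_le T) (f - hermiteProj hα n f),
    Lp.coeFn_sub f (hermiteProj hα n f)] with x h1 h2 h3
  rw [h2, h3, Pi.sub_apply, h1, window, Set.indicator_apply, Set.indicator_apply]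
  split_ifs <;> simp

theorem ae_eq_zero_of_timeProj_eq {T : ℝ} {z : Lp ℂ 2 (volume : Measure ℝ)}
    (hz : timeProj T z = z) : ∀ᵐ x, T < |x| → z x = 0 := by
  have h := coeFn_mulLp (measurable_window T) (abs_window_le T) z
  rw [hz] at h
  filter_upwards [h] with x hx hT
  rw [hx, window_eq, if_neg (not_le.2 hT)]; simp

theorem norm_bandProj_sq {α T c : ℝ} (hα : 0 < α) (hc : 0 ≤ c) {z : Lp ℂ 2 (volume : Measure ℝ)}
    (hz : ∀ᵐ x, T < |x| → z x = 0) :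
    ‖bandProj α c z‖ ^ 2 = 1 / (2 * Real.pi) * ∫ ω in (-c)..c,
      ‖angularFourier (volume.restrict (Set.Icc (-(T / α)) (T / α))) (dilate α z) ω‖ ^ 2 := by
  rw [norm_fourierMul_sq_eq (M := window c) hα hz, intervalIntegral.integral_of_le (by linarith),
    ← integral_Icc_eq_integral_Ioc, ← integral_indicator measurableSet_Icc]
  congr 2; funext ω
  rw [window, Set.indicator_apply, Set.indicator_apply]
  split_ifs <;> simp

/-- The pointwise bound on the transform is integrated over a band of length `2c`. With `c ≤ b/2`
the constant is at most `t/π`, which is the spectral gap needed in the small regime. -/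
theorem norm_bandProj_sq_le {α T c : ℝ} (hα : 0 < α) (hT : 0 ≤ T) (hc : 0 ≤ c)
    {z : Lp ℂ 2 (volume : Measure ℝ)} (hz : ∀ᵐ x, T < |x| → z x = 0) :
    ‖bandProj α c z‖ ^ 2 ≤ 2 * (T / α) * c / Real.pi * ‖z‖ ^ 2 := by
  have hu := memLp_dilate hα hz (Set.Icc (-(T / α)) (T / α))
  have hT' : 0 ≤ T / α := by positivity
  have hcont := continuous_angularFourier (hu.integrable (by norm_num))
  have h := intervalIntegral.integral_mono_on (a := -c) (b := c) (by linarith)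
    ((hcont.norm.pow 2).intervalIntegrable _ _) (intervalIntegrable_const (μ := volume))
    fun ω _ => norm_angularFourier_sq_le hT' hu ω
  rw [intervalIntegral.integral_const, ← norm_sq_eq_setIntegral_dilate hα hz, smul_eq_mul] at h
  rw [norm_bandProj_sq hα hc hz]
  calc _ ≤ 1 / (2 * Real.pi) * ((c - -c) * (2 * (T / α) * ‖z‖ ^ 2)) :=
        mul_le_mul_of_nonneg_left h (by positivity)
    _ = _ := by field_simp; ring

theorem norm_bandProj_sq_le_hermiteProj {α T c : ℝ} {n : ℕ} (hα : 0 < α) (hn : 1 ≤ n) (hT : 0 ≤ T)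
    (hc0 : 0 ≤ c) (hc : c ≤ Real.sqrt (2 * n + 2) / 2)
    (hTb : T / α * Real.sqrt (2 * n + 2) ≤ 2.2)
    (hT3 : 24 * (T / α) ^ 3 ≤ Real.sqrt (2 * n + 2))
    {z : Lp ℂ 2 (volume : Measure ℝ)} (hz : ∀ᵐ x, T < |x| → z x = 0) :
    ‖bandProj α c z‖ ^ 2 ≤ ‖hermiteProj hα n z‖ ^ 2 + (T / α) ^ 3 / Real.sqrt (2 * n + 2) *
      (0.45 * (T / α * Real.sqrt (2 * n + 2)) ^ 2 + 0.9 * (T / α * Real.sqrt (2 * n + 2)) + 0.25) *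
        ‖z‖ ^ 2 := by
  have h := integral_band_le_hermite hn (by positivity) hc0 hc hTb hT3
    (memLp_dilate hα hz (Set.Icc (-(T / α)) (T / α)))
  rw [← norm_sq_eq_setIntegral_dilate hα hz] at h
  rw [norm_bandProj_sq hα hc0 hz, norm_hermiteProj_sq]
  simp only [inner_hermiteLp_eq_setIntegral_dilate hα hz]
  rw [one_div_mul_eq_div, div_le_iff₀' (by positivity)]
  exact h

/-- The Fourier multiplier with symbol a dilated smooth cutoff. -/
noncomputable abbrev smoothBand (α : ℝ) {b : ℝ} (hb : 0 < b) :
    Lp ℂ 2 (volume : Measure ℝ) →L[ℂ] Lp ℂ 2 (volume : Measure ℝ) :=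
  fourierMul (m := fun ξ => cutoff b (2 * Real.pi * α * ξ))
    ((measurable_cutoff b).comp (measurable_const_mul _)) fun _ => (cutoff_bounds hb _).1

theorem norm_smoothBand_sub_hermiteProj_le {α T b : ℝ} {n : ℕ} (hα : 0 < α) (hT : 0 ≤ T)
    (hb : 0 < b) (hbn : b = Real.sqrt (2 * n + 2)) (hTb : 2.2 ≤ T / α * b)
    {z : Lp ℂ 2 (volume : Measure ℝ)} (hz : ∀ᵐ x, T < |x| → z x = 0) :
    ‖smoothBand α hb z - hermiteProj hα n (smoothBand α hb z)‖ ≤ 24 * (T / α) ^ 3 / b * ‖z‖ := by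
  refine (sq_le_sq₀ (norm_nonneg _) (by positivity)).1
    (norm_sub_hermiteProj_sq_le hα fun N => ?_)
  have h := norm_hermiteTail_cutoff_angularFourier_le (n := n) (by positivity)
    (by rw [← hbn]; exact hTb) (memLp_dilate hα hz (Set.Icc (-(T / α)) (T / α))) N
  rw [← norm_sq_eq_setIntegral_dilate hα hz, norm_hermiteTail_sq, ← hbn] at h
  simp only [norm_inner_hermiteLp_fourierMul_sq (M := cutoff b) hα hz]
  rw [← Finset.mul_sum, one_div_mul_eq_div, div_le_iff₀' (by positivity), mul_pow]
  exact h

/-- `1 - K` is applied to the three pieces `f - Φf`, `Φ(f - Af)` and `ΦAf`. It is a contraction on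
the first two, and the third is the Hermite tail of a smoothly band-limited window function. -/
theorem norm_timeProj_sub_hermiteProj_le_of_large {α T c b : ℝ} {n : ℕ} (hα : 0 < α) (hT : 0 ≤ T)
    (hb : 0 < b) (hbn : b = Real.sqrt (2 * n + 2)) (hc : c ≤ b / 2) (hTb : 2.2 ≤ T / α * b)
    (f : Lp ℂ 2 (volume : Measure ℝ)) :
    ‖timeProj T (f - hermiteProj hα n f)‖ ≤ ‖f - bandProj α c f‖ + ‖f - timeProj T f‖ +
      24 * (T / α) ^ 3 / b * ‖f‖ := by
  have hA : IsOrthoProj (timeProj T) := isOrthoProj_mulLp _ _ (window_mul_self T)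
  have hK := isOrthoProj_hermiteProj hα n
  set Φ := smoothBand α hb with hΦ
  -- The cutoff equals 1 wherever the sharp band does, because `c ≤ b/2`, and lies in `[0, 1]`
  -- elsewhere.
  have h1 : ‖f - Φ f‖ ≤ ‖f - bandProj α c f‖ := by
    refine norm_sub_fourierMul_le_of_le _ _ _ _ (fun ξ => ?_) f
    rw [window_eq]
    split_ifs with h
    · rw [(cutoff_of_abs_le hb (h.trans hc)).1]
    · have h2 := cutoff_nonneg hb (2 * Real.pi * α * ξ)
      have h3 := abs_le.1 (cutoff_bounds hb (2 * Real.pi * α * ξ)).1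
      rw [abs_le]; constructor <;> norm_num <;> linarith
  have h2 : ‖Φ (f - timeProj T f)‖ ≤ ‖f - timeProj T f‖ := norm_fourierMul_le _ _ _
  have h3 := norm_smoothBand_sub_hermiteProj_le (n := n) hα hT hb hbn hTb
    (ae_eq_zero_of_timeProj_eq (hA.idem f))
  have e : f - hermiteProj hα n f =
      ((f - Φ f) - hermiteProj hα n (f - Φ f)) +
      ((Φ (f - timeProj T f)) - hermiteProj hα n (Φ (f - timeProj T f))) +
      (Φ (timeProj T f) - hermiteProj hα n (Φ (timeProj T f))) := by
    simp only [map_sub]; abel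
  calc ‖timeProj T (f - hermiteProj hα n f)‖ ≤ ‖f - hermiteProj hα n f‖ := hA.norm_le _
    _ ≤ ‖(f - Φ f) - hermiteProj hα n (f - Φ f)‖ +
        ‖(Φ (f - timeProj T f)) - hermiteProj hα n (Φ (f - timeProj T f))‖ +
        ‖Φ (timeProj T f) - hermiteProj hα n (Φ (timeProj T f))‖ := by
      conv_lhs => rw [e]
      exact norm_add₃_le
    _ ≤ _ := add_le_add (add_le_add ((hK.norm_sub_le _).trans h1) ((hK.norm_sub_le _).trans h2))
      (h3.trans (mul_le_mul_of_nonneg_left (hA.norm_le f) (by positivity)))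

/-- The three-projection lemma with gap `δ = 1 - t/π`, positive because `t ≤ 2.2 < π`, and with `ε`
from the comparison of band and Hermite energies. -/
theorem norm_timeProj_sub_hermiteProj_le_of_small {α T c b : ℝ} {n : ℕ} (hα : 0 < α) (hn : 1 ≤ n)
    (hT : 0 ≤ T) (hbn : b = Real.sqrt (2 * n + 2)) (hc0 : 0 ≤ c) (hc : c ≤ b / 2)
    (hTb : T / α * b ≤ 2.2) (hT3 : 24 * (T / α) ^ 3 ≤ b) (f : Lp ℂ 2 (volume : Measure ℝ)) :
    ‖timeProj T (f - hermiteProj hα n f)‖ ≤ ‖f - bandProj α c f‖ + ‖f - timeProj T f‖ +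
      24 * (T / α) ^ 3 / b * ‖f‖ := by
  have hA : IsOrthoProj (timeProj T) := isOrthoProj_mulLp _ _ (window_mul_self T)
  have hQ : IsOrthoProj (bandProj α c) := isOrthoProj_fourierMul _ _ fun _ => window_mul_self c _
  have hb : 0 < b := by rw [hbn]; positivity
  have hT' : 0 ≤ T / α := by positivity
  set t := T / α * b with ht
  have ht0 : 0 ≤ t := by positivity
  have hπ := Real.pi_gt_d2
  have htπ : t / Real.pi ≤ t / 3.14 := div_le_div_of_nonneg_left ht0 (by norm_num) hπ.le
  have hδ : 0 < 1 - t / Real.pi := by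
    have : t / 3.14 < 1 := by rw [div_lt_one (by norm_num)]; linarith
    linarith
  have hε : 0 ≤ (T / α) ^ 3 / b * (0.45 * t ^ 2 + 0.9 * t + 0.25) := by positivity
  refine (IsOrthoProj.norm_apply_sub_le hA hQ (isOrthoProj_hermiteProj hα n) hδ
    (sub_le_self _ (by positivity)) hε (fun z hz => ?_) (fun z hz => ?_) f).trans ?_
  · refine (norm_bandProj_sq_le hα hT hc0 (ae_eq_zero_of_timeProj_eq hz)).trans ?_
    rw [sub_sub_cancel]
    refine mul_le_mul_of_nonneg_right (div_le_div_of_nonneg_right ?_ Real.pi_pos.le) (by positivity)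
    rw [ht, mul_right_comm, mul_comm]
    nlinarith
  · have := norm_bandProj_sq_le_hermiteProj hα hn hT hc0 (hbn ▸ hc) (hbn ▸ hTb) (hbn ▸ hT3)
      (ae_eq_zero_of_timeProj_eq hz)
    rw [← hbn] at this
    exact this
  · refine add_le_add_right (mul_le_mul_of_nonneg_right ?_ (norm_nonneg _)) _
    -- At `t = 2.2` the sides are about `4.41` and `4.79`. The factor 16 is chosen so that `3/2 · 16
    -- = 24`.
    have h1 : 0.45 * t ^ 2 + 0.9 * t + 0.25 ≤ 16 * (1 - t / Real.pi) := by
      have : t / 3.14 ≤ 0.31848 * t := by rw [div_le_iff₀ (by norm_num)]; nlinarith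
      nlinarith
    calc 3 / 2 * ((T / α) ^ 3 / b * (0.45 * t ^ 2 + 0.9 * t + 0.25) / (1 - t / Real.pi))
        ≤ 3 / 2 * ((T / α) ^ 3 / b * 16) := by
          refine mul_le_mul_of_nonneg_left ?_ (by norm_num)
          rw [div_le_iff₀ hδ, mul_assoc]
          exact mul_le_mul_of_nonneg_left h1 (by positivity)
      _ = _ := by ring

end Main

theorem mainTheorem6 (α T c εT εc : ℝ) (hα : 0 < α) (hT : 2 ≤ T) (hc : 2 / α ≤ c)
    (hεT : 0 ≤ εT) (hεc : 0 ≤ εc) (f : Lp ℂ 2 (volume : Measure ℝ))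
    (htime : IsAlmostTimeLimited εT T f) (hband : IsAlmostBandLimited εc (c / α) f)
    (n : ℕ) (hn : max (2 * (T / α) ^ 2) (2 * c ^ 2) ≤ (n : ℝ)) :
    eLpNorm (fun x : ℝ => f x - scaledHermiteProj α n f x) 2
        (volume.restrict (Set.Icc (-T) T)) ≤
      ENNReal.ofReal
        ((εT + εc + 24 * (T / α) ^ 3 / Real.sqrt (2 * (n : ℝ) + 1)) * ‖f‖) := by
  rw [eLpNorm_restrict_sub_scaledHermiteProj hα]
  refine ENNReal.ofReal_le_ofReal ?_
  have hT0 : 0 ≤ T := by linarith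
  have hc0 : 0 < c := lt_of_lt_of_le (by positivity) hc
  have hnc : 2 * c ^ 2 ≤ n := (le_max_right _ _).trans hn
  have hn1 : 1 ≤ n := by
    have : (0 : ℝ) < n := lt_of_lt_of_le (by positivity) hnc
    exact_mod_cast this
  have hT3 : 0 ≤ 24 * (T / α) ^ 3 := by positivity
  have hN : 0 < Real.sqrt (2 * (n : ℝ) + 1) := by positivity
  -- `√(2n+2)` is the coefficient in the ladder relations, hence the natural frequency. Passing back
  -- to `√(2n+1)` only weakens the bound.
  obtain ⟨b, hbn⟩ : ∃ b, b = Real.sqrt (2 * (n : ℝ) + 2) := ⟨_, rfl⟩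
  have hNb : Real.sqrt (2 * (n : ℝ) + 1) ≤ b := by
    rw [hbn]; exact Real.sqrt_le_sqrt (by linarith)
  have hb : 0 < b := hN.trans_le hNb
  have hcb : c ≤ b / 2 := by
    have hb2 : b ^ 2 = 2 * n + 2 := by rw [hbn, Real.sq_sqrt (by positivity)]
    nlinarith
  have ht := htime.norm_sub_timeProj_le hεT
  have hq := hband.norm_sub_bandProj_le hα hεc
  have hη : 24 * (T / α) ^ 3 / b * ‖f‖ ≤
      24 * (T / α) ^ 3 / Real.sqrt (2 * (n : ℝ) + 1) * ‖f‖ :=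
    mul_le_mul_of_nonneg_right (div_le_div_of_nonneg_left hT3 hN hNb) (norm_nonneg _)
  have key : ‖timeProj T (f - hermiteProj hα n f)‖ ≤ ‖f - bandProj α c f‖ + ‖f - timeProj T f‖ +
      24 * (T / α) ^ 3 / b * ‖f‖ → ‖timeProj T (f - hermiteProj hα n f)‖ ≤
      (εT + εc + 24 * (T / α) ^ 3 / Real.sqrt (2 * (n : ℝ) + 1)) * ‖f‖ := fun h => by
    rw [add_mul, add_mul]
    linarith
  rcases le_total 2.2 (T / α * b) with h | h
  · exact key (norm_timeProj_sub_hermiteProj_le_of_large hα hT0 hb hbn hcb h f)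
  -- If the claimed remainder is at least 1 there is nothing to prove; otherwise `24 (T/α)³ ≤ b`, as
  -- the small regime requires.
  rcases le_or_gt (Real.sqrt (2 * (n : ℝ) + 1)) (24 * (T / α) ^ 3) with h' | h'
  · have h1 : ‖timeProj T (f - hermiteProj hα n f)‖ ≤ ‖f‖ :=
      (norm_mulLp_le _ _ _).trans ((isOrthoProj_hermiteProj hα n).norm_sub_le f)
    refine h1.trans (le_mul_of_one_le_left (norm_nonneg _) ?_)
    have := (one_le_div hN).2 h'
    linarith
  · exact key (norm_timeProj_sub_hermiteProj_le_of_small hα hn1 hT0 hbn hc0.le hcb h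
      (h'.le.trans hNb) f)
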